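/- Let $p$ be a prime, let $\mathbb{Z}_p^{\mathrm{cycl}}$ be the $p$-adic completion of $\mathbb{Z}_p[\zeta_{p^\infty}]$, and fix a compatible system $(1,\zeta_p,\zeta_{p^2},\ldots)$ of primitive $p$-power roots of unity, i.e. a topological generator $\gamma$ of $\Gamma:=\mathbb{Z}_p(1)$. Let $S:=\mathbb{Z}_p^{\mathrm{cycl}}\langle\kappa,T^{\pm1}\rangle$ and $S_\infty:=\mathbb{Z}_p^{\mathrm{cycl}}\langle\kappa,T^{\pm1/p^\infty}\rangle$ be the $p$-adic completions of $\mathbb{Z}_p^{\mathrm{cycl}}[\kappa,T^{\pm1}]$ and $\mathbb{Z}_p^{\mathrm{cycl}}[\kappa,T^{\pm1/p^\infty}]$. The group $\Gamma$ acts continuously and $S$-linearly on $S_\infty$ by $\gamma(T^{1/p^k})=\zeta_{p^k}T^{1/p^k}$. Let $B^+:=\widehat{\bigoplus}_{n\ge0}S_\infty\frac{x^n}{n!}$ be the $p$-completed divided power polynomial algebra on one variable $x$ over $S_\infty$, put $c:=(\zeta_p-1)\kappa\in S$, and extend the action of $\Gamma$ on $S_\infty$ to the continuous action on the ring $B^+$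 with $\gamma(x)=x+c$ (so $\gamma^a(x)=x+ac$ for $a\in\mathbb{Z}_p$). Then there is $n\in\mathbb{N}$ such that for every $p$-adically complete $S$-algebra $R$, the cofiber, in the derived category of $R$-modules, of the natural map $$R\to R\Gamma(\Gamma,B^+\widehat{\otimes}_SR)$$ is killed by $(cp)^n$, i.e. multiplication by $(cp)^n$ is the zero endomorphism of the cofiber. Here $R\Gamma(\Gamma,-)$ is continuous group cohomology, $\widehat{\otimes}_S$ is the $p$-completed tensor product, and $B^+\widehat{\otimes}_SR$ carries the $p$-adic topology. Consequently, if $c$ maps to a unit in $R[\tfrac1p]$, then this map becomes an isomorphism after inverting $p$, i.e. it induces isomorphisms on all cohomology groups after inverting $p$. -/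

import Mathlib

open CategoryTheory

universe u w

noncomputable section

namespace GaloisB

section PCompletion

variable (p : ℕ) {A B C : Type*} [CommRing A] [CommRing B] [CommRing C]

/-- The `p`-adic completion `lim A/p^n` of a commutative ring `A`. -/
abbrev PCompl (A : Type*) [CommRing A] : Type _ := AdicCompletion (Ideal.span {(p : A)}) A

/-- The canonical map from a ring to its `p`-adic completion. -/
def PCompl.of : A →+* PCompl p A := algebraMap A (PCompl p A)

theorem PCompl.pow_le_comap (f : A →+* B) (n : ℕ) :
    Ideal.span {(p : A)} ^ n ≤ Ideal.comap f (Ideal.span {(p : B)} ^ n) := by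
  rw [← Ideal.map_le_iff_le_comap, Ideal.map_pow, Ideal.map_span]
  simp

theorem PCompl.factorPow_quotientMap (f : A →+* B) {m n : ℕ} (hle : m ≤ n) :
    (Ideal.Quotient.factorPow (Ideal.span {(p : B)}) hle).comp
      ((Ideal.quotientMap (Ideal.span {(p : B)} ^ n) f (PCompl.pow_le_comap p f n)).comp
        (AdicCompletion.evalₐ (Ideal.span {(p : A)}) n :
          PCompl p A →+* A ⧸ Ideal.span {(p : A)} ^ n)) =
      (Ideal.quotientMap (Ideal.span {(p : B)} ^ m) f (PCompl.pow_le_comap p f m)).comp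
        (AdicCompletion.evalₐ (Ideal.span {(p : A)}) m :
          PCompl p A →+* A ⧸ Ideal.span {(p : A)} ^ m) := by
  ext x
  obtain ⟨y, rfl⟩ := AdicCompletion.mk_surjective _ _ x
  simp only [RingHom.comp_apply, RingHom.coe_coe, AdicCompletion.evalₐ_mk]
  rw [← AdicCompletion.Ideal.mk_eq_mk _ hle y]
  rfl

/-- Functoriality of the `p`-adic completion. -/
def PCompl.map (f : A →+* B) : PCompl p A →+* PCompl p B :=
  AdicCompletion.liftRingHom (Ideal.span {(p : B)})
    (fun n => (Ideal.quotientMap (Ideal.span {(p : B)} ^ n) f (PCompl.pow_le_comap p f n)).comp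
      (AdicCompletion.evalₐ (Ideal.span {(p : A)}) n : PCompl p A →+* A ⧸ Ideal.span {(p : A)} ^ n))
    (PCompl.factorPow_quotientMap p f)

theorem PCompl.evalₐ_map (f : A →+* B) (n : ℕ) (x : PCompl p A) :
    AdicCompletion.evalₐ (Ideal.span {(p : B)}) n (PCompl.map p f x) =
      Ideal.quotientMap (Ideal.span {(p : B)} ^ n) f (PCompl.pow_le_comap p f n)
        (AdicCompletion.evalₐ (Ideal.span {(p : A)}) n x) :=
  AdicCompletion.evalₐ_liftRingHom _ _ (PCompl.factorPow_quotientMap p f) _ _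

theorem PCompl.map_id : PCompl.map p (RingHom.id A) = RingHom.id _ := by
  refine RingHom.ext fun x => AdicCompletion.ext_evalₐ fun n => ?_
  rw [PCompl.evalₐ_map]
  obtain ⟨y, hy⟩ := Ideal.Quotient.mk_surjective (AdicCompletion.evalₐ (Ideal.span {(p : A)}) n x)
  simp [← hy]

theorem PCompl.map_map (g : B →+* C) (f : A →+* B) (x : PCompl p A) :
    PCompl.map p g (PCompl.map p f x) = PCompl.map p (g.comp f) x := by
  refine AdicCompletion.ext_evalₐ fun n => ?_
  simp only [PCompl.evalₐ_map]
  obtain ⟨y, hy⟩ := Ideal.Quotient.mk_surjective (AdicCompletion.evalₐ (Ideal.span {(p : A)}) n x)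
  simp [← hy]

theorem PCompl.map_eq_self {f : A →+* A} (h : f = RingHom.id A) (x : PCompl p A) :
    PCompl.map p f x = x := by
  rw [h, PCompl.map_id, RingHom.id_apply]

theorem PCompl.map_eq_map_map {h : A →+* C} {g : B →+* C} {f : A →+* B} (e : h = g.comp f)
    (x : PCompl p A) : PCompl.map p h x = PCompl.map p g (PCompl.map p f x) := by
  rw [e, PCompl.map_map]

theorem PCompl.map_of (f : A →+* B) (x : A) :
    PCompl.map p f (PCompl.of p x) = PCompl.of p (f x) := by
  refine AdicCompletion.ext_evalₐ fun n => ?_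
  simp only [PCompl.evalₐ_map]
  change Ideal.quotientMap _ f _ (AdicCompletion.evalₐ _ n (AdicCompletion.of _ _ x)) =
    AdicCompletion.evalₐ _ n (AdicCompletion.of _ _ (f x))
  simp

end PCompletion

section DividedPowers

open Polynomial

variable (p : ℕ) (A : Type*) [CommRing A]

/-- `A[1/p]`. -/
abbrev InvP : Type _ := Localization.Away (p : A)

/-- The polynomials `∑ aₙ xⁿ/n!` with `aₙ ∈ A`, as a subalgebra of `A[1/p][x]`: the coefficients
become integral after multiplication by `n!`. For a `p`-torsion free `ℤ_p`-algebra `A` this is the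
divided power polynomial algebra `⨁ A xⁿ/n!` on one variable `x`. -/
def PDPoly : Subalgebra A (InvP p A)[X] where
  carrier := {f | ∀ n : ℕ, ∃ a : A, algebraMap A (InvP p A) a = (n.factorial : InvP p A) * f.coeff n}
  mul_mem' := by
    intro f g hf hg n
    choose a ha using hf
    choose b hb using hg
    refine ⟨∑ x ∈ Finset.HasAntidiagonal.antidiagonal n, (n.choose x.1 : A) * (a x.1 * b x.2), ?_⟩
    rw [map_sum, coeff_mul, Finset.mul_sum]
    refine Finset.sum_congr rfl fun x hx => ?_
    rw [Finset.HasAntidiagonal.mem_antidiagonal] at hx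
    subst hx
    rw [map_mul, map_mul, ha, hb, map_natCast, ← Nat.add_choose_mul_factorial_mul_factorial,
      Nat.choose_symm_add]
    push_cast
    ring
  add_mem' := by
    intro f g hf hg n
    obtain ⟨a, ha⟩ := hf n
    obtain ⟨b, hb⟩ := hg n
    exact ⟨a + b, by rw [map_add, ha, hb, coeff_add, mul_add]⟩
  algebraMap_mem' := by
    intro r n
    refine ⟨if n = 0 then r else 0, ?_⟩
    rw [Polynomial.algebraMap_apply, coeff_C]
    split_ifs with h
    · simp [h]
    · simp

variable {A}

/-- The endomorphism of `A[1/p]` induced by an endomorphism of `A`. -/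
def InvP.map (g : A →+* A) : InvP p A →+* InvP p A :=
  IsLocalization.map (M := Submonoid.powers (p : A)) (T := Submonoid.powers (p : A)) (InvP p A) g
    (by
      rw [Submonoid.powers_le]
      exact ⟨1, by simp⟩)

@[simp]
theorem InvP.map_algebraMap (g : A →+* A) (a : A) :
    InvP.map p g (algebraMap A (InvP p A) a) = algebraMap A (InvP p A) (g a) :=
  IsLocalization.map_eq _ _

/-- The ring endomorphism of `A[1/p][x]` that is `g` on `A` and sends `x` to `x + t`. -/
def transHom (g : A →+* A) (t : A) : (InvP p A)[X] →+* (InvP p A)[X] :=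
  eval₂RingHom (C.comp (InvP.map p g)) (X + C (algebraMap A (InvP p A) t))

theorem transHom_mem (g : A →+* A) (t : A) (ht : ∀ m : ℕ, (m.factorial : A) ∣ t ^ m)
    (f : (InvP p A)[X]) (hf : f ∈ PDPoly p A) : transHom p g t f ∈ PDPoly p A := by
  choose a ha using hf
  choose d hd using ht
  intro n
  refine ⟨∑ i ∈ f.support, g (a i) * (if n ≤ i then d (i - n) else 0), ?_⟩
  have : transHom p g t f = ∑ i ∈ f.support, C (InvP.map p g (f.coeff i)) *
      (X + C (algebraMap A (InvP p A) t)) ^ i := by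
    simp [transHom, eval₂_eq_sum, Polynomial.sum]
  rw [this, finsetSum_coeff, map_sum, Finset.mul_sum]
  refine Finset.sum_congr rfl fun i _ => ?_
  rw [coeff_C_mul, coeff_X_add_C_pow, map_mul, ← InvP.map_algebraMap, ha, map_mul, map_natCast]
  split_ifs with h
  · obtain ⟨k, rfl⟩ := Nat.exists_eq_add_of_le h
    rw [Nat.add_sub_cancel_left, ← map_pow, hd, map_mul, map_natCast,
      ← Nat.add_choose_mul_factorial_mul_factorial, Nat.choose_symm_add]
    push_cast
    ring
  · rw [Nat.choose_eq_zero_of_lt (not_le.mp h)]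
    simp

/-- The ring endomorphism of `⨁ A xⁿ/n!` that is `g` on `A` and sends `x` to `x + t`, for an
element `t` such that `t^m/m!` exists in `A` for every `m`. -/
def pdHom (g : A →+* A) (t : A) (ht : ∀ m : ℕ, (m.factorial : A) ∣ t ^ m) :
    PDPoly p A →+* PDPoly p A :=
  RingHom.restrict (transHom p g t) (PDPoly p A) (PDPoly p A) (transHom_mem p g t ht)

theorem pdHom_algebraMap (g : A →+* A) (t : A) (ht : ∀ m : ℕ, (m.factorial : A) ∣ t ^ m) (a : A) :
    pdHom p g t ht (algebraMap A (PDPoly p A) a) = algebraMap A (PDPoly p A) (g a) := by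
  apply Subtype.ext
  change transHom p g t (algebraMap A (InvP p A)[X] a) = algebraMap A (InvP p A)[X] (g a)
  simp [transHom, Polynomial.algebraMap_apply]

theorem transHom_comp (g g' : A →+* A) (t t' : A) (f : (InvP p A)[X]) :
    transHom p g t (transHom p g' t' f) = transHom p (g.comp g') (t + g t') f := by
  rw [← RingHom.comp_apply]
  congr 1
  refine Polynomial.ringHom_ext' ?_ ?_
  · refine IsLocalization.ringHom_ext (Submonoid.powers (p : A)) ?_
    ext a
    simp [transHom]
  · simp [transHom, add_assoc]

theorem transHom_id : transHom p (RingHom.id A) 0 = RingHom.id _ := by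
  refine Polynomial.ringHom_ext' ?_ ?_
  · refine IsLocalization.ringHom_ext (Submonoid.powers (p : A)) ?_
    ext a
    simp [transHom]
  · simp [transHom]

end DividedPowers
section Cyclotomic

variable (p : ℕ) [Fact p.Prime]

/-- `ℤ_p[ζ_{p^∞}]`, generated over `ℤ_p` by all roots of unity of `p`-power order in an algebraic
closure of `ℚ_p`. -/
abbrev ZpZeta : Subalgebra ℤ_[p] (PadicAlgCl p) :=
  Algebra.adjoin ℤ_[p] {z : PadicAlgCl p | ∃ n : ℕ, z ^ p ^ n = 1}

/-- `ℤ_p^cycl`, the `p`-adic completion of `ℤ_p[ζ_{p^∞}]`. -/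
abbrev Zcyc : Type := PCompl p (ZpZeta p)

/-- A compatible system `(1, ζ_p, ζ_{p²}, …)` of primitive `p`-power roots of unity, i.e. a
topological generator `γ` of `ℤ_p(1)`. -/
structure RootSystem where
  /-- the chosen primitive `p ^ n`-th root of unity -/
  ζ : ℕ → PadicAlgCl p
  primitive : ∀ n, IsPrimitiveRoot (ζ n) (p ^ n)
  compat : ∀ n, ζ (n + 1) ^ p = ζ n

variable {p} (ε : RootSystem p)

/-- `ζ_{p^n}` as an element of `ℤ_p[ζ_{p^∞}]`. -/
def RootSystem.z (n : ℕ) : ZpZeta p :=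
  ⟨ε.ζ n, Algebra.subset_adjoin ⟨n, (ε.primitive n).pow_eq_one⟩⟩

theorem RootSystem.z_pow_prime_pow (k l : ℕ) : ε.z (k + l) ^ p ^ l = ε.z k := by
  induction l with
  | zero => simp
  | succ l ih =>
    have h : ε.z (k + l + 1) ^ p = ε.z (k + l) := Subtype.ext (ε.compat (k + l))
    rw [← add_assoc, pow_succ', pow_mul, h, ih]

theorem RootSystem.z_pow_self (k : ℕ) : ε.z k ^ p ^ k = 1 :=
  Subtype.ext (ε.primitive k).pow_eq_one

theorem exists_approx (q : ℚ_[p]) : ∃ kn : ℕ × ℕ, ‖q - kn.2 / (p : ℚ_[p]) ^ kn.1‖ ≤ 1 := by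
  have hp : (1 : ℝ) < p := by exact_mod_cast (Fact.out : p.Prime).one_lt
  obtain ⟨k, hk⟩ := pow_unbounded_of_one_lt ‖q‖ hp
  have hpk : ‖(p : ℚ_[p]) ^ k‖ = ((p : ℝ) ^ k)⁻¹ := by simp
  have hpos : (0 : ℝ) < (p : ℝ) ^ k := by positivity
  have hx : ‖q * (p : ℚ_[p]) ^ k‖ ≤ 1 := by
    rw [norm_mul, hpk, mul_inv_le_iff₀ hpos, one_mul]
    exact hk.le
  obtain ⟨x, hx'⟩ : ∃ x : ℤ_[p], (x : ℚ_[p]) = q * (p : ℚ_[p]) ^ k := ⟨⟨_, hx⟩, rfl⟩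
  refine ⟨(k, x.appr k), ?_⟩
  have h := (PadicInt.norm_le_pow_iff_mem_span_pow _ _).mpr (PadicInt.appr_spec k x)
  generalize x.appr k = n at h ⊢
  have h' : ‖q * (p : ℚ_[p]) ^ k - (n : ℚ_[p])‖ ≤ ((p : ℝ) ^ k)⁻¹ := by
    rw [zpow_neg, zpow_natCast, PadicInt.norm_def, PadicInt.coe_sub, PadicInt.coe_natCast, hx'] at h
    exact h
  have h0 : (p : ℚ_[p]) ^ k ≠ 0 := by
    have : (p : ℚ_[p]) ≠ 0 := by exact_mod_cast (Fact.out : p.Prime).ne_zero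
    positivity
  have e : q - n / (p : ℚ_[p]) ^ k = (q * (p : ℚ_[p]) ^ k - n) / (p : ℚ_[p]) ^ k := by
    field_simp
  rw [e, norm_div, hpk, div_inv_eq_mul]
  calc _ ≤ ((p : ℝ) ^ k)⁻¹ * (p : ℝ) ^ k := by gcongr
    _ = 1 := inv_mul_cancel₀ hpos.ne'

theorem RootSystem.z_pow_eq {k n l m : ℕ}
    (h : ‖(n / (p : ℚ_[p]) ^ k - m / (p : ℚ_[p]) ^ l : ℚ_[p])‖ ≤ 1) :
    ε.z k ^ n = ε.z l ^ m := by
  have hp0 : (p : ℚ_[p]) ≠ 0 := by exact_mod_cast (Fact.out : p.Prime).ne_zero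
  have key : ((p ^ (k + l) : ℕ) : ℤ) ∣ ((n * p ^ l : ℕ) : ℤ) - ((m * p ^ k : ℕ) : ℤ) := by
    have := (Padic.norm_int_le_pow_iff_dvd (p := p)
      (((n * p ^ l : ℕ) : ℤ) - ((m * p ^ k : ℕ) : ℤ)) (k + l)).mp
    refine this ?_
    have e : (((((n * p ^ l : ℕ) : ℤ) - ((m * p ^ k : ℕ) : ℤ) : ℤ)) : ℚ_[p]) =
        (n / (p : ℚ_[p]) ^ k - m / (p : ℚ_[p]) ^ l) * (p : ℚ_[p]) ^ (k + l) := by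
      push_cast
      field_simp
      ring
    rw [e, norm_mul, norm_pow, Padic.norm_p, zpow_neg, zpow_natCast, inv_pow]
    calc _ ≤ 1 * ((p : ℝ) ^ (k + l))⁻¹ := by gcongr
      _ = _ := one_mul _
  have hmod : n * p ^ l ≡ m * p ^ k [MOD p ^ (k + l)] :=
    ((Nat.modEq_iff_dvd).mpr (by exact_mod_cast key)).symm
  rw [← ε.z_pow_prime_pow k l, ← ε.z_pow_prime_pow l k, ← pow_mul, ← pow_mul, add_comm l k,
    mul_comm (p ^ l), mul_comm (p ^ k)]
  exact pow_eq_pow_of_modEq hmod (ε.z_pow_self (k + l))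

/-- The root of unity `ζ^q` for `q ∈ ℚ_p`: it is `ζ_{p^k} ^ n` whenever `q ≡ n / p^k` modulo
`ℤ_p`. -/
def RootSystem.rpow (q : ℚ_[p]) : ZpZeta p :=
  ε.z (exists_approx q).choose.1 ^ (exists_approx q).choose.2

theorem norm_sub_le_one {x y : ℚ_[p]} (hx : ‖x‖ ≤ 1) (hy : ‖y‖ ≤ 1) : ‖x - y‖ ≤ 1 :=
  by
  rw [sub_eq_add_neg]
  exact (Padic.nonarchimedean x (-y)).trans (max_le hx (by rwa [norm_neg]))

theorem RootSystem.rpow_eq {q : ℚ_[p]} {k n : ℕ} (h : ‖q - n / (p : ℚ_[p]) ^ k‖ ≤ 1) :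
    ε.rpow q = ε.z k ^ n := by
  refine ε.z_pow_eq ?_
  have := norm_sub_le_one h (exists_approx q).choose_spec
  rwa [sub_sub_sub_cancel_left] at this

theorem RootSystem.rpow_eq_one {q : ℚ_[p]} (h : ‖q‖ ≤ 1) : ε.rpow q = 1 := by
  rw [ε.rpow_eq (q := q) (k := 0) (n := 0) (by simpa using h), pow_zero]

theorem RootSystem.rpow_add (q r : ℚ_[p]) : ε.rpow (q + r) = ε.rpow q * ε.rpow r := by
  have hp0 : (p : ℚ_[p]) ≠ 0 := by exact_mod_cast (Fact.out : p.Prime).ne_zero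
  obtain ⟨⟨k, n⟩, h⟩ := exists_approx q
  obtain ⟨⟨l, m⟩, h'⟩ := exists_approx r
  rw [ε.rpow_eq h, ε.rpow_eq h', ε.rpow_eq (k := k + l) (n := n * p ^ l + m * p ^ k), pow_add,
    mul_comm n, mul_comm m, pow_mul, pow_mul, ε.z_pow_prime_pow, add_comm k l,
    ε.z_pow_prime_pow]
  have e : q + r - ((n * p ^ l + m * p ^ k : ℕ) : ℚ_[p]) / (p : ℚ_[p]) ^ (k + l) =
      (q - n / (p : ℚ_[p]) ^ k) - -(r - m / (p : ℚ_[p]) ^ l) := by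
    push_cast
    field_simp
    ring
  rw [e]
  exact norm_sub_le_one h (by rwa [norm_neg])

/-- `(ζ_p - 1) ^ m` is divisible by `m!` in `ℤ_p[ζ_{p^∞}]`. -/
theorem RootSystem.factorial_dvd (m : ℕ) :
    (m.factorial : ZpZeta p) ∣ (ε.z 1 - 1) ^ m := by
  have hpp : p.Prime := Fact.out
  set π : ZpZeta p := ε.z 1 - 1 with hπ
  have hπ0 : π ≠ 0 := by
    intro h
    have h1 : ε.ζ 1 = 1 := congrArg Subtype.val (sub_eq_zero.mp h)
    exact (ε.primitive 1).ne_one (by simpa using hpp.one_lt) h1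
  have hdiv : (p : ZpZeta p) ∣ π ^ (p - 1) := by
    obtain ⟨r, hr⟩ := exists_add_pow_prime_eq hpp π 1
    have hz : (π + 1) ^ p = 1 := by
      rw [hπ, sub_add_cancel]
      simpa using ε.z_pow_self 1
    rw [hz, one_pow, mul_one] at hr
    have h1 : π * (π ^ (p - 1) + p * r) = 0 := by
      have : π * π ^ (p - 1) = π ^ p := mul_pow_sub_one hpp.ne_zero π
      linear_combination this - hr
    have h2 := (mul_eq_zero.mp h1).resolve_left hπ0
    exact ⟨-r, by linear_combination h2⟩
  set v := padicValNat p m.factorial with hv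
  obtain ⟨u, hu⟩ : p ^ v ∣ m.factorial := pow_padicValNat_dvd
  have hu' : ¬ p ∣ u := by
    rintro ⟨w, rfl⟩
    refine pow_succ_padicValNat_not_dvd (p := p) (Nat.factorial_ne_zero m) ⟨w, ?_⟩
    rw [← hv, hu]
    ring
  have hunit : IsUnit (u : ZpZeta p) := by
    have h1 : IsUnit (u : ℤ_[p]) := by
      rw [PadicInt.isUnit_iff]
      have := PadicInt.norm_int_lt_one_iff_dvd (p := p) (u : ℤ)
      by_contra hne
      have hlt : ‖((u : ℤ) : ℤ_[p])‖ < 1 :=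
        lt_of_le_of_ne (PadicInt.norm_le_one _) (by simpa using hne)
      exact hu' (by exact_mod_cast this.mp hlt)
    simpa using h1.map (algebraMap ℤ_[p] (ZpZeta p))
  have hle : (p - 1) * v ≤ m := by
    rw [hv, sub_one_mul_padicValNat_factorial]
    exact Nat.sub_le _ _
  rw [hu]
  push_cast
  rw [hunit.mul_right_dvd]
  refine (pow_dvd_pow_of_dvd hdiv v).trans ?_
  rw [← pow_mul]
  exact pow_dvd_pow _ hle

end Cyclotomic

section KeyRings

variable (p : ℕ) [Fact p.Prime]

/-- The group `ℤ[1/p]` of exponents of `T`. -/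
def ExpGroup : AddSubgroup ℚ where
  carrier := {r | ∃ (k : ℕ) (i : ℤ), r * (p : ℚ) ^ k = i}
  add_mem' := by
    rintro r s ⟨k, i, hi⟩ ⟨l, j, hj⟩
    refine ⟨k + l, i * p ^ l + j * p ^ k, ?_⟩
    push_cast
    rw [← hi, ← hj]
    ring
  zero_mem' := ⟨0, 0, by simp⟩
  neg_mem' := by
    rintro r ⟨k, i, hi⟩
    exact ⟨k, -i, by rw [neg_mul, hi]; push_cast; rfl⟩

/-- The inclusion `ℤ ⊆ ℤ[1/p]`. -/
def intToExp : ℤ →+ ExpGroup p :=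
  (Int.castAddHom ℚ).codRestrict (ExpGroup p) (fun i => ⟨0, i, by simp⟩)

/-- The inclusion `K[T^{±1}] → K[T^{±1/p^∞}]`. -/
def torusIncl (K : Type*) [CommRing K] :
    LaurentPolynomial K →+* AddMonoidAlgebra K (ExpGroup p) :=
  AddMonoidAlgebra.mapDomainRingHom K (intToExp p)

section Torus

variable {p} (ε : RootSystem p) {K : Type*} [CommRing K] (φ : ZpZeta p →+* K)

/-- The action of `γ ^ a`, `a ∈ ℤ_p`, on `K[T^{±1/p^∞}]`, for a `ℤ_p[ζ_{p^∞}]`-algebra `K`: it is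
linear over `K` and sends `T ^ r` to `ζ ^ (a r) T ^ r`. In particular `γ` sends `T^{1/p^k}` to
`ζ_{p^k} T^{1/p^k}`. -/
def torusAct (a : ℤ_[p]) : AddMonoidAlgebra K (ExpGroup p) →ₐ[K] AddMonoidAlgebra K (ExpGroup p) :=
  AddMonoidAlgebra.lift K (AddMonoidAlgebra K (ExpGroup p)) (ExpGroup p)
    { toFun := fun r => AddMonoidAlgebra.single r.toAdd
        (φ (ε.rpow (a * ((r.toAdd : ℚ) : ℚ_[p]))))
      map_one' := by
        rw [ε.rpow_eq_one (by simp)]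
        simp [AddMonoidAlgebra.one_def]
      map_mul' := by
        intro r s
        rw [AddMonoidAlgebra.single_mul_single, ← map_mul, ← ε.rpow_add]
        congr 4
        simp [mul_add] }

theorem torusAct_single (a : ℤ_[p]) (r : ExpGroup p) (f : K) :
    torusAct ε φ a (AddMonoidAlgebra.single r f) = AddMonoidAlgebra.single r
      (f * φ (ε.rpow (a * ((r : ℚ) : ℚ_[p])))) := by
  simp [torusAct, AddMonoidAlgebra.lift_single]

theorem torusAct_zero :
    (torusAct ε φ 0 : AddMonoidAlgebra K (ExpGroup p) →+* AddMonoidAlgebra K (ExpGroup p)) =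
      RingHom.id _ := by
  have h : torusAct ε φ 0 = AlgHom.id _ _ := by
    refine AddMonoidAlgebra.algHom_ext (fun r => ?_) (by ext)
    rw [torusAct_single, PadicInt.coe_zero, zero_mul, ε.rpow_eq_one (by simp)]
    simp
  rw [h]
  rfl

theorem torusAct_add (a b : ℤ_[p]) :
    (torusAct ε φ (a + b) : AddMonoidAlgebra K (ExpGroup p) →+* AddMonoidAlgebra K (ExpGroup p)) =
      (torusAct ε φ a : AddMonoidAlgebra K (ExpGroup p) →+* AddMonoidAlgebra K (ExpGroup p)).comp
        (torusAct ε φ b : AddMonoidAlgebra K (ExpGroup p) →+* AddMonoidAlgebra K (ExpGroup p)) := by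
  have h : torusAct ε φ (a + b) = (torusAct ε φ a).comp (torusAct ε φ b) := by
    refine AddMonoidAlgebra.algHom_ext (fun r => ?_) (by ext)
    rw [AlgHom.comp_apply, torusAct_single, torusAct_single, torusAct_single,
      PadicInt.coe_add, add_mul, add_comm, ε.rpow_add, map_mul, mul_assoc]
  rw [h]
  rfl

theorem torusAct_comp_incl (a : ℤ_[p]) :
    (torusAct ε φ a : AddMonoidAlgebra K (ExpGroup p) →+* AddMonoidAlgebra K (ExpGroup p)).comp
      (torusIncl p K) = torusIncl p K := by
  have key : ∀ (i : ℤ) (f : K), torusAct ε φ a (torusIncl p K (AddMonoidAlgebra.single i f)) =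
      torusIncl p K (AddMonoidAlgebra.single i f) := by
    intro i f
    have e : torusIncl p K (AddMonoidAlgebra.single i f) =
        AddMonoidAlgebra.single (intToExp p i) f :=
      AddMonoidAlgebra.mapDomain_single
    rw [e, torusAct_single, ε.rpow_eq_one, map_one, mul_one]
    have h : ((((intToExp p i : ExpGroup p) : ℚ)) : ℚ_[p]) = ((i : ℤ_[p]) : ℚ_[p]) := by
      rw [PadicInt.coe_intCast]
      exact Rat.cast_intCast i
    rw [h, ← PadicInt.coe_mul]
    exact PadicInt.norm_le_one _
  exact AddMonoidAlgebra.ringHom_ext (fun f => key 0 f) (fun i => key i 1)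

end Torus

/-- `ℤ_p^cycl[κ, T^{±1}]`, where `κ` is the polynomial variable and `T` the Laurent variable. -/
abbrev S₀ : Type := LaurentPolynomial (Polynomial (Zcyc p))

/-- `ℤ_p^cycl[κ, T^{±1/p^∞}]`. -/
abbrev SInf₀ : Type := AddMonoidAlgebra (Polynomial (Zcyc p)) (ExpGroup p)

/-- `S = ℤ_p^cycl⟨κ, T^{±1}⟩`. -/
def S : Type := PCompl p (S₀ p)

instance : CommRing (S p) := inferInstanceAs (CommRing (PCompl p (S₀ p)))

/-- `S_∞ = ℤ_p^cycl⟨κ, T^{±1/p^∞}⟩`. -/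
def SInf : Type := PCompl p (SInf₀ p)

instance : CommRing (SInf p) := inferInstanceAs (CommRing (PCompl p (SInf₀ p)))

instance : Algebra (S p) (SInf p) :=
  RingHom.toAlgebra (S := SInf p) (R := S p) (PCompl.map p (torusIncl p (Polynomial (Zcyc p))))

/-- The structure map of the `ℤ_p[ζ_{p^∞}]`-algebra `S`. -/
def baseToS : ZpZeta p →+* S p :=
  (PCompl.of p : S₀ p →+* PCompl p (S₀ p)).comp
    (LaurentPolynomial.C.comp (Polynomial.C.comp (PCompl.of p)))

/-- The variable `κ` of `S`. -/
def kappa : S p := (PCompl.of p (LaurentPolynomial.C Polynomial.X : S₀ p) : PCompl p (S₀ p))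

variable {p} (ε : RootSystem p)

/-- The element `c = (ζ_p - 1) κ` of `S`. -/
def cElt : S p := (baseToS p (ε.z 1) - 1) * kappa p

variable (p) in
/-- The structure map of the `ℤ_p[ζ_{p^∞}]`-algebra `ℤ_p^cycl[κ]`. -/
def baseToPoly : ZpZeta p →+* Polynomial (Zcyc p) := Polynomial.C.comp (PCompl.of p)

/-- The action of `γ ^ a`, `a ∈ ℤ_p`, on `S_∞`. -/
def gammaSInf (a : ℤ_[p]) : SInf p →+* SInf p :=
  PCompl.map p (torusAct ε (baseToPoly p) a : SInf₀ p →+* SInf₀ p)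

theorem gammaSInf_zero : gammaSInf ε 0 = RingHom.id (SInf p) :=
  RingHom.ext fun x => PCompl.map_eq_self p (torusAct_zero ε (baseToPoly p)) x

theorem gammaSInf_add (a b : ℤ_[p]) :
    gammaSInf ε (a + b) = (gammaSInf ε a).comp (gammaSInf ε b) :=
  RingHom.ext fun x => PCompl.map_eq_map_map p (torusAct_add ε (baseToPoly p) a b) x

theorem gammaSInf_algebraMap (a : ℤ_[p]) (s : S p) :
    gammaSInf ε a (algebraMap (S p) (SInf p) s) = algebraMap (S p) (SInf p) s :=
  (PCompl.map_eq_map_map p (torusAct_comp_incl ε (baseToPoly p) a).symm s).symm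

/-- `a c` as element of `S_∞`, for `a ∈ ℤ_p`. -/
def acElt (a : ℤ_[p]) : SInf p :=
  algebraMap (S p) (SInf p) (baseToS p (algebraMap ℤ_[p] (ZpZeta p) a) * cElt ε)

theorem acElt_factorial_dvd (a : ℤ_[p]) (m : ℕ) : (m.factorial : SInf p) ∣ acElt ε a ^ m := by
  have h : (m.factorial : S p) ∣ (baseToS p (ε.z 1) - 1) ^ m := by
    have := map_dvd (baseToS p) (ε.factorial_dvd m)
    simpa using this
  have h2 : (m.factorial : S p) ∣ (baseToS p (algebraMap ℤ_[p] (ZpZeta p) a) * cElt ε) ^ m := by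
    rw [cElt, mul_pow, mul_pow]
    exact (h.mul_right _).mul_left _
  have := map_dvd (algebraMap (S p) (SInf p)) h2
  rw [map_natCast, map_pow] at this
  exact this

theorem acElt_zero : acElt ε 0 = 0 := by simp [acElt]

theorem acElt_add (a b : ℤ_[p]) : acElt ε (a + b) = acElt ε a + acElt ε b := by
  simp [acElt, add_mul]

variable (p) in
/-- `B^+`, the `p`-adic completion of the divided power algebra `⨁ S_∞ xⁿ/n!`. -/
def BPlus : Type := PCompl p (PDPoly p (SInf p))

instance : CommRing (BPlus p) := inferInstanceAs (CommRing (PCompl p (PDPoly p (SInf p))))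

instance : Algebra (SInf p) (BPlus p) :=
  RingHom.toAlgebra (S := BPlus p)
    ((PCompl.of p : PDPoly p (SInf p) →+* PCompl p (PDPoly p (SInf p))).comp
      (algebraMap (SInf p) (PDPoly p (SInf p))))

instance : Algebra (S p) (BPlus p) :=
  RingHom.toAlgebra ((algebraMap (SInf p) (BPlus p)).comp (algebraMap (S p) (SInf p)))

/-- The action of `γ ^ a`, `a ∈ ℤ_p`, on `⨁ S_∞ xⁿ/n!`: it is the given action on `S_∞` and
sends `x` to `x + a c`. -/
def gammaPD (a : ℤ_[p]) : PDPoly p (SInf p) →+* PDPoly p (SInf p) :=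
  pdHom p (gammaSInf ε a) (acElt ε a) (acElt_factorial_dvd ε a)

theorem gammaPD_zero : gammaPD ε 0 = RingHom.id _ := by
  refine RingHom.ext fun f => Subtype.ext ?_
  change transHom p (gammaSInf ε 0) (acElt ε 0) f = f
  rw [gammaSInf_zero, acElt_zero, transHom_id, RingHom.id_apply]

theorem gammaPD_add (a b : ℤ_[p]) : gammaPD ε (a + b) = (gammaPD ε a).comp (gammaPD ε b) := by
  refine RingHom.ext fun f => Subtype.ext ?_
  change transHom p (gammaSInf ε (a + b)) (acElt ε (a + b)) f =
    transHom p (gammaSInf ε a) (acElt ε a) (transHom p (gammaSInf ε b) (acElt ε b) f)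
  have h : gammaSInf ε a (acElt ε b) = acElt ε b := gammaSInf_algebraMap ε a _
  rw [transHom_comp, gammaSInf_add, acElt_add, h]

/-- The action of `γ ^ a`, `a ∈ ℤ_p`, on `B^+`, as an `S`-algebra endomorphism. -/
def gammaB (a : ℤ_[p]) : BPlus p →ₐ[S p] BPlus p where
  toRingHom := (PCompl.map p (gammaPD ε a) : PCompl p (PDPoly p (SInf p)) →+* _)
  commutes' := by
    intro s
    change PCompl.map p (gammaPD ε a)
      (PCompl.of p (algebraMap (SInf p) (PDPoly p (SInf p)) (algebraMap (S p) (SInf p) s))) =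
      PCompl.of p (algebraMap (SInf p) (PDPoly p (SInf p)) (algebraMap (S p) (SInf p) s))
    rw [PCompl.map_of, gammaPD, pdHom_algebraMap, gammaSInf_algebraMap]

theorem gammaB_zero : gammaB ε 0 = AlgHom.id _ _ := by
  exact AlgHom.ext fun x => PCompl.map_eq_self p (gammaPD_zero ε) x

theorem gammaB_add (a b : ℤ_[p]) : gammaB ε (a + b) = (gammaB ε a).comp (gammaB ε b) := by
  exact AlgHom.ext fun x => PCompl.map_eq_map_map p (gammaPD_add ε a b) x

end KeyRings

section Cohomology

open TensorProduct

theorem adic_hasBasis_nhds_zero {R : Type*} [CommRing R] (I : Ideal R) (M : Type*)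
    [AddCommGroup M] [Module R M] :
    (@nhds M (I.adicModuleTopology M) 0).HasBasis (fun _ => True)
      fun n : ℕ => ((I ^ n • ⊤ : Submodule R M) : Set M) :=
  let B := (@ModuleFilterBasis.toAddGroupFilterBasis R M _ I.adic_basis.topology _ _
    (I.ringFilterBasis.moduleFilterBasis (I.adic_module_basis M)))
  ⟨by
    intro s
    rw [B.nhds_zero_hasBasis.mem_iff]
    constructor
    · rintro ⟨-, ⟨i, rfl⟩, hi⟩
      exact ⟨i, trivial, hi⟩
    · rintro ⟨i, -, hi⟩
      exact ⟨_, ⟨i, rfl⟩, hi⟩⟩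

/-- A linear map is continuous for the `I`-adic topologies. -/
theorem continuous_adic {R : Type*} [CommRing R] (I : Ideal R) {M N : Type*} [AddCommGroup M]
    [Module R M] [AddCommGroup N] [Module R N] (f : M →ₗ[R] N) :
    @Continuous M N (I.adicModuleTopology M) (I.adicModuleTopology N) f := by
  let _ : WithIdeal R := ⟨I⟩
  let _ : TopologicalSpace M := WithIdeal.topologicalSpaceModule R M
  let _ : TopologicalSpace N := WithIdeal.topologicalSpaceModule R N
  refine continuous_of_continuousAt_zero f ?_
  rw [ContinuousAt, map_zero]
  refine ((adic_hasBasis_nhds_zero I M).tendsto_iff (adic_hasBasis_nhds_zero I N)).mpr ?_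
  intro n _
  refine ⟨n, trivial, fun x hx => ?_⟩
  have h : Submodule.map f (I ^ n • ⊤) ≤ I ^ n • ⊤ := by
    rw [Submodule.map_smul'']
    exact smul_mono_right _ le_top
  exact h (Submodule.mem_map_of_mem hx)

variable {p : ℕ} [Fact p.Prime] (ε : RootSystem p) (R : Type u) [CommRing R] [Algebra (S p) R]

variable (p) in
/-- The `p`-completed tensor product `B^+ ⊗̂_S R`, as an `R`-module. -/
abbrev BHat : Type u := AdicCompletion (Ideal.span {(p : R)}) (R ⊗[S p] BPlus p)

/-- The action of `γ ^ a`, `a ∈ ℤ_p`, on `B^+ ⊗̂_S R`. -/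
def gammaHat (a : ℤ_[p]) : BHat p R →ₗ[R] BHat p R :=
  (AdicCompletion.map (Ideal.span {(p : R)})
    ((gammaB ε a).toLinearMap.baseChange R)).restrictScalars R

theorem gammaHat_zero : gammaHat ε R 0 = LinearMap.id := by
  have h : (gammaB ε 0).toLinearMap.baseChange R = LinearMap.id := by
    rw [gammaB_zero]
    exact LinearMap.baseChange_id
  rw [gammaHat, h, AdicCompletion.map_id]
  rfl

theorem gammaHat_add (a b : ℤ_[p]) :
    gammaHat ε R (a + b) = gammaHat ε R a ∘ₗ gammaHat ε R b := by
  have h : (gammaB ε (a + b)).toLinearMap.baseChange R =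
      (gammaB ε a).toLinearMap.baseChange R ∘ₗ (gammaB ε b).toLinearMap.baseChange R := by
    rw [gammaB_add, ← LinearMap.baseChange_comp]
    rfl
  refine LinearMap.ext fun x => ?_
  simp only [gammaHat, h, LinearMap.comp_apply, LinearMap.restrictScalars_apply,
    AdicCompletion.map_comp_apply]

/-- `B^+ ⊗̂_S R` with its `p`-adic topology as a continuous `R`-linear representation of
`Γ = ℤ_p(1)`, which is identified with `ℤ_p` through its topological generator `γ`. The ring `R`
carries the `p`-adic topology. -/
def galoisRep : @TopRep.{u} R (Multiplicative ℤ_[p]) _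
    (Ideal.span {(p : R)}).adicTopology _ :=
  letI : WithIdeal R := ⟨Ideal.span {(p : R)}⟩
  letI := WithIdeal.topologicalSpaceModule R (BHat p R)
  TopRep.of (ContRepresentation.ofMonoidHom
    { toFun := fun g => ⟨gammaHat ε R g.toAdd, continuous_adic _ _⟩
      map_one' := ContinuousLinearMap.ext fun x => LinearMap.congr_fun (gammaHat_zero ε R) x
      map_mul' := fun g h => ContinuousLinearMap.ext fun x =>
        LinearMap.congr_fun (gammaHat_add ε R g.toAdd h.toAdd) x })

instance forgetAdditive [TopologicalSpace R] :
    (forget₂ (TopModuleCat.{u} R) (ModuleCat.{u} R)).Additive where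

/-- The complex of continuous cochains of `Γ` with values in `B^+ ⊗̂_S R`; it represents
`RΓ(Γ, B^+ ⊗̂_S R)`. -/
def cochains : CochainComplex (ModuleCat.{u} R) ℕ :=
  letI : TopologicalSpace R := (Ideal.span {(p : R)}).adicTopology
  ((forget₂ (TopModuleCat.{u} R) (ModuleCat.{u} R)).mapHomologicalComplex _).obj
    (TopRep.homogeneousCochains (galoisRep ε R))

theorem gammaHat_one (a : ℤ_[p]) :
    gammaHat ε R a (AdicCompletion.of _ _ (1 ⊗ₜ 1)) = AdicCompletion.of _ _ (1 ⊗ₜ 1) := by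
  have h : (gammaB ε a).toLinearMap.baseChange R ((1 : R) ⊗ₜ[S p] (1 : BPlus p)) = 1 ⊗ₜ 1 := by
    rw [LinearMap.baseChange_tmul, AlgHom.toLinearMap_apply, map_one]
  refine (AdicCompletion.map_of (Ideal.span {(p : R)})
    ((gammaB ε a).toLinearMap.baseChange R) _).trans ?_
  rw [h]

/-- The map `r ↦ r · (1 ⊗ 1)` from `R` to the continuous `0`-cochains: homogeneous
`0`-cochains are the `Γ`-equivariant continuous functions on `Γ`, and an invariant element
corresponds to a constant function. -/
def unitCochain : ModuleCat.of R R ⟶ (cochains ε R).X 0 :=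
  letI : TopologicalSpace R := (Ideal.span {(p : R)}).adicTopology
  ModuleCat.ofHom (LinearMap.toSpanSingleton R ((TopRep.homogeneousCochains (galoisRep ε R)).X 0)
    ⟨ContinuousMap.const _ (AdicCompletion.of _ _ (1 ⊗ₜ 1) : BHat p R),
      ContinuousCohomology.mem_const_resol₀ (galoisRep ε R) _ (fun g => gammaHat_one ε R g.toAdd)⟩)

theorem unitCochain_d : unitCochain ε R ≫ (cochains ε R).d 0 1 = 0 := by
  let _ : TopologicalSpace R := (Ideal.span {(p : R)}).adicTopology
  refine ModuleCat.hom_ext (LinearMap.ext_ring ?_)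
  have h := ContinuousCohomology.cocycles₀IsoAux' (galoisRep ε R)
    (AdicCompletion.of _ _ (1 ⊗ₜ 1) : BHat p R)
    (ContinuousCohomology.mem_const_resol₀ (galoisRep ε R) _ (fun g => gammaHat_one ε R g.toAdd))
  exact (LinearMap.congr_arg (one_smul R _)).trans h

/-- The map of complexes `R → RΓ(Γ, B^+ ⊗̂_S R)`, with `R` in degree `0`. -/
def unitMap : (CochainComplex.single₀ (ModuleCat.{u} R)).obj (ModuleCat.of R R) ⟶ cochains ε R :=
  HomologicalComplex.mkHomFromSingle (unitCochain ε R) (fun k hk => by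
    obtain rfl : 0 + 1 = k := hk
    exact unitCochain_d ε R)

/-- The same map between complexes indexed by `ℤ`. -/
def unitMapInt :
    ((CochainComplex.single₀ (ModuleCat.{u} R)).obj (ModuleCat.of R R)).extend
      ComplexShape.embeddingUpNat ⟶ (cochains ε R).extend ComplexShape.embeddingUpNat :=
  HomologicalComplex.extendMap (unitMap ε R) ComplexShape.embeddingUpNat

/-- The cofiber of `R → RΓ(Γ, B^+ ⊗̂_S R)` in the derived category of `R`-modules. -/
def cofiber [HasDerivedCategory.{w} (ModuleCat.{u} R)] : DerivedCategory (ModuleCat.{u} R) :=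
  DerivedCategory.Q.obj (CochainComplex.mappingCone (unitMapInt ε R))

end Cohomology

end GaloisB

end

/-!
Write `M = B^+ ⊗̂_S R`. The point is that `R → RΓ(Γ, M)` has an inverse in the homotopy category up
to the scalar `c`; then `c ^ 2` kills the cofiber, and the map is an isomorphism wherever `c` is
invertible.

*Inverting `γ - 1` on `M` up to `c`, apart from `R`.* In terms of the coefficients of the divided
powers `xⁿ/n!`, the operator `γ` is `g · exp(c X)`, where `X = d/dx` and `g` is the diagonal
operator `T^r ↦ ζ^r T^r` (`gammaPD_coeffsEquiv`). Because `(ζ_p - 1)^j / (j + 1)!` is integral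
(`RootSystem.factorial_succ_dvd`), one has `exp(c X) = 1 + c X V` with an integral power series `V`
with constant term `1` (`gammaSeries_one`). For integral `r` the operator `γ - 1` is therefore
`c X V`, which integration inverts up to `c`, leaving only the constant terms `S`. For non-integral
`r` the difference `ζ^r - 1` divides `ζ_p - 1` (`exists_weight_inverse`), hence `g - 1` can be
inverted up to `ζ_p - 1`, and so can `γ - 1`, which differs from it by a locally nilpotent
multiple of `ζ_p - 1`. Both cases together are `exists_homotopy_of_diffOp`. The resulting operators
are `S`-linear, so they survive completion and base change: there are `H : M → M` and `e : M → R`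
with `(γ - 1) H = c` and `H (γ - 1) = c (1 - e(·) 1)` (`exists_homotopy_bHat`).

*From `γ - 1` to continuous cochains of `Γ`.* Continuous cohomology is computed by the invariants of
the resolution `M → C(Γ, M) → C(Γ, C(Γ, M)) → ⋯`. The action of `Γ` on `M` is continuous
(`exists_gammaHat_sub_mem`), so vectors fixed by `γ` are invariant under `Γ`. The indefinite sum of
a continuous function on `ℤ_p` with values in a `p`-adically complete module is again continuous
(`hasIndefiniteSum_of_adic`); hence `γ - 1` has a linear right inverse on every coinduced term
(`IsSummable.exists_rightInverse`). Together with `H` in degree zero, these right inverses correct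
the contraction of the resolution given by evaluation at `1` to a contraction, up to `c` and apart
from `R`, of the complex of invariants (`invHomotopyAux`, `exists_homotopyInverse_cochains`).
-/

noncomputable section

namespace GaloisB

/-! ### Additive functoriality of the `p`-adic completion -/

section AdditiveFunctoriality

variable (p : ℕ) {A B C : Type*} [CommRing A] [CommRing B] [CommRing C]

/-- Reduction of the `p`-adic completion modulo `p ^ n`. -/
abbrev PCompl.ev (n : ℕ) : PCompl p A →+* A ⧸ Ideal.span {(p : A)} ^ n :=
  (AdicCompletion.evalₐ (Ideal.span {(p : A)}) n : PCompl p A →+* A ⧸ Ideal.span {(p : A)} ^ n)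

variable {p}

theorem PCompl.exists_ev_eq (n : ℕ) (x : PCompl p A) :
    ∃ a : A, PCompl.ev p n x = Ideal.Quotient.mk _ a :=
  (Ideal.Quotient.mk_surjective (PCompl.ev p n x)).imp fun _ h => h.symm

theorem PCompl.ext_ev {x y : PCompl p A} (h : ∀ n, PCompl.ev p n x = PCompl.ev p n y) : x = y :=
  AdicCompletion.ext_evalₐ h

@[simp]
theorem PCompl.ev_of (n : ℕ) (a : A) : PCompl.ev p n (PCompl.of p a) = Ideal.Quotient.mk _ a :=
  AdicCompletion.evalₐ_of _ n a

theorem PCompl.factorPow_ev {m n : ℕ} (h : m ≤ n) (x : PCompl p A) :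
    Ideal.Quotient.factorPow (Ideal.span {(p : A)}) h (PCompl.ev p n x) = PCompl.ev p m x := by
  obtain ⟨y, rfl⟩ := AdicCompletion.mk_surjective _ _ x
  simp only [PCompl.ev, RingHom.coe_coe, AdicCompletion.evalₐ_mk]
  exact AdicCompletion.Ideal.mk_eq_mk _ h y

theorem PCompl.ev_eq_of_le {m n : ℕ} (h : m ≤ n) {x : PCompl p A} {a : A}
    (ha : PCompl.ev p n x = Ideal.Quotient.mk _ a) : PCompl.ev p m x = Ideal.Quotient.mk _ a := by
  rw [← PCompl.factorPow_ev h, ha]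
  rfl

/-- An additive map kills `p ^ n • A` modulo `p ^ n`: this is the continuity of additive maps. -/
theorem PCompl.ev_map_eq_zero (f : A →+ PCompl p B) (n : ℕ) {a : A}
    (ha : a ∈ Ideal.span {(p : A)} ^ n) : PCompl.ev p n (f a) = 0 := by
  rw [Ideal.span_singleton_pow, Ideal.mem_span_singleton] at ha
  obtain ⟨b, rfl⟩ := ha
  have h : f ((p : A) ^ n * b) = (p : PCompl p B) ^ n * f b := by
    have := map_nsmul f (p ^ n) b
    simpa [nsmul_eq_mul] using this
  have h0 : ((p : B ⧸ Ideal.span {(p : B)} ^ n)) ^ n = 0 := by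
    rw [← map_natCast (Ideal.Quotient.mk _), ← map_pow, Ideal.Quotient.eq_zero_iff_mem]
    exact Ideal.pow_mem_pow (Ideal.mem_span_singleton_self _) n
  rw [h, map_mul, map_pow, map_natCast, h0, zero_mul]

theorem PCompl.ev_map_congr (f : A →+ PCompl p B) (n : ℕ) {a b : A}
    (h : (Ideal.Quotient.mk (Ideal.span {(p : A)} ^ n)) a = Ideal.Quotient.mk _ b) :
    PCompl.ev p n (f a) = PCompl.ev p n (f b) := by
  rw [← sub_eq_zero, ← map_sub, ← map_sub]
  exact PCompl.ev_map_eq_zero f n (Ideal.Quotient.eq.mp h)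

/-- A compatible system of residues modulo the powers of `p` comes from the completion. -/
theorem PCompl.exists_of_compatible (s : ∀ n, A ⧸ Ideal.span {(p : A)} ^ n)
    (hs : ∀ n, Ideal.Quotient.factorPow (Ideal.span {(p : A)}) n.le_succ (s (n + 1)) = s n) :
    ∃ x : PCompl p A, ∀ n, PCompl.ev p n x = s n := by
  choose a ha using fun n => Ideal.Quotient.mk_surjective (s n)
  have hc : ∀ n, a n ≡ a (n + 1) [SMOD (Ideal.span {(p : A)} ^ n • ⊤ : Submodule A A)] := by
    intro n
    rw [SModEq.sub_mem, smul_eq_mul, Ideal.mul_top, ← Ideal.Quotient.eq, ha, ← hs, ← ha (n + 1)]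
    rfl
  refine ⟨AdicCompletion.mk _ _ (AdicCompletion.AdicCauchySequence.mk _ _ a hc), fun n => ?_⟩
  exact (AdicCompletion.evalₐ_mk _ n _).trans (ha n)

/-- The pointwise form of the extension to completions of an additive map `f`: its value at `x` is
congruent to `f a` modulo `p ^ n` whenever `a` approximates `x` modulo `p ^ n`. -/
theorem PCompl.exists_lift (f : A →+ PCompl p B) (x : PCompl p A) :
    ∃ y : PCompl p B, ∀ n a, PCompl.ev p n x = Ideal.Quotient.mk _ a →
      PCompl.ev p n y = PCompl.ev p n (f a) := by
  choose a ha using fun n => PCompl.exists_ev_eq (p := p) n x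
  obtain ⟨y, hy⟩ := PCompl.exists_of_compatible (fun n => PCompl.ev p n (f (a n))) (by
    intro n
    rw [PCompl.factorPow_ev]
    exact PCompl.ev_map_congr f n ((PCompl.ev_eq_of_le n.le_succ (ha (n + 1))).symm.trans (ha n)))
  exact ⟨y, fun n b hb => (hy n).trans (PCompl.ev_map_congr f n ((ha n).symm.trans hb))⟩

/-- The extension of an additive map `A → lim B/pⁿ` to the `p`-adic completion of `A`. It exists
because additive maps are automatically `p`-adically continuous. -/
def PCompl.liftAdd (f : A →+ PCompl p B) : PCompl p A →+ PCompl p B where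
  toFun x := (PCompl.exists_lift f x).choose
  map_zero' := by
    refine PCompl.ext_ev fun n => ?_
    rw [(PCompl.exists_lift f 0).choose_spec n 0 (by simp), map_zero]
  map_add' x y := by
    refine PCompl.ext_ev fun n => ?_
    obtain ⟨a, ha⟩ := PCompl.exists_ev_eq n x
    obtain ⟨b, hb⟩ := PCompl.exists_ev_eq n y
    rw [map_add, (PCompl.exists_lift f x).choose_spec n a ha,
      (PCompl.exists_lift f y).choose_spec n b hb,
      (PCompl.exists_lift f (x + y)).choose_spec n (a + b) (by rw [map_add, ha, hb, map_add]),
      map_add, map_add]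

theorem PCompl.ev_liftAdd (f : A →+ PCompl p B) {n : ℕ} {x : PCompl p A} {a : A}
    (ha : PCompl.ev p n x = Ideal.Quotient.mk _ a) :
    PCompl.ev p n (PCompl.liftAdd f x) = PCompl.ev p n (f a) :=
  (PCompl.exists_lift f x).choose_spec n a ha

@[simp]
theorem PCompl.liftAdd_of (f : A →+ PCompl p B) (a : A) :
    PCompl.liftAdd f (PCompl.of p a) = f a :=
  PCompl.ext_ev fun n => PCompl.ev_liftAdd f (PCompl.ev_of n a)

/-- Every element of the completion of `A` is the sum of an element of `A` and a multiple of
`p ^ n`. -/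
theorem PCompl.exists_of_add (n : ℕ) (x : PCompl p A) :
    ∃ (a : A) (y : PCompl p A), x = PCompl.of p a + p ^ n • y := by
  obtain ⟨a, ha⟩ := PCompl.exists_ev_eq n x
  have h1 : x - PCompl.of p a ∈ (Ideal.span {(p : A)} ^ n • ⊤ : Submodule A (PCompl p A)) := by
    rw [AdicCompletion.pow_smul_top_eq_ker_eval ⟨{(p : A)}, by simp⟩]
    change AdicCompletion.eval _ _ n (x - PCompl.of p a) = 0
    have h2 : PCompl.ev p n (x - PCompl.of p a) = 0 := by
      rw [map_sub, ha, PCompl.ev_of, sub_self]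
    have h3 := AdicCompletion.factor_evalₐ_eq_eval (Ideal.span {(p : A)}) (n := n)
      (x - PCompl.of p a) (by simp)
    rw [← h3]
    exact (congrArg _ h2).trans (map_zero _)
  rw [Ideal.span_singleton_pow, Submodule.ideal_span_singleton_smul,
    Submodule.mem_smul_pointwise_iff_exists] at h1
  obtain ⟨y, -, hy⟩ := h1
  refine ⟨a, y, ?_⟩
  rw [← sub_eq_iff_eq_add', ← hy, nsmul_eq_mul, Algebra.smul_def]
  simp

/-- Additive maps out of the completion of `A` with values in a completion are determined by their
values on `A`. -/
theorem PCompl.addHom_ext {f g : PCompl p A →+ PCompl p B}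
    (h : ∀ a, f (PCompl.of p a) = g (PCompl.of p a)) : f = g := by
  have hz : ∀ (n : ℕ) (y : PCompl p B), PCompl.ev p n (p ^ n • y) = 0 := fun n y =>
    PCompl.ev_map_eq_zero (A := PCompl p B) (AddMonoidHom.id (PCompl p B)) n (by
      rw [Ideal.span_singleton_pow, Ideal.mem_span_singleton]
      exact ⟨y, (nsmul_eq_mul _ _).trans (by rw [Nat.cast_pow])⟩)
  refine AddMonoidHom.ext fun x => PCompl.ext_ev fun n => ?_
  obtain ⟨a, y, rfl⟩ := PCompl.exists_of_add n x
  have hx : ∀ f : PCompl p A →+ PCompl p B, PCompl.ev p n (f (PCompl.of p a + p ^ n • y)) =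
      PCompl.ev p n (f (PCompl.of p a)) := by
    intro f
    rw [map_add f, map_nsmul f, map_add (PCompl.ev p n), hz, add_zero]
  rw [hx f, hx g, h]

variable (p) in
/-- The map induced on `p`-adic completions by an additive map. -/
def PCompl.mapAdd (f : A →+ B) : PCompl p A →+ PCompl p B :=
  PCompl.liftAdd ((PCompl.of p : B →+* PCompl p B).toAddMonoidHom.comp f)

@[simp]
theorem PCompl.mapAdd_of (f : A →+ B) (a : A) :
    PCompl.mapAdd p f (PCompl.of p a) = PCompl.of p (f a) :=
  PCompl.liftAdd_of _ a

theorem PCompl.mapAdd_ringHom (f : A →+* B) (x : PCompl p A) :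
    PCompl.mapAdd p (f : A →+ B) x = PCompl.map p f x := by
  have h : PCompl.mapAdd p (f : A →+ B) = (PCompl.map p f).toAddMonoidHom :=
    PCompl.addHom_ext fun a => (PCompl.mapAdd_of _ a).trans (PCompl.map_of p f a).symm
  rw [h]
  rfl

theorem PCompl.mapAdd_id : PCompl.mapAdd p (AddMonoidHom.id A) = AddMonoidHom.id _ :=
  PCompl.addHom_ext fun a => by simp

theorem PCompl.mapAdd_comp (g : B →+ C) (f : A →+ B) :
    PCompl.mapAdd p (g.comp f) = (PCompl.mapAdd p g).comp (PCompl.mapAdd p f) :=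
  PCompl.addHom_ext fun a => by simp

theorem PCompl.mapAdd_add (f g : A →+ B) :
    PCompl.mapAdd p (f + g) = PCompl.mapAdd p f + PCompl.mapAdd p g :=
  PCompl.addHom_ext fun a => by simp

theorem PCompl.mapAdd_zero : PCompl.mapAdd p (0 : A →+ B) = 0 :=
  PCompl.addHom_ext fun a => by simp

/-- If `f` is semilinear along `i : C → A` and `j : C → lim B/pⁿ`, then so is its extension to the
completions. -/
theorem PCompl.liftAdd_semilinear {f : A →+ PCompl p B} {i : C →+* A} {j : C →+* B}
    (h : ∀ s a, f (i s * a) = PCompl.of p (j s) * f a) (s : PCompl p C) (x : PCompl p A) :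
    PCompl.liftAdd f (PCompl.map p i s * x) = PCompl.map p j s * PCompl.liftAdd f x := by
  refine PCompl.ext_ev fun n => ?_
  obtain ⟨a, ha⟩ := PCompl.exists_ev_eq n x
  obtain ⟨b, hb⟩ := PCompl.exists_ev_eq n s
  have hi : PCompl.ev p n (PCompl.map p i s) = Ideal.Quotient.mk _ (i b) := by
    refine (PCompl.evalₐ_map p i n s).trans ?_
    rw [show AdicCompletion.evalₐ _ n s = Ideal.Quotient.mk _ b from hb]
    simp
  have hj : PCompl.ev p n (PCompl.map p j s) = Ideal.Quotient.mk _ (j b) := by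
    refine (PCompl.evalₐ_map p j n s).trans ?_
    rw [show AdicCompletion.evalₐ _ n s = Ideal.Quotient.mk _ b from hb]
    simp
  rw [PCompl.ev_liftAdd f (a := i b * a) (by rw [map_mul, hi, ha, map_mul]), h, map_mul, map_mul,
    PCompl.ev_liftAdd f ha, hj, PCompl.ev_of]

theorem PCompl.liftAdd_of_mul {f : A →+ PCompl p B} {a : A} {b : PCompl p B}
    (h : ∀ x, f (a * x) = b * f x) (x : PCompl p A) :
    PCompl.liftAdd f (PCompl.of p a * x) = b * PCompl.liftAdd f x := by
  refine PCompl.ext_ev fun n => ?_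
  obtain ⟨y, hy⟩ := PCompl.exists_ev_eq n x
  rw [PCompl.ev_liftAdd f (a := a * y) (by rw [map_mul, PCompl.ev_of, hy, map_mul]), h, map_mul,
    map_mul, PCompl.ev_liftAdd f hy]

theorem PCompl.mapAdd_of_mul {f : A →+ B} {a : A} {b : B} (h : ∀ x, f (a * x) = b * f x)
    (x : PCompl p A) :
    PCompl.mapAdd p f (PCompl.of p a * x) = PCompl.of p b * PCompl.mapAdd p f x :=
  PCompl.liftAdd_of_mul (fun x => (congrArg (PCompl.of p) (h x)).trans (map_mul _ _ _)) x

/-- The `p`-adic completion of a `p`-torsion free ring is `p`-torsion free. -/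
theorem PCompl.torsionFree (hA : ∀ a : A, (p : A) * a = 0 → a = 0) (x : PCompl p A)
    (hx : (p : PCompl p A) * x = 0) : x = 0 := by
  refine PCompl.ext_ev fun n => ?_
  obtain ⟨a, ha⟩ := PCompl.exists_ev_eq (n + 1) x
  have h1 : PCompl.ev p (n + 1) ((p : PCompl p A) * x) = 0 := by rw [hx, map_zero]
  rw [map_mul, ha, map_natCast, ← map_natCast (Ideal.Quotient.mk _), ← map_mul,
    Ideal.Quotient.eq_zero_iff_mem, Ideal.span_singleton_pow, Ideal.mem_span_singleton] at h1
  obtain ⟨b, hb⟩ := h1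
  have h2 : a = (p : A) ^ n * b := by
    rw [← sub_eq_zero]
    refine hA _ ?_
    rw [mul_sub, hb]
    ring
  rw [PCompl.ev_eq_of_le n.le_succ ha, map_zero, Ideal.Quotient.eq_zero_iff_mem,
    Ideal.span_singleton_pow, Ideal.mem_span_singleton]
  exact ⟨b, h2⟩

end AdditiveFunctoriality

/-! ### Diagonal operators on `S_∞` -/

section DiagonalOperators

variable (p : ℕ)

/-- The group `ℤ[1/p]/ℤ` of exponents of `T` modulo integral exponents. -/
abbrev ExpClass : Type := ExpGroup p ⧸ (intToExp p).range

variable {p} {K : Type*} [CommRing K]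

theorem ExpClass.mk_intToExp_add (i : ℤ) (r : ExpGroup p) :
    (QuotientAddGroup.mk (intToExp p i + r) : ExpClass p) = QuotientAddGroup.mk r := by
  rw [QuotientAddGroup.mk_add,
    (QuotientAddGroup.eq_zero_iff _).mpr (AddMonoidHom.mem_range.mpr ⟨i, rfl⟩), zero_add]

/-- The diagonal operator on `K[T^{±1/p^∞}]` that multiplies `T ^ r` by a weight depending only on
the class of `r` modulo `ℤ`. -/
def diagTorus (f : ExpClass p → K) :
    AddMonoidAlgebra K (ExpGroup p) →+ AddMonoidAlgebra K (ExpGroup p) :=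
  AddMonoidAlgebra.liftNC (AddMonoidAlgebra.singleAddHom 0)
    (fun r => AddMonoidAlgebra.single r.toAdd (f (QuotientAddGroup.mk r.toAdd)))

@[simp]
theorem diagTorus_single (f : ExpClass p → K) (r : ExpGroup p) (b : K) :
    diagTorus f (AddMonoidAlgebra.single r b) =
      AddMonoidAlgebra.single r (b * f (QuotientAddGroup.mk r)) := by
  simp [diagTorus, AddMonoidAlgebra.liftNC_single, AddMonoidAlgebra.single_mul_single]

theorem diagTorus_one : diagTorus (1 : ExpClass p → K) = AddMonoidHom.id _ :=
  AddMonoidAlgebra.addMonoidHom_ext fun r b => by simp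

theorem diagTorus_mul (f g : ExpClass p → K) :
    diagTorus (f * g) = (diagTorus f).comp (diagTorus g) :=
  AddMonoidAlgebra.addMonoidHom_ext fun r b => by simp [mul_assoc, mul_comm (f _)]

theorem diagTorus_zero : diagTorus (0 : ExpClass p → K) = 0 :=
  AddMonoidAlgebra.addMonoidHom_ext fun r b => by simp

theorem diagTorus_add (f g : ExpClass p → K) : diagTorus (f + g) = diagTorus f + diagTorus g :=
  AddMonoidAlgebra.addMonoidHom_ext fun r b => by simp [mul_add, AddMonoidAlgebra.single_add]

theorem torusIncl_single (i : ℤ) (b : K) :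
    torusIncl p K (AddMonoidAlgebra.single i b) = AddMonoidAlgebra.single (intToExp p i) b :=
  AddMonoidAlgebra.mapDomain_single

theorem diagTorus_const (k : K) (a : AddMonoidAlgebra K (ExpGroup p)) :
    diagTorus (fun _ => k) a = torusIncl p K (LaurentPolynomial.C k) * a := by
  induction a using AddMonoidAlgebra.induction_linear with
  | zero => simp
  | add a c ha hc => rw [map_add, ha, hc, mul_add]
  | single r d =>
    rw [diagTorus_single]
    change _ = torusIncl p K (AddMonoidAlgebra.single 0 k) * _
    rw [torusIncl_single, AddMonoidAlgebra.single_mul_single, map_zero, zero_add, mul_comm]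

/-- Diagonal operators are linear over `K[T^{±1}]`. -/
theorem diagTorus_torusIncl_mul (f : ExpClass p → K) (s : LaurentPolynomial K)
    (a : AddMonoidAlgebra K (ExpGroup p)) :
    diagTorus f (torusIncl p K s * a) = torusIncl p K s * diagTorus f a := by
  induction s using AddMonoidAlgebra.induction_linear with
  | zero => simp
  | add s t hs ht => rw [map_add, add_mul, map_add, hs, ht, add_mul]
  | single i b =>
    induction a using AddMonoidAlgebra.induction_linear with
    | zero => simp
    | add a c ha hc => rw [mul_add, map_add, ha, hc, map_add, mul_add]
    | single r d =>
      rw [torusIncl_single, AddMonoidAlgebra.single_mul_single, diagTorus_single, diagTorus_single,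
        AddMonoidAlgebra.single_mul_single, ExpClass.mk_intToExp_add, mul_assoc]

theorem intToExp_injective : Function.Injective (intToExp p) := by
  intro i j h
  have : ((i : ℤ) : ℚ) = j := congrArg Subtype.val h
  exact_mod_cast this

/-- The projection of `K[T^{±1/p^∞}]` onto `K[T^{±1}]` that forgets the terms with non-integral
exponents. -/
def integralPart : AddMonoidAlgebra K (ExpGroup p) →+ LaurentPolynomial K :=
  (AddMonoidAlgebra.coeffAddEquiv (R := K) (M := ℤ)).symm.toAddMonoidHom.comp
    ((Finsupp.comapDomain.addMonoidHom (intToExp_injective (p := p))).comp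
      (AddMonoidAlgebra.coeffAddEquiv (R := K) (M := ExpGroup p)).toAddMonoidHom)

theorem integralPart_single_intToExp (i : ℤ) (b : K) :
    integralPart (AddMonoidAlgebra.single (intToExp p i) b) = AddMonoidAlgebra.single i b := by
  apply (AddMonoidAlgebra.coeffAddEquiv (R := K) (M := ℤ)).injective
  ext j
  simp only [integralPart, AddMonoidHom.comp_apply]
  change (Finsupp.single (intToExp p i) b) (intToExp p j) = (Finsupp.single i b) j
  rw [Finsupp.single_apply, Finsupp.single_apply]
  simp [intToExp_injective.eq_iff]

theorem integralPart_single_of_notMem {r : ExpGroup p} (hr : r ∉ (intToExp p).range) (b : K) :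
    integralPart (AddMonoidAlgebra.single r b) = 0 := by
  apply (AddMonoidAlgebra.coeffAddEquiv (R := K) (M := ℤ)).injective
  ext j
  change (Finsupp.single r b) (intToExp p j) = 0
  rw [Finsupp.single_apply, if_neg]
  rintro rfl
  exact hr ⟨j, rfl⟩

theorem integralPart_torusIncl_mul (s : LaurentPolynomial K)
    (a : AddMonoidAlgebra K (ExpGroup p)) :
    integralPart (torusIncl p K s * a) = s * integralPart a := by
  induction s using AddMonoidAlgebra.induction_linear with
  | zero => simp
  | add s t hs ht => rw [map_add, add_mul, map_add, hs, ht, add_mul]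
  | single i b =>
    induction a using AddMonoidAlgebra.induction_linear with
    | zero => simp
    | add a c ha hc => rw [mul_add, map_add, ha, hc, map_add, mul_add]
    | single r d =>
      rw [torusIncl_single, AddMonoidAlgebra.single_mul_single]
      by_cases hr : r ∈ (intToExp p).range
      · obtain ⟨j, rfl⟩ := hr
        rw [← map_add, integralPart_single_intToExp, integralPart_single_intToExp,
          AddMonoidAlgebra.single_mul_single]
      · rw [integralPart_single_of_notMem hr, mul_zero, integralPart_single_of_notMem]
        rwa [AddSubgroup.add_mem_cancel_left _ (AddMonoidHom.mem_range.mpr ⟨i, rfl⟩)]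

open Classical in
/-- Projecting onto the integral exponents is the diagonal operator whose weight is the indicator
function of the trivial class. -/
theorem torusIncl_integralPart (a : AddMonoidAlgebra K (ExpGroup p)) :
    torusIncl p K (integralPart a) = diagTorus (Pi.single 0 1) a := by
  induction a using AddMonoidAlgebra.induction_linear with
  | zero => simp
  | add a c ha hc => rw [map_add, map_add, ha, hc, map_add]
  | single r d =>
    rw [diagTorus_single]
    by_cases hr : r ∈ (intToExp p).range
    · rw [(QuotientAddGroup.eq_zero_iff r).mpr hr]
      obtain ⟨j, rfl⟩ := hr
      rw [integralPart_single_intToExp, torusIncl_single]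
      simp
    · rw [integralPart_single_of_notMem hr, Pi.single_eq_of_ne]
      · simp
      · rwa [Ne, QuotientAddGroup.eq_zero_iff]

variable [Fact p.Prime]

/-- The ring `ℤ_p^cycl[κ]`. -/
abbrev CycPoly (p : ℕ) [Fact p.Prime] : Type := Polynomial (Zcyc p)

/-- Weights `ℤ[1/p]/ℤ → ℤ_p^cycl[κ]` act on `S_∞` by `S`-linear diagonal operators. -/
def diagSInf : (ExpClass p → CycPoly p) →+* Module.End (S p) (SInf p) where
  toFun f :=
    { toFun := PCompl.mapAdd p (diagTorus f)
      map_add' := map_add _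
      map_smul' := fun s x => by
        refine PCompl.liftAdd_semilinear (i := torusIncl p (CycPoly p))
          (j := torusIncl p (CycPoly p)) (fun s a => ?_) s x
        rw [AddMonoidHom.comp_apply, diagTorus_torusIncl_mul]
        exact map_mul (PCompl.of p) _ _ }
  map_one' := LinearMap.ext fun x => by
    change PCompl.mapAdd p (diagTorus (1 : ExpClass p → CycPoly p)) x = x
    rw [diagTorus_one, PCompl.mapAdd_id]
    rfl
  map_mul' f g := LinearMap.ext fun x => by
    change PCompl.mapAdd p (diagTorus (f * g)) x =
      PCompl.mapAdd p (diagTorus f) (PCompl.mapAdd p (diagTorus g) x)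
    rw [diagTorus_mul, PCompl.mapAdd_comp]
    rfl
  map_zero' := LinearMap.ext fun x => by
    change PCompl.mapAdd p (diagTorus (0 : ExpClass p → CycPoly p)) x = 0
    rw [diagTorus_zero, PCompl.mapAdd_zero]
    rfl
  map_add' f g := LinearMap.ext fun x => by
    change PCompl.mapAdd p (diagTorus (f + g)) x =
      PCompl.mapAdd p (diagTorus f) x + PCompl.mapAdd p (diagTorus g) x
    rw [diagTorus_add, PCompl.mapAdd_add]
    rfl

/-- The structure map of the `ℤ_p^cycl[κ]`-algebra `S`. -/
def cycPolyToS : CycPoly p →+* S p :=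
  (PCompl.of p : S₀ p →+* PCompl p (S₀ p)).comp LaurentPolynomial.C

/-- A constant weight acts as the corresponding scalar of `S`. -/
theorem diagSInf_const (k : CycPoly p) (x : SInf p) :
    diagSInf (fun _ => k) x = cycPolyToS k • x := by
  have h : PCompl.mapAdd p (diagTorus (fun _ : ExpClass p => k)) =
      AddMonoidHom.mulLeft (algebraMap (S p) (SInf p) (cycPolyToS k) : PCompl p (SInf₀ p)) := by
    refine PCompl.addHom_ext fun a => ?_
    rw [PCompl.mapAdd_of, diagTorus_const, map_mul]
    exact congrArg (· * _) (PCompl.map_of p (torusIncl p (CycPoly p)) (LaurentPolynomial.C k)).symm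
  exact DFunLike.congr_fun h x

/-- The `S`-linear projection `S_∞ → S` onto the terms with integral exponents. -/
def sInfToS : SInf p →ₗ[S p] S p where
  toFun := PCompl.mapAdd p (integralPart (p := p) (K := CycPoly p))
  map_add' := map_add _
  map_smul' s x := by
    refine (PCompl.liftAdd_semilinear (i := torusIncl p (CycPoly p))
      (j := RingHom.id _) (fun s a => ?_) s x).trans ?_
    · rw [AddMonoidHom.comp_apply, integralPart_torusIncl_mul]
      exact map_mul (PCompl.of p) _ _
    · rw [PCompl.map_id]
      rfl

open Classical in
theorem algebraMap_sInfToS (x : SInf p) :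
    algebraMap (S p) (SInf p) (sInfToS x) = diagSInf (Pi.single 0 1) x := by
  have h : (PCompl.map p (torusIncl p (CycPoly p))).toAddMonoidHom.comp
      (PCompl.mapAdd p (integralPart (p := p) (K := CycPoly p))) =
      PCompl.mapAdd p (diagTorus (Pi.single 0 1)) := by
    refine PCompl.addHom_ext fun a => ?_
    rw [PCompl.mapAdd_of, ← torusIncl_integralPart, AddMonoidHom.comp_apply, PCompl.mapAdd_of]
    exact PCompl.map_of p _ _
  exact DFunLike.congr_fun h x

theorem sInfToS_one : sInfToS (1 : SInf p) = 1 := by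
  have h : integralPart (1 : SInf₀ p) = 1 := by
    rw [AddMonoidAlgebra.one_def, ← map_zero (intToExp p), integralPart_single_intToExp]
    rfl
  change PCompl.mapAdd p (integralPart (p := p) (K := CycPoly p)) 1 = 1
  rw [← map_one (PCompl.of p), PCompl.mapAdd_of, h, map_one]

end DiagonalOperators

/-! ### Differential operators of infinite order on divided power polynomials -/

section DifferentialOperators

open Finset.HasAntidiagonal

variable {S A Λ : Type*} [CommRing S] [AddCommGroup A] [Module S A] [CommRing Λ]

/-- Differential operators of infinite order with constant coefficients on `⨁ A x^[n]`, where
`x^[n]` stands for `xⁿ/n!`: if `Λ` acts on `A` through `ρ`, then `Λ⟦X⟧` acts on finitely supported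
sequences in `A`, the variable `X` acting as the derivation `x^[n+1] ↦ x^[n]`. -/
def diffOp (ρ : Λ →+* Module.End S A) : PowerSeries Λ →+* Module.End S (ℕ →₀ A) where
  toFun F := Finsupp.lsum S fun i => ∑ x ∈ antidiagonal i,
    Finsupp.lsingle x.2 ∘ₗ ρ (PowerSeries.coeff x.1 F)
  map_one' := by
    refine Finsupp.lhom_ext fun i a => ?_
    rw [Finsupp.lsum_single, LinearMap.sum_apply, Finset.sum_eq_single (0, i)]
    · simp
    · rintro ⟨j, m⟩ h h'
      rw [mem_antidiagonal] at h
      have : j ≠ 0 := by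
        rintro rfl
        exact h' (by simp_all)
      simp [PowerSeries.coeff_one, this]
    · simp [mem_antidiagonal]
  map_zero' := by
    refine Finsupp.lhom_ext fun i a => ?_
    simp
  map_add' F G := by
    refine Finsupp.lhom_ext fun i a => ?_
    simp [Finset.sum_add_distrib]
  map_mul' F G := by
    refine Finsupp.lhom_ext fun i a => ?_
    rw [Module.End.mul_apply, Finsupp.lsum_single, Finsupp.lsum_single, LinearMap.sum_apply,
      LinearMap.sum_apply, map_sum]
    simp only [LinearMap.comp_apply, Finsupp.lsingle_apply, Finsupp.lsum_single,
      LinearMap.sum_apply, PowerSeries.coeff_mul, map_sum, map_mul, Module.End.mul_apply]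
    rw [Finset.sum_sigma', Finset.sum_sigma']
    refine Finset.sum_nbij' (fun x => ⟨(x.2.2, x.2.1 + x.1.2), (x.2.1, x.1.2)⟩)
      (fun x => ⟨(x.2.1 + x.1.1, x.2.2), (x.2.1, x.1.1)⟩) ?_ ?_ ?_ ?_ ?_
    all_goals
      rintro ⟨⟨a, b⟩, ⟨c, d⟩⟩
      simp only [Finset.mem_sigma, mem_antidiagonal]
      rintro ⟨h1, h2⟩
      subst h2
      subst h1
      simp [add_comm, add_left_comm]

variable (ρ : Λ →+* Module.End S A)

theorem diffOp_single (F : PowerSeries Λ) (i : ℕ) (a : A) :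
    diffOp ρ F (Finsupp.single i a) =
      ∑ x ∈ antidiagonal i, Finsupp.single x.2 (ρ (PowerSeries.coeff x.1 F) a) := by
  change Finsupp.lsum S _ _ = _
  rw [Finsupp.lsum_single]
  simp

theorem diffOp_C (l : Λ) (i : ℕ) (a : A) :
    diffOp ρ (PowerSeries.C l) (Finsupp.single i a) = Finsupp.single i (ρ l a) := by
  rw [diffOp_single, Finset.sum_eq_single (0, i)]
  · simp
  · rintro ⟨j, m⟩ h h'
    rw [mem_antidiagonal] at h
    have : j ≠ 0 := by
      rintro rfl
      exact h' (by simp_all)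
    simp [PowerSeries.coeff_C, this]
  · simp [mem_antidiagonal]

theorem diffOp_C_apply (l : Λ) (a : ℕ →₀ A) (i : ℕ) :
    diffOp ρ (PowerSeries.C l) a i = ρ l (a i) := by
  induction a using Finsupp.induction_linear with
  | zero => simp
  | add a b ha hb => rw [map_add, Finsupp.add_apply, ha, hb, Finsupp.add_apply, map_add]
  | single m x =>
    rw [diffOp_C, Finsupp.single_apply, Finsupp.single_apply]
    split_ifs <;> simp

/-- The integration operator `x^[n] ↦ x^[n+1]`. -/
def integration (S A : Type*) [CommRing S] [AddCommGroup A] [Module S A] :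
    Module.End S (ℕ →₀ A) := Finsupp.lmapDomain A S Nat.succ

@[simp]
theorem integration_single (i : ℕ) (a : A) :
    integration S A (Finsupp.single i a) = Finsupp.single (i + 1) a :=
  Finsupp.mapDomain_single

theorem diffOp_X_single_zero (a : A) :
    diffOp ρ PowerSeries.X (Finsupp.single 0 a) = 0 := by
  simp [diffOp_single]

theorem diffOp_X_single_succ (i : ℕ) (a : A) :
    diffOp ρ PowerSeries.X (Finsupp.single (i + 1) a) = Finsupp.single i a := by
  rw [diffOp_single, Finset.sum_eq_single (1, i)]
  · simp
  · rintro ⟨j, m⟩ h h'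
    rw [mem_antidiagonal] at h
    have : j ≠ 1 := by
      rintro rfl
      exact h' (by ext <;> simp; omega)
    simp [PowerSeries.coeff_X, this]
  · simp [mem_antidiagonal, add_comm]

theorem diffOp_X_mul_integration : diffOp ρ PowerSeries.X * integration S A = 1 := by
  refine Finsupp.lhom_ext fun i a => ?_
  rw [Module.End.mul_apply, integration_single, diffOp_X_single_succ, Module.End.one_apply]

/-- The operator that keeps only the constant term. -/
def constTerm (S A : Type*) [CommRing S] [AddCommGroup A] [Module S A] :
    Module.End S (ℕ →₀ A) := Finsupp.lsingle 0 ∘ₗ Finsupp.lapply 0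

theorem integration_mul_diffOp_X :
    integration S A * diffOp ρ PowerSeries.X = 1 - constTerm S A := by
  refine Finsupp.lhom_ext fun i a => ?_
  rw [Module.End.mul_apply, LinearMap.sub_apply, Module.End.one_apply]
  cases i with
  | zero => simp [diffOp_X_single_zero, constTerm]
  | succ i => simp [diffOp_X_single_succ, constTerm]

theorem diffOp_C_mul_integration (l : Λ) :
    diffOp ρ (PowerSeries.C l) * integration S A =
      integration S A * diffOp ρ (PowerSeries.C l) := by
  refine Finsupp.lhom_ext fun i a => ?_
  simp [diffOp_C]

/-- Suppose that `G = g (1 + z k X V)` with `V` a power series with constant term `1`, and that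
`g - 1` is invertible up to `z` on the complement of the image of a projector `e` on which `g` is
the identity. Then `G - 1` is invertible up to `z k` on `⨁ A x^[n]`, apart from the constants
`e A`: on `e A` the operator `G - 1 = z k X V` is inverted by integration and division by `V`, and
on the complement `G - 1` is `g - 1` plus a locally nilpotent multiple of `z`. -/
theorem exists_homotopy_of_diffOp (e g n z k : Λ) (V G : PowerSeries Λ)
    (hG : G = PowerSeries.C g * (1 + PowerSeries.C (z * k) * PowerSeries.X * V))
    (hV : PowerSeries.constantCoeff V = 1)
    (heg : e * g = e) (hne : n * e = 0) (hn : n * (g - 1) = z * (1 - e)) :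
    ∃ H : Module.End S (ℕ →₀ A),
      (diffOp ρ G - 1) * H = diffOp ρ (PowerSeries.C (z * k)) ∧
      H * (diffOp ρ G - 1) =
        diffOp ρ (PowerSeries.C (z * k)) * (1 - constTerm S A * diffOp ρ (PowerSeries.C e)) := by
  obtain ⟨W, hW⟩ : ∃ W, V * W = 1 :=
    ⟨_, PowerSeries.mul_invOfUnit V 1 (by simpa using hV)⟩
  set c : PowerSeries Λ := PowerSeries.C (z * k) with hc
  set E : PowerSeries Λ := PowerSeries.C e with hE
  set N : PowerSeries Λ := PowerSeries.C n with hN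
  set Z : PowerSeries Λ := PowerSeries.C z with hZ
  set K : PowerSeries Λ := PowerSeries.C k with hK
  set γ : PowerSeries Λ := PowerSeries.C g with hγ
  have hcZ : c = Z * K := map_mul _ _ _
  have hEγ : E * γ = E := by rw [hE, hγ, ← map_mul, heg]
  have hNE : N * E = 0 := by rw [hE, hN, ← map_mul, hne, map_zero]
  have hNγ : N * (γ - 1) = Z * (1 - E) := by
    rw [hE, hN, hγ, hZ, ← map_one PowerSeries.C, ← map_sub, ← map_sub, ← map_mul, ← map_mul, hn]
  -- `K * Y * N` inverts `G - 1` on the complement of `E`, since `N * (G - 1)` is `Z * Y⁻¹` there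
  obtain ⟨Y, hY⟩ : ∃ Y, (1 + N * γ * K * PowerSeries.X * V) * Y = 1 :=
    ⟨_, PowerSeries.mul_invOfUnit _ 1 (by simp)⟩
  have hYE : Y * E = E := by
    linear_combination E * hY - Y * γ * K * PowerSeries.X * V * hNE
  have h1 : (G - 1) * (K * Y * N) = c * (1 - E) := by
    rw [hG, hcZ]
    linear_combination K * Y * hNγ + Z * K * hY - Z * K * hYE
  have h2 : (G - 1) * E = c * PowerSeries.X * V * E := by
    rw [hG]
    linear_combination (1 + c * PowerSeries.X * V) * hEγ
  -- power series commute with each other but not with `integration`, so the order matters below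
  have key1 : (diffOp ρ G - 1) * diffOp ρ E = diffOp ρ (c * V * E) * diffOp ρ PowerSeries.X := by
    rw [← map_one (diffOp ρ), ← map_sub, ← map_mul, ← map_mul, h2]
    congr 1
    ring
  have key2 : diffOp ρ W * diffOp ρ E * (diffOp ρ G - 1) =
      diffOp ρ PowerSeries.X * diffOp ρ (c * E) := by
    rw [← map_one (diffOp ρ), ← map_sub, ← map_mul, ← map_mul, ← map_mul]
    congr 1
    linear_combination W * h2 + c * E * PowerSeries.X * hW
  have key3 : diffOp ρ (K * Y * N) * (diffOp ρ G - 1) = diffOp ρ c * (1 - diffOp ρ E) := by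
    rw [← map_one (diffOp ρ), ← map_sub, ← map_sub, ← map_mul, ← map_mul, mul_comm, h1]
  refine ⟨diffOp ρ E * integration S A * diffOp ρ W + diffOp ρ (K * Y * N), ?_, ?_⟩
  · rw [mul_add, ← mul_assoc, ← mul_assoc, key1, mul_assoc (diffOp ρ (c * V * E)),
      diffOp_X_mul_integration, mul_one, ← map_mul, ← map_one (diffOp ρ), ← map_sub, ← map_mul, h1,
      ← map_add]
    congr 1
    linear_combination c * E * hW
  · rw [add_mul, hE, diffOp_C_mul_integration, ← hE, mul_assoc (integration S A), mul_assoc,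
      ← map_mul (diffOp ρ) E W, mul_comm E W, map_mul (diffOp ρ) W E, key2, ← mul_assoc,
      integration_mul_diffOp_X, key3]
    have hcomm : constTerm S A * diffOp ρ (c * E) = diffOp ρ c * (constTerm S A * diffOp ρ E) := by
      rw [hc, hE, ← map_mul]
      refine Finsupp.lhom_ext fun i a => ?_
      rw [Module.End.mul_apply, Module.End.mul_apply, Module.End.mul_apply, diffOp_C, diffOp_C]
      cases i with
      | zero => simp [constTerm, diffOp_C]
      | succ i => simp [constTerm]
    rw [sub_mul, hcomm, one_mul, map_mul, mul_sub, mul_sub, mul_one]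
    abel

end DifferentialOperators

/-! ### The basis of divided powers -/

section DividedPowerBasis

open Polynomial Finset.HasAntidiagonal

variable {p : ℕ} {A : Type*} [CommRing A]

variable (p A) in
/-- `A` has no `p`-torsion and every natural number prime to `p` is invertible in `A`; this holds
for `p`-torsion free `ℤ_p`-algebras. -/
structure IsTorsionFreeLocal : Prop where
  eq_zero : ∀ a : A, (p : A) * a = 0 → a = 0
  isUnit : ∀ n : ℕ, ¬ p ∣ n → IsUnit (n : A)

theorem IsTorsionFreeLocal.algebraMap_injective (h : IsTorsionFreeLocal p A) :
    Function.Injective (algebraMap A (InvP p A)) := by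
  refine IsLocalization.injective (M := Submonoid.powers (p : A)) _ ?_
  rw [Submonoid.powers_le, mem_nonZeroDivisors_iff]
  exact ⟨h.eq_zero, fun a ha => h.eq_zero a (by rwa [mul_comm])⟩

variable [Fact p.Prime]

theorem IsTorsionFreeLocal.isUnit_natCast (h : IsTorsionFreeLocal p A) {n : ℕ} (hn : n ≠ 0) :
    IsUnit (n : InvP p A) := by
  obtain ⟨v, u, hu, rfl⟩ :=
    Nat.exists_eq_pow_mul_and_not_dvd hn p (Fact.out : p.Prime).ne_one
  have h1 : IsUnit (p : InvP p A) := by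
    simpa using IsLocalization.Away.algebraMap_isUnit (S := InvP p A) (p : A)
  have h2 : IsUnit (u : InvP p A) := by
    simpa using (h.isUnit u hu).map (algebraMap A (InvP p A))
  rw [Nat.cast_mul, Nat.cast_pow]
  exact (h1.pow v).mul h2

variable (p A) in
/-- The divided power `xⁿ/n!`. -/
def divPow (h : IsTorsionFreeLocal p A) (n : ℕ) : PDPoly p A :=
  ⟨monomial n ((h.isUnit_natCast n.factorial_ne_zero).unit⁻¹ : (InvP p A)ˣ).1, by
    intro k
    rw [coeff_monomial]
    split_ifs with hk
    · subst hk
      exact ⟨1, by simp⟩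
    · exact ⟨0, by simp⟩⟩

theorem factorial_mul_divPow (h : IsTorsionFreeLocal p A) (n : ℕ) :
    (n.factorial : (InvP p A)[X]) * (divPow p A h n : (InvP p A)[X]) = X ^ n := by
  rw [divPow, ← map_natCast C, C_mul_monomial, IsUnit.mul_val_inv, monomial_one_right_eq_X_pow]

/-- The identification of `⨁ A xⁿ/n!` with the finitely supported sequences in `A`. -/
def ofCoeffs (h : IsTorsionFreeLocal p A) : (ℕ →₀ A) →ₗ[A] PDPoly p A :=
  Finsupp.lsum A fun n => LinearMap.toSpanSingleton A (PDPoly p A) (divPow p A h n)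

theorem ofCoeffs_single (h : IsTorsionFreeLocal p A) (n : ℕ) (a : A) :
    ofCoeffs h (Finsupp.single n a) = a • divPow p A h n := by
  simp [ofCoeffs]

theorem factorial_mul_coeff_ofCoeffs (h : IsTorsionFreeLocal p A) (a : ℕ →₀ A) (n : ℕ) :
    (n.factorial : InvP p A) * (ofCoeffs h a : (InvP p A)[X]).coeff n =
      algebraMap A (InvP p A) (a n) := by
  induction a using Finsupp.induction_linear with
  | zero => simp
  | add a b ha hb =>
    rw [map_add, Subalgebra.coe_add, coeff_add, mul_add, ha, hb, Finsupp.add_apply, map_add]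
  | single m x =>
    rw [ofCoeffs_single, Subalgebra.coe_smul, coeff_smul, divPow, coeff_monomial,
      Finsupp.single_apply, Algebra.smul_def]
    split_ifs with hm
    · subst hm
      rw [mul_left_comm, IsUnit.mul_val_inv, mul_one]
    · simp

theorem ofCoeffs_bijective (h : IsTorsionFreeLocal p A) : Function.Bijective (ofCoeffs h) := by
  constructor
  · intro a b hab
    ext n
    apply h.algebraMap_injective
    rw [← factorial_mul_coeff_ofCoeffs h, hab, factorial_mul_coeff_ofCoeffs h]
  · intro f
    choose a ha using f.2
    refine ⟨Finsupp.onFinset f.1.support (fun n => if n ∈ f.1.support then a n else 0)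
      (by intro n hn; by_contra h'; simp [h'] at hn), ?_⟩
    apply Subtype.ext
    ext n
    refine (h.isUnit_natCast n.factorial_ne_zero).mul_left_cancel ?_
    rw [factorial_mul_coeff_ofCoeffs, Finsupp.onFinset_apply]
    split_ifs with hn
    · exact ha n
    · rw [notMem_support_iff.mp hn]
      simp

/-- The divided powers of `x` form a basis of `⨁ A xⁿ/n!`. -/
def coeffsEquiv (h : IsTorsionFreeLocal p A) : (ℕ →₀ A) ≃ₗ[A] PDPoly p A :=
  LinearEquiv.ofBijective (ofCoeffs h) (ofCoeffs_bijective h)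

theorem coeffsEquiv_single (h : IsTorsionFreeLocal p A) (n : ℕ) (a : A) :
    coeffsEquiv h (Finsupp.single n a) = a • divPow p A h n :=
  ofCoeffs_single h n a

theorem divPow_zero (h : IsTorsionFreeLocal p A) : divPow p A h 0 = 1 := by
  apply Subtype.ext
  simpa using factorial_mul_divPow h 0

/-- The Taylor expansion `g(a xⁱ/i!) = ∑ g(a) tʲ/j! xᵐ/m!` over `j + m = i` for the endomorphism
with `g(x) = x + t`. -/
theorem pdHom_smul_divPow (h : IsTorsionFreeLocal p A) (g : A →+* A) (t : A)
    (ht : ∀ m : ℕ, (m.factorial : A) ∣ t ^ m) {d : ℕ → A}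
    (hd : ∀ j, (j.factorial : A) * d j = t ^ j) (i : ℕ) (a : A) :
    pdHom p g t ht (a • divPow p A h i) =
      ∑ x ∈ antidiagonal i, (d x.1 * g a) • divPow p A h x.2 := by
  apply Subtype.ext
  have hu : IsUnit ((i.factorial : (InvP p A)[X])) := by
    simpa using (h.isUnit_natCast i.factorial_ne_zero).map (C : InvP p A →+* _)
  refine hu.mul_left_cancel ?_
  have e1 : (i.factorial : (InvP p A)[X]) * (pdHom p g t ht (a • divPow p A h i)).1 =
      C (algebraMap A (InvP p A) (g a)) * (X + C (algebraMap A (InvP p A) t)) ^ i := by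
    change _ * transHom p g t (a • (divPow p A h i : (InvP p A)[X])) = _
    rw [← map_natCast (transHom p g t), ← map_mul, mul_smul_comm, factorial_mul_divPow,
      Algebra.smul_def, map_mul, map_pow, Polynomial.algebraMap_apply]
    simp [transHom]
  rw [e1, add_comm X, (Commute.all _ _).add_pow', Finset.mul_sum, AddSubmonoidClass.coe_finsetSum,
    Finset.mul_sum]
  refine Finset.sum_congr rfl fun x hx => ?_
  rw [mem_antidiagonal] at hx
  obtain ⟨j, m⟩ := x
  simp only at hx ⊢
  subst hx
  rw [Subalgebra.coe_smul, Algebra.smul_def, Polynomial.algebraMap_apply, map_mul,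
    ← factorial_mul_divPow h m, ← map_pow, ← map_pow, ← hd j, nsmul_eq_mul,
    ← Nat.add_choose_mul_factorial_mul_factorial j m, Nat.choose_symm_add (a := j)]
  simp only [map_mul, map_natCast, Nat.cast_mul]
  ring

end DividedPowerBasis

/-! ### Divisibility in `ℤ_p[ζ_{p^∞}]` and the weights of the action of `Γ` -/

section Arithmetic

variable (p : ℕ) [Fact p.Prime]

theorem isUnit_natCast_zpZeta {n : ℕ} (hn : ¬ p ∣ n) : IsUnit (n : ZpZeta p) := by
  have h1 : IsUnit (n : ℤ_[p]) := by
    rw [PadicInt.isUnit_iff]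
    have := PadicInt.norm_int_lt_one_iff_dvd (p := p) (n : ℤ)
    by_contra hne
    have hlt : ‖((n : ℤ) : ℤ_[p])‖ < 1 :=
      lt_of_le_of_ne (PadicInt.norm_le_one _) (by simpa using hne)
    exact hn (by exact_mod_cast this.mp hlt)
  simpa using h1.map (algebraMap ℤ_[p] (ZpZeta p))

theorem isTorsionFreeLocal_sInf : IsTorsionFreeLocal p (SInf p) where
  eq_zero := by
    have h1 : ∀ a : ZpZeta p, (p : ZpZeta p) * a = 0 → a = 0 := by
      intro a ha
      have h0 : (p : ZpZeta p) ≠ 0 := by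
        intro h
        have : (p : PadicAlgCl p) = 0 := by simpa using congrArg Subtype.val h
        exact (Fact.out : p.Prime).ne_zero (by exact_mod_cast this)
      exact (mul_eq_zero.mp ha).resolve_left h0
    have h2 := fun x => PCompl.torsionFree h1 x
    have h3 : ∀ a : CycPoly p, (p : CycPoly p) * a = 0 → a = 0 := by
      intro a ha
      refine Polynomial.ext fun n => ?_
      refine (h2 _ ?_).trans (Polynomial.coeff_zero n).symm
      rw [← Polynomial.coeff_natCast_mul, ha, Polynomial.coeff_zero]
    have h4 : ∀ a : SInf₀ p, (p : SInf₀ p) * a = 0 → a = 0 := by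
      intro a ha
      apply AddMonoidAlgebra.coeffAddEquiv.injective
      ext1 r
      rw [map_zero, Finsupp.zero_apply]
      refine h3 _ ?_
      rw [← nsmul_eq_mul] at ha ⊢
      have := congrArg AddMonoidAlgebra.coeffAddEquiv ha
      rw [map_nsmul, map_zero] at this
      simpa using DFunLike.congr_fun this r
    exact fun x => PCompl.torsionFree h4 x
  isUnit n hn := by
    have := (isUnit_natCast_zpZeta p hn).map ((algebraMap (S p) (SInf p)).comp (baseToS p))
    simpa using this

variable {p} (ε : RootSystem p)

/-- `(ζ_p - 1) ^ j / (j + 1)!` is integral: the `p`-adic valuation of `(j + 1)!` is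
`(j + 1 - s)/(p - 1)` where `s ≥ 1` is the sum of the `p`-adic digits of `j + 1`. -/
theorem RootSystem.factorial_succ_dvd (j : ℕ) :
    ((j + 1).factorial : ZpZeta p) ∣ (ε.z 1 - 1) ^ j := by
  have hpp : p.Prime := Fact.out
  set v := padicValNat p (j + 1).factorial with hv
  obtain ⟨u, hu⟩ : p ^ v ∣ (j + 1).factorial := pow_padicValNat_dvd
  have hu' : ¬ p ∣ u := by
    rintro ⟨w, rfl⟩
    refine pow_succ_padicValNat_not_dvd (p := p) (Nat.factorial_ne_zero (j + 1)) ⟨w, ?_⟩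
    rw [← hv, hu]
    ring
  have hdiv : (p : ZpZeta p) ∣ (ε.z 1 - 1) ^ (p - 1) := by
    have hπ0 : ε.z 1 - 1 ≠ 0 := by
      intro h
      have h1 : ε.ζ 1 = 1 := congrArg Subtype.val (sub_eq_zero.mp h)
      exact (ε.primitive 1).ne_one (by simpa using hpp.one_lt) h1
    obtain ⟨k, hk⟩ : (p : ZpZeta p) * (ε.z 1 - 1) ∣ (ε.z 1 - 1) ^ p := by
      obtain ⟨r, hr⟩ := exists_add_pow_prime_eq hpp (ε.z 1 - 1) 1
      have hz : (ε.z 1 - 1 + 1) ^ p = 1 := by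
        rw [sub_add_cancel]
        simpa using ε.z_pow_self 1
      rw [hz, one_pow, mul_one] at hr
      exact ⟨-r, by linear_combination -hr⟩
    refine ⟨k, mul_left_cancel₀ hπ0 ?_⟩
    rw [mul_pow_sub_one hpp.ne_zero, hk]
    ring
  have hle : (p - 1) * v ≤ j := by
    rw [hv, sub_one_mul_padicValNat_factorial]
    have h1 : (p.digits (j + 1)).sum ≠ 0 := by
      intro h0
      have h2 := Nat.getLast_digit_ne_zero p j.succ_ne_zero
      refine h2 (List.sum_eq_zero_iff.mp h0 _ (List.getLast_mem _))
    omega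
  rw [hu]
  push_cast
  rw [(isUnit_natCast_zpZeta p hu').mul_right_dvd]
  refine (pow_dvd_pow_of_dvd hdiv v).trans ?_
  rw [← pow_mul]
  exact pow_dvd_pow _ hle

/-- An element of `ℤ[1/p]` that lies in `ℤ_p` is an integer. -/
theorem mem_range_intToExp {r : ExpGroup p} (hr : ‖((r : ℚ) : ℚ_[p])‖ ≤ 1) :
    r ∈ (intToExp p).range := by
  obtain ⟨k, i, hi⟩ := r.2
  have hp0 : (p : ℚ) ≠ 0 := by exact_mod_cast (Fact.out : p.Prime).ne_zero
  have h1 : ‖((i : ℤ) : ℚ_[p])‖ ≤ (p : ℝ) ^ (-(k : ℤ)) := by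
    have : ((i : ℤ) : ℚ_[p]) = ((r : ℚ) : ℚ_[p]) * (p : ℚ_[p]) ^ k := by
      rw [← Rat.cast_intCast, ← hi]
      push_cast
      rfl
    rw [this, norm_mul, norm_pow, Padic.norm_p, inv_pow, zpow_neg, zpow_natCast]
    exact mul_le_of_le_one_left (by positivity) hr
  obtain ⟨m, hm⟩ := (Padic.norm_int_le_pow_iff_dvd i k).mp h1
  refine AddMonoidHom.mem_range.mpr ⟨m, Subtype.ext ?_⟩
  have h2 : (r : ℚ) * (p : ℚ) ^ k = m * (p : ℚ) ^ k := by
    rw [hi, hm]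
    push_cast
    ring
  exact (mul_right_cancel₀ (pow_ne_zero k hp0) h2).symm

theorem norm_intToExp_le_one (i : ℤ) : ‖(((intToExp p i : ExpGroup p) : ℚ) : ℚ_[p])‖ ≤ 1 := by
  have h : (((intToExp p i : ExpGroup p) : ℚ) : ℚ_[p]) = ((i : ℤ_[p]) : ℚ_[p]) := by
    rw [PadicInt.coe_intCast]
    exact Rat.cast_intCast i
  rw [h]
  exact PadicInt.norm_le_one _

/-- The converse of `RootSystem.rpow_eq_one`: `ζ^q = 1` only for `q ∈ ℤ_p`. -/
theorem RootSystem.norm_le_one_of_rpow_eq_one {q : ℚ_[p]} (h : ε.rpow q = 1) : ‖q‖ ≤ 1 := by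
  obtain ⟨⟨k, n⟩, hkn⟩ := exists_approx q
  rw [ε.rpow_eq hkn] at h
  have h1 : ε.ζ k ^ n = 1 := congrArg Subtype.val h
  obtain ⟨m, rfl⟩ := (ε.primitive k).dvd_of_pow_eq_one n h1
  have hp0 : (p : ℚ_[p]) ≠ 0 := by exact_mod_cast (Fact.out : p.Prime).ne_zero
  have h2 : (((p ^ k * m : ℕ) : ℚ_[p])) / (p : ℚ_[p]) ^ k = ((m : ℤ_[p]) : ℚ_[p]) := by
    push_cast
    field_simp
  rw [h2] at hkn
  have := norm_sub_le_one hkn (y := -((m : ℤ_[p]) : ℚ_[p]))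
    (by rw [norm_neg]; exact PadicInt.norm_le_one _)
  simpa using this

/-- For a non-integral exponent `r`, the root of unity `ζ^r` has order `p^k` with `k ≥ 1`, so that
`ζ_p` is one of its powers and `ζ^r - 1` divides `ζ_p - 1`. -/
theorem RootSystem.rpow_sub_one_dvd {q : ℚ_[p]} (hq : ε.rpow q ≠ 1) :
    ε.rpow q - 1 ∣ ε.z 1 - 1 := by
  set w : PadicAlgCl p := (ε.rpow q : PadicAlgCl p) with hw
  have hw1 : w ≠ 1 := fun h => hq (Subtype.ext h)
  obtain ⟨⟨k, n⟩, hkn⟩ := exists_approx q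
  have hwk : w ^ p ^ k = 1 := by
    have h1 : ε.rpow q ^ p ^ k = 1 := by
      rw [ε.rpow_eq hkn, ← pow_mul, mul_comm, pow_mul, ε.z_pow_self, one_pow]
    exact congrArg Subtype.val h1
  obtain ⟨l, -, hl⟩ := (Nat.dvd_prime_pow Fact.out).mp (orderOf_dvd_of_pow_eq_one hwk)
  have hl0 : l ≠ 0 := by
    rintro rfl
    rw [pow_zero, orderOf_eq_one_iff] at hl
    exact hw1 hl
  have hprim : IsPrimitiveRoot w (p ^ l) := hl ▸ IsPrimitiveRoot.orderOf w
  have hz : ε.ζ 1 ^ p ^ l = 1 := by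
    obtain ⟨l, rfl⟩ := Nat.exists_eq_succ_of_ne_zero hl0
    have h1 : ε.ζ 1 ^ p ^ 1 = 1 := (ε.primitive 1).pow_eq_one
    rw [Nat.succ_eq_add_one, add_comm, pow_add, pow_mul, h1, one_pow]
  have : NeZero (p ^ l) := ⟨pow_ne_zero _ (Fact.out : p.Prime).ne_zero⟩
  obtain ⟨i, -, hi⟩ := hprim.eq_pow_of_pow_eq_one hz
  have h2 : ε.z 1 = ε.rpow q ^ i := Subtype.ext hi.symm
  rw [h2]
  simpa using sub_dvd_pow_sub_pow (ε.rpow q) 1 i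

/-- The weight `r ↦ ζ^(a r)` through which `γ^a` acts on powers of `T`, evaluated at a chosen
representative `r ∈ ℤ[1/p]` of each class. -/
def gammaWeight (a : ℤ_[p]) (q : ExpClass p) : CycPoly p :=
  baseToPoly p (ε.rpow (a * ((q.out : ℚ) : ℚ_[p])))

theorem RootSystem.rpow_mul_congr (a : ℤ_[p]) {r s : ExpGroup p}
    (h : (QuotientAddGroup.mk r : ExpClass p) = QuotientAddGroup.mk s) :
    ε.rpow (a * ((r : ℚ) : ℚ_[p])) = ε.rpow (a * ((s : ℚ) : ℚ_[p])) := by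
  obtain ⟨i, hi⟩ := AddMonoidHom.mem_range.mp (QuotientAddGroup.eq.mp h)
  obtain rfl : s = r + intToExp p i := by rw [hi]; abel
  have h1 : ε.rpow (a * (((intToExp p i : ExpGroup p) : ℚ) : ℚ_[p])) = 1 := by
    refine ε.rpow_eq_one ?_
    rw [norm_mul]
    exact mul_le_one₀ (PadicInt.norm_le_one a) (norm_nonneg _) (norm_intToExp_le_one i)
  have h2 : (a : ℚ_[p]) * (((r + intToExp p i : ExpGroup p) : ℚ) : ℚ_[p]) =
      a * ((r : ℚ) : ℚ_[p]) + a * (((intToExp p i : ExpGroup p) : ℚ) : ℚ_[p]) := by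
    rw [← mul_add, AddSubgroup.coe_add, Rat.cast_add]
  rw [h2, ε.rpow_add, h1, mul_one]

/-- `γ^a` acts on `S_∞` diagonally, with weight `gammaWeight ε a`. -/
theorem gammaSInf_eq_diagSInf (a : ℤ_[p]) (x : SInf p) :
    gammaSInf ε a x = diagSInf (gammaWeight ε a) x := by
  have h : (torusAct ε (baseToPoly p) a : SInf₀ p →+* SInf₀ p).toAddMonoidHom =
      diagTorus (gammaWeight ε a) := by
    refine AddMonoidAlgebra.addMonoidHom_ext fun r b => ?_
    rw [diagTorus_single]
    refine (torusAct_single ε (baseToPoly p) a r b).trans ?_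
    rw [gammaWeight, ε.rpow_mul_congr a (QuotientAddGroup.out_eq' _).symm]
  refine (PCompl.mapAdd_ringHom (torusAct ε (baseToPoly p) a : SInf₀ p →+* SInf₀ p) x).symm.trans ?_
  change PCompl.mapAdd p (torusAct ε (baseToPoly p) a : SInf₀ p →+* SInf₀ p).toAddMonoidHom x = _
  rw [h]
  rfl

/-- A weight that inverts `γ - 1` up to `ζ_p - 1` on the powers `T ^ r` with non-integral `r`. -/
theorem exists_weight_inverse : ∃ n : ExpClass p → CycPoly p, n 0 = 0 ∧
    ∀ q ≠ 0, n q * (gammaWeight ε 1 q - 1) = baseToPoly p (ε.z 1 - 1) := by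
  have h : ∀ q : ExpClass p, ∃ n : CycPoly p, (q = 0 → n = 0) ∧
      (q ≠ 0 → n * (gammaWeight ε 1 q - 1) = baseToPoly p (ε.z 1 - 1)) := by
    intro q
    by_cases hq : q = 0
    · exact ⟨0, fun _ => rfl, fun h => absurd hq h⟩
    · have h1 : ε.rpow (((1 : ℤ_[p]) : ℚ_[p]) * ((q.out : ℚ) : ℚ_[p])) ≠ 1 := by
        intro h
        have h2 := ε.norm_le_one_of_rpow_eq_one h
        rw [PadicInt.coe_one, one_mul] at h2
        apply hq
        rw [← QuotientAddGroup.out_eq' q]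
        exact (QuotientAddGroup.eq_zero_iff _).mpr (mem_range_intToExp h2)
      obtain ⟨b, hb⟩ := ε.rpow_sub_one_dvd h1
      refine ⟨baseToPoly p b, fun h => absurd h hq, fun _ => ?_⟩
      rw [hb, mul_comm, map_mul, map_sub, map_one]
      rfl
  choose n hn0 hn using h
  exact ⟨n, hn0 0 rfl, hn⟩

theorem gammaWeight_zero_class (a : ℤ_[p]) : gammaWeight ε a 0 = 1 := by
  have h : (QuotientAddGroup.mk (Quotient.out (0 : ExpClass p)) : ExpClass p) =
      QuotientAddGroup.mk 0 := QuotientAddGroup.out_eq' _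
  have h2 := ε.rpow_mul_congr a h
  rw [gammaWeight]
  -- the chosen representative is spelled with `Quotient.out`, equal only up to unfolding
  erw [h2]
  rw [ε.rpow_eq_one (by simp), map_one]

end Arithmetic

/-! ### Operators on the completed divided power algebra -/

section OperatorsOnCompletion

variable {p : ℕ} [Fact p.Prime] {S A B : Type*} [CommRing S] [CommRing A] [Algebra S A]
  [CommRing B] (h : IsTorsionFreeLocal p A)

variable (p S A) in
/-- The structure map of the `S`-algebra `⨁ A xⁿ/n!`. -/
abbrev toPD : S →+* PDPoly p A := (algebraMap A (PDPoly p A)).comp (algebraMap S A)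

theorem coeffsEquiv_symm_toPD_mul (s : S) (f : PDPoly p A) :
    (coeffsEquiv h).symm (toPD p S A s * f) = s • (coeffsEquiv h).symm f := by
  rw [RingHom.comp_apply, ← Algebra.smul_def, map_smul, algebraMap_smul]

theorem coeffsEquiv_smul (s : S) (f : ℕ →₀ A) :
    coeffsEquiv h (s • f) = toPD p S A s * coeffsEquiv h f := by
  rw [RingHom.comp_apply, ← Algebra.smul_def, ← map_smul, algebraMap_smul]

/-- The additive endomorphism of `⨁ A xⁿ/n!` given by an operator on coefficient sequences. -/
def endPD (F : Module.End S (ℕ →₀ A)) : PDPoly p A →+ PDPoly p A :=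
  (coeffsEquiv h).toAddMonoidHom.comp
    (F.toAddMonoidHom.comp (coeffsEquiv h).symm.toAddMonoidHom)

theorem endPD_apply (F : Module.End S (ℕ →₀ A)) (f : PDPoly p A) :
    endPD h F f = coeffsEquiv h (F ((coeffsEquiv h).symm f)) := rfl

/-- Operators on coefficient sequences act on the completion of `⨁ A xⁿ/n!`. -/
def endCompl (F : Module.End S (ℕ →₀ A)) : PCompl p (PDPoly p A) →+ PCompl p (PDPoly p A) :=
  PCompl.mapAdd p (endPD h F)

theorem endCompl_one : endCompl h (1 : Module.End S (ℕ →₀ A)) = AddMonoidHom.id _ := by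
  have h1 : endPD h (1 : Module.End S (ℕ →₀ A)) = AddMonoidHom.id _ :=
    AddMonoidHom.ext fun f => by simp [endPD_apply]
  rw [endCompl, h1, PCompl.mapAdd_id]

theorem endCompl_mul (F G : Module.End S (ℕ →₀ A)) :
    endCompl h (F * G) = (endCompl h F).comp (endCompl h G) := by
  have h1 : endPD h (F * G) = (endPD h F).comp (endPD h G) :=
    AddMonoidHom.ext fun f => by simp [endPD_apply]
  exact (congrArg (PCompl.mapAdd p) h1).trans (PCompl.mapAdd_comp _ _)

theorem endCompl_zero : endCompl h (0 : Module.End S (ℕ →₀ A)) = 0 := by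
  have h1 : endPD h (0 : Module.End S (ℕ →₀ A)) = 0 :=
    AddMonoidHom.ext fun f => by simp [endPD_apply]
  rw [endCompl, h1, PCompl.mapAdd_zero]

theorem endCompl_add (F G : Module.End S (ℕ →₀ A)) :
    endCompl h (F + G) = endCompl h F + endCompl h G := by
  have h1 : endPD h (F + G) = endPD h F + endPD h G :=
    AddMonoidHom.ext fun f => by simp [endPD_apply]
  rw [endCompl, h1, PCompl.mapAdd_add]
  rfl

theorem endCompl_of (F : Module.End S (ℕ →₀ A)) (f : PDPoly p A) :
    endCompl h F (PCompl.of p f) = PCompl.of p (coeffsEquiv h (F ((coeffsEquiv h).symm f))) :=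
  PCompl.mapAdd_of _ f

theorem endCompl_toPD_mul (F : Module.End S (ℕ →₀ A)) (s : S) (x : PCompl p (PDPoly p A)) :
    endCompl h F (PCompl.of p (toPD p S A s) * x) =
      PCompl.of p (toPD p S A s) * endCompl h F x := by
  refine PCompl.mapAdd_of_mul (fun f => ?_) x
  rw [endPD_apply, endPD_apply, coeffsEquiv_symm_toPD_mul, map_smul, coeffsEquiv_smul]

theorem endCompl_smul_one (s : S) (x : PCompl p (PDPoly p A)) :
    endCompl h (s • (1 : Module.End S (ℕ →₀ A))) x = PCompl.of p (toPD p S A s) * x := by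
  have h1 : ∀ f, endPD h (s • (1 : Module.End S (ℕ →₀ A))) f = toPD p S A s * f := fun f => by
    rw [endPD_apply, LinearMap.smul_apply, Module.End.one_apply, coeffsEquiv_smul,
      LinearEquiv.apply_symm_apply]
  have h2 : endCompl h (s • (1 : Module.End S (ℕ →₀ A))) =
      AddMonoidHom.mulLeft (PCompl.of p (toPD p S A s)) := by
    refine PCompl.addHom_ext fun f => ?_
    refine (PCompl.mapAdd_of _ f).trans ?_
    rw [h1, map_mul (PCompl.of p)]
    rfl
  exact DFunLike.congr_fun h2 x

theorem endCompl_eq_map {F : Module.End S (ℕ →₀ A)} {g : PDPoly p A →+* PDPoly p A}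
    (hg : ∀ f, g (coeffsEquiv h f) = coeffsEquiv h (F f)) (x : PCompl p (PDPoly p A)) :
    endCompl h F x = PCompl.map p g x := by
  have h1 : endPD h F = (g : PDPoly p A →+ PDPoly p A) := AddMonoidHom.ext fun f => by
    rw [endPD_apply, ← hg, LinearEquiv.apply_symm_apply]
    rfl
  rw [endCompl, h1, PCompl.mapAdd_ringHom]

/-- The map on the completion of `⨁ A xⁿ/n!` that applies `f` to the constant term. -/
def complConst (f : A →+ PCompl p B) : PCompl p (PDPoly p A) →+ PCompl p B :=
  PCompl.liftAdd (f.comp ((Finsupp.applyAddHom 0).comp (coeffsEquiv h).symm.toAddMonoidHom))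

theorem complConst_of (f : A →+ PCompl p B) (g : PDPoly p A) :
    complConst h f (PCompl.of p g) = f ((coeffsEquiv h).symm g 0) :=
  PCompl.liftAdd_of _ g

theorem complConst_toPD_mul {f : A →+ PCompl p B} {s : S} {b : PCompl p B}
    (hf : ∀ a : A, f (s • a) = b * f a) (x : PCompl p (PDPoly p A)) :
    complConst h f (PCompl.of p (toPD p S A s) * x) = b * complConst h f x := by
  refine PCompl.liftAdd_of_mul (fun g => ?_) x
  refine Eq.trans ?_ (hf _)
  exact congrArg (fun y : ℕ →₀ A => f (y 0)) (coeffsEquiv_symm_toPD_mul h s g)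

/-- An operator that takes the constant term and applies the projector `l = j ∘ f` to it acts on the
completion as `j ∘ complConst f`. -/
theorem endCompl_constTerm {l : Module.End S A} {D : Module.End S (ℕ →₀ A)}
    (hD : ∀ a, D a 0 = l (a 0)) {f : A →+ PCompl p B} {j : PCompl p B →+ A}
    (hf : ∀ a, j (f a) = l a) (x : PCompl p (PDPoly p A)) :
    endCompl h (constTerm S A * D) x =
      PCompl.of p (algebraMap A (PDPoly p A) (j (complConst h f x))) := by
  have h2 : endCompl h (constTerm S A * D) =
      ((PCompl.of p).toAddMonoidHom.comp
        ((algebraMap A (PDPoly p A)).toAddMonoidHom.comp j)).comp (complConst h f) := by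
    refine PCompl.addHom_ext fun g => ?_
    rw [endCompl_of, AddMonoidHom.comp_apply, complConst_of]
    refine congrArg (PCompl.of p) ?_
    refine Eq.trans ?_ (congrArg (algebraMap A (PDPoly p A)) (hf _)).symm
    change coeffsEquiv h (Finsupp.single 0 (D _ 0)) = _
    rw [hD, coeffsEquiv_single, divPow_zero, Algebra.algebraMap_eq_smul_one]
  exact DFunLike.congr_fun h2 x

end OperatorsOnCompletion

/-! ### Inverting `γ - 1` on `B^+` -/

section HomotopyOnBPlus

open Finset.HasAntidiagonal

variable {p : ℕ} [Fact p.Prime] (ε : RootSystem p)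

/-- The integral element `(ζ_p - 1) ^ j / (j + 1)!` of `ℤ_p[ζ_{p^∞}]`. -/
def RootSystem.quot (j : ℕ) : ZpZeta p := (ε.factorial_succ_dvd j).choose

theorem RootSystem.factorial_mul_quot (j : ℕ) :
    ((j + 1).factorial : ZpZeta p) * ε.quot j = (ε.z 1 - 1) ^ j :=
  (ε.factorial_succ_dvd j).choose_spec.symm

theorem RootSystem.quot_zero : ε.quot 0 = 1 := by
  simpa using ε.factorial_mul_quot 0

/-- The divided power `c ^ j / j!` of `c = (ζ_p - 1) κ` in `ℤ_p^cycl[κ]`. For `j ≥ 1` one factor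
`ζ_p - 1` is split off explicitly. -/
def cDivPow : ℕ → CycPoly p
  | 0 => 1
  | j + 1 => baseToPoly p (ε.z 1 - 1) * baseToPoly p (ε.quot j) * Polynomial.X ^ (j + 1)

theorem factorial_mul_cDivPow (j : ℕ) :
    (j.factorial : CycPoly p) * cDivPow ε j =
      (baseToPoly p (ε.z 1 - 1) * Polynomial.X) ^ j := by
  cases j with
  | zero => simp [cDivPow]
  | succ j =>
    have h := congrArg (baseToPoly p) (ε.factorial_mul_quot j)
    rw [map_mul, map_natCast, map_pow] at h
    rw [cDivPow]
    linear_combination baseToPoly p (ε.z 1 - 1) * Polynomial.X ^ (j + 1) * h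

theorem cycPolyToS_c : cycPolyToS (baseToPoly p (ε.z 1 - 1) * Polynomial.X) = cElt ε := by
  rw [map_mul, map_sub, map_sub, map_one, map_one]
  rfl

/-- The differential operator through which `γ^a` acts on `⨁ S_∞ xⁿ/n!`: it is `exp(a c X)`, the
Taylor expansion of `x ↦ x + a c`, times the diagonal weight of `γ^a`. -/
def gammaSeries (a : ℤ_[p]) : PowerSeries (ExpClass p → CycPoly p) :=
  PowerSeries.mk fun j => gammaWeight ε a *
    (fun _ => baseToPoly p (algebraMap ℤ_[p] (ZpZeta p) a) ^ j * cDivPow ε j)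

theorem acElt_eq (a : ℤ_[p]) : acElt ε a = algebraMap (S p) (SInf p) (cycPolyToS
    (baseToPoly p (algebraMap ℤ_[p] (ZpZeta p) a) *
      (baseToPoly p (ε.z 1 - 1) * Polynomial.X))) := by
  rw [acElt, map_mul cycPolyToS, cycPolyToS_c]
  rfl

theorem factorial_mul_eq_acElt_pow (a : ℤ_[p]) (j : ℕ) :
    (j.factorial : SInf p) * algebraMap (S p) (SInf p) (cycPolyToS
      (baseToPoly p (algebraMap ℤ_[p] (ZpZeta p) a) ^ j * cDivPow ε j)) = acElt ε a ^ j := by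
  rw [acElt_eq, ← map_pow (algebraMap (S p) (SInf p)), ← map_pow cycPolyToS, mul_pow,
    ← factorial_mul_cDivPow, mul_left_comm, map_mul cycPolyToS (j.factorial : CycPoly p),
    map_mul (algebraMap (S p) (SInf p)),
    map_natCast, map_natCast]

/-- `γ^a` acts on `⨁ S_∞ xⁿ/n!` through the differential operator `gammaSeries ε a`. -/
theorem gammaPD_coeffsEquiv (a : ℤ_[p]) (f : ℕ →₀ SInf p) :
    gammaPD ε a (coeffsEquiv (isTorsionFreeLocal_sInf p) f) =
      coeffsEquiv (isTorsionFreeLocal_sInf p) (diffOp diagSInf (gammaSeries ε a) f) := by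
  induction f using Finsupp.induction_linear with
  | zero => rw [map_zero, map_zero, map_zero, map_zero]
  | add f g hf hg => rw [map_add, map_add, hf, hg, map_add, map_add]
  | single i x =>
    rw [coeffsEquiv_single, diffOp_single, map_sum, gammaPD,
      pdHom_smul_divPow _ _ _ _ (factorial_mul_eq_acElt_pow ε a)]
    refine Finset.sum_congr rfl fun y _ => ?_
    rw [coeffsEquiv_single, gammaSeries, PowerSeries.coeff_mk, map_mul diagSInf,
      Module.End.mul_apply, diagSInf_const, map_smul, ← gammaSInf_eq_diagSInf,
      Algebra.smul_def (cycPolyToS _) (gammaSInf ε a x)]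

/-- As a differential operator `γ` is `g (1 + (ζ_p - 1) κ X V)` with `g` diagonal and `V` an
integral power series with constant term `1`; the coefficients of `V` are integral because
`(ζ_p - 1) ^ j / (j + 1)!` is. -/
theorem gammaSeries_one : gammaSeries ε 1 = PowerSeries.C (gammaWeight ε 1) *
    (1 + PowerSeries.C ((fun _ => baseToPoly p (ε.z 1 - 1)) * (fun _ => Polynomial.X)) *
      PowerSeries.X *
      PowerSeries.mk fun j => (fun _ => baseToPoly p (ε.quot j) * Polynomial.X ^ j)) := by
  ext j q : 2
  rw [gammaSeries, PowerSeries.coeff_mk, PowerSeries.coeff_C_mul, map_add, mul_assoc,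
    PowerSeries.coeff_C_mul]
  cases j with
  | zero => simp [cDivPow]
  | succ j =>
    rw [PowerSeries.coeff_succ_X_mul, PowerSeries.coeff_mk, PowerSeries.coeff_one, if_neg (by simp)]
    simp only [Pi.mul_apply, Pi.add_apply, Pi.zero_apply, cDivPow, map_one, one_pow]
    ring

theorem diffOp_C_const (k : CycPoly p) :
    diffOp diagSInf (PowerSeries.C (fun _ => k)) = cycPolyToS k • 1 := by
  refine Finsupp.lhom_ext fun i x => ?_
  rw [diffOp_C, diagSInf_const]
  simp

open Classical in
/-- On `⨁ S_∞ xⁿ/n!` the operator `γ - 1` is invertible up to `c`, apart from the summand `S`. -/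
theorem exists_homotopy_coeffs : ∃ H : Module.End (S p) (ℕ →₀ SInf p),
    (diffOp diagSInf (gammaSeries ε 1) - 1) * H = cElt ε • 1 ∧
    H * (diffOp diagSInf (gammaSeries ε 1) - 1) = cElt ε •
      (1 - constTerm (S p) (SInf p) * diffOp diagSInf (PowerSeries.C (Pi.single 0 1))) := by
  obtain ⟨n, hn0, hn⟩ := exists_weight_inverse ε
  obtain ⟨H, h1, h2⟩ := exists_homotopy_of_diffOp (diagSInf (p := p)) (Pi.single 0 1)
    (gammaWeight ε 1) n (fun _ => baseToPoly p (ε.z 1 - 1)) (fun _ => Polynomial.X) _ _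
    (gammaSeries_one ε)
    (by
      rw [← PowerSeries.coeff_zero_eq_constantCoeff_apply, PowerSeries.coeff_mk, ε.quot_zero]
      ext1 q
      simp)
    (by
      ext1 q
      by_cases hq : q = 0
      · subst hq
        simp [gammaWeight_zero_class]
      · simp [hq])
    (by
      ext1 q
      by_cases hq : q = 0
      · subst hq
        simp [hn0]
      · simp [hq])
    (by
      ext1 q
      by_cases hq : q = 0
      · subst hq
        simp [hn0]
      · simpa [hq] using hn q hq)
  have hc : diffOp diagSInf (PowerSeries.C ((fun _ : ExpClass p => baseToPoly p (ε.z 1 - 1)) *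
      (fun _ => Polynomial.X))) = cElt ε • 1 := by
    rw [← cycPolyToS_c, ← diffOp_C_const]
    rfl
  refine ⟨H, by rw [h1, hc], by rw [h2, hc, smul_mul_assoc, one_mul]⟩

/-- Operators on coefficient sequences act on the completion `B^+`. -/
def endBPlus : Module.End (S p) (ℕ →₀ SInf p) →+* Module.End (S p) (BPlus p) where
  toFun F :=
    { toFun := endCompl (isTorsionFreeLocal_sInf p) F
      map_add' := map_add _
      map_smul' := endCompl_toPD_mul (isTorsionFreeLocal_sInf p) F }
  map_one' := LinearMap.ext fun x => DFunLike.congr_fun (endCompl_one _) x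
  map_mul' F G := LinearMap.ext fun x => DFunLike.congr_fun (endCompl_mul _ F G) x
  map_zero' := LinearMap.ext fun x => DFunLike.congr_fun (endCompl_zero _) x
  map_add' F G := LinearMap.ext fun x => DFunLike.congr_fun (endCompl_add _ F G) x

theorem endBPlus_gammaSeries (a : ℤ_[p]) (x : BPlus p) :
    endBPlus (diffOp diagSInf (gammaSeries ε a)) x = gammaB ε a x :=
  endCompl_eq_map (isTorsionFreeLocal_sInf p) (gammaPD_coeffsEquiv ε a) x

theorem endBPlus_smul_one (s : S p) :
    endBPlus (s • (1 : Module.End (S p) (ℕ →₀ SInf p))) = s • 1 :=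
  LinearMap.ext fun x => endCompl_smul_one (isTorsionFreeLocal_sInf p) s x

theorem endBPlus_sub (F G : Module.End (S p) (ℕ →₀ SInf p)) :
    endBPlus (F - G) = endBPlus F - endBPlus G := by
  rw [eq_sub_iff_add_eq, ← map_add]
  exact congrArg endBPlus (sub_add_cancel F G)

/-- The `S`-linear retraction of `S → B^+` that forgets all terms other than `T^i` with integral
`i`. -/
def bPlusToS : BPlus p →ₗ[S p] S p where
  toFun := complConst (B := S₀ p) (isTorsionFreeLocal_sInf p) (sInfToS (p := p)).toAddMonoidHom
  map_add' := map_add _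
  map_smul' s x := complConst_toPD_mul (B := S₀ p) (isTorsionFreeLocal_sInf p)
    (f := (sInfToS (p := p)).toAddMonoidHom) (s := s) (b := s) (map_smul sInfToS s) x

theorem bPlusToS_of (f : PDPoly p (SInf p)) :
    bPlusToS (PCompl.of p f : BPlus p) =
      sInfToS ((coeffsEquiv (isTorsionFreeLocal_sInf p)).symm f 0) :=
  complConst_of (B := S₀ p) (isTorsionFreeLocal_sInf p) (sInfToS (p := p)).toAddMonoidHom f

theorem bPlusToS_one : bPlusToS (1 : BPlus p) = 1 := by
  have h : (1 : BPlus p) = PCompl.of p 1 := (map_one (PCompl.of p)).symm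
  have h1 : (1 : PDPoly p (SInf p)) =
      coeffsEquiv (isTorsionFreeLocal_sInf p) (Finsupp.single 0 1) := by
    rw [coeffsEquiv_single, divPow_zero, one_smul]
  rw [h, bPlusToS_of, h1, LinearEquiv.symm_apply_apply, Finsupp.single_eq_same, sInfToS_one]

open Classical in
/-- The projector of `exists_homotopy_coeffs` acts on `B^+` as the projector onto `S`. -/
theorem endBPlus_constTerm (x : BPlus p) :
    endBPlus (constTerm (S p) (SInf p) * diffOp diagSInf (PowerSeries.C (Pi.single 0 1))) x =
      bPlusToS x • (1 : BPlus p) := by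
  refine (endCompl_constTerm (B := S₀ p) (isTorsionFreeLocal_sInf p)
    (fun a => diffOp_C_apply diagSInf (Pi.single 0 1) a 0)
    (f := (sInfToS (p := p)).toAddMonoidHom) (j := (algebraMap (S p) (SInf p)).toAddMonoidHom)
    algebraMap_sInfToS x).trans ?_
  rw [Algebra.smul_def, mul_one]
  rfl

/-- The `S`-linear homotopy on `B^+`: the operator `γ - 1` is invertible up to `c`, apart from the
summand `S`. -/
theorem exists_homotopy_bPlus : ∃ H : Module.End (S p) (BPlus p),
    ((gammaB ε 1).toLinearMap - 1) * H = cElt ε • 1 ∧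
    H * ((gammaB ε 1).toLinearMap - 1) =
      cElt ε • (1 - (LinearMap.toSpanSingleton (S p) (BPlus p) 1) ∘ₗ bPlusToS) := by
  classical
  obtain ⟨H, h1, h2⟩ := exists_homotopy_coeffs ε
  have hγ : endBPlus (diffOp diagSInf (gammaSeries ε 1)) = (gammaB ε 1).toLinearMap :=
    LinearMap.ext (endBPlus_gammaSeries ε 1)
  have he : endBPlus (constTerm (S p) (SInf p) * diffOp diagSInf (PowerSeries.C (Pi.single 0 1))) =
      (LinearMap.toSpanSingleton (S p) (BPlus p) 1) ∘ₗ bPlusToS :=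
    LinearMap.ext endBPlus_constTerm
  have h3 : (gammaB ε 1).toLinearMap - 1 = endBPlus (diffOp diagSInf (gammaSeries ε 1) - 1) := by
    rw [endBPlus_sub, map_one, hγ]
  refine ⟨endBPlus H, ?_, ?_⟩
  · rw [h3, ← map_mul, h1, endBPlus_smul_one]
  · rw [h3, ← map_mul, h2, ← one_mul (1 - constTerm (S p) (SInf p) * _), ← smul_mul_assoc, map_mul,
      endBPlus_smul_one, endBPlus_sub, map_one, he, smul_mul_assoc, one_mul]

end HomotopyOnBPlus

/-! ### Congruences modulo powers of `p` -/

section CongruencePowers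

open Finset.HasAntidiagonal

variable (p : ℕ) {A B : Type*} [CommRing A] [CommRing B]

/-- Congruence modulo `p ^ n` in a commutative ring. -/
def CongrMod (n : ℕ) (x y : A) : Prop := ∃ z, x = y + p ^ n * z

variable {p} {n : ℕ}

theorem CongrMod.refl (x : A) : CongrMod p n x x := ⟨0, by simp⟩

theorem CongrMod.of_eq {x y : A} (h : x = y) : CongrMod p n x y := h ▸ CongrMod.refl x

theorem CongrMod.symm {x y : A} (h : CongrMod p n x y) : CongrMod p n y x := by
  obtain ⟨z, rfl⟩ := h
  exact ⟨-z, by ring⟩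

theorem CongrMod.trans {x y z : A} (h : CongrMod p n x y) (h' : CongrMod p n y z) :
    CongrMod p n x z := by
  obtain ⟨s, rfl⟩ := h
  obtain ⟨t, rfl⟩ := h'
  exact ⟨s + t, by ring⟩

theorem CongrMod.add {x y x' y' : A} (h : CongrMod p n x y) (h' : CongrMod p n x' y') :
    CongrMod p n (x + x') (y + y') := by
  obtain ⟨s, rfl⟩ := h
  obtain ⟨t, rfl⟩ := h'
  exact ⟨s + t, by ring⟩

theorem CongrMod.mul {x y x' y' : A} (h : CongrMod p n x y) (h' : CongrMod p n x' y') :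
    CongrMod p n (x * x') (y * y') := by
  obtain ⟨s, rfl⟩ := h
  obtain ⟨t, rfl⟩ := h'
  exact ⟨s * y' + y * t + p ^ n * s * t, by ring⟩

theorem CongrMod.map (f : A →+* B) {x y : A} (h : CongrMod p n x y) :
    CongrMod p n (f x) (f y) := by
  obtain ⟨s, rfl⟩ := h
  exact ⟨f s, by simp⟩

theorem CongrMod.pow_succ_zero {x : A} (h : CongrMod p n x 0) (k : ℕ) :
    CongrMod p n (x ^ (k + 1)) 0 := by
  obtain ⟨s, rfl⟩ := h
  exact ⟨s * (0 + p ^ n * s) ^ k, by ring⟩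

theorem CongrMod.mul_zero {x : A} (h : CongrMod p n x 0) (y : A) : CongrMod p n (x * y) 0 := by
  obtain ⟨s, rfl⟩ := h
  exact ⟨s * y, by ring⟩

theorem CongrMod.smul_zero [Algebra A B] {x : A} (h : CongrMod p n x 0) (y : B) :
    CongrMod p n (x • y) 0 := by
  rw [Algebra.smul_def]
  exact CongrMod.mul_zero (by simpa using h.map (algebraMap A B)) y

theorem CongrMod.sum_zero {ι : Type*} (s : Finset ι) (f : ι → A)
    (h : ∀ i ∈ s, CongrMod p n (f i) 0) : CongrMod p n (∑ i ∈ s, f i) 0 := by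
  classical
  induction s using Finset.induction_on with
  | empty => exact CongrMod.of_eq (by simp)
  | insert i s hi ih =>
    rw [Finset.sum_insert hi]
    simpa using (h i (by simp)).add (ih fun j hj => h j (by simp [hj]))

/-- A ring is dense in its `p`-adic completion. -/
theorem PCompl.exists_congrMod (n : ℕ) (x : PCompl p A) :
    ∃ a : A, CongrMod p n x (PCompl.of p a) := by
  obtain ⟨a, y, h⟩ := PCompl.exists_of_add n x
  exact ⟨a, y, h.trans (congrArg _ ((nsmul_eq_mul _ _).trans (by rw [Nat.cast_pow])))⟩

/-- Open stabilisers modulo `p ^ n` pass from `A` to a ring in which `A` is dense. -/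
theorem exists_congrMod_of_dense {ι : Type*} {q : ι → ℕ → Prop}
    (of : A →+* B) (f : ι → A →+* A) (F : ι → B →+* B) (n : ℕ)
    (hof : ∀ b : B, ∃ x : A, CongrMod p n b (of x)) (hF : ∀ i x, F i (of x) = of (f i x))
    (h : ∀ x : A, ∃ j : ℕ, ∀ i, q i j → CongrMod p n (f i x) x) (b : B) :
    ∃ j : ℕ, ∀ i, q i j → CongrMod p n (F i b) b := by
  obtain ⟨x, hx⟩ := hof b
  obtain ⟨j, hj⟩ := h x
  exact ⟨j, fun i hi => (hx.map (F i)).trans ((CongrMod.of_eq (hF i x)).trans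
    (((hj i hi).map of).trans hx.symm))⟩

/-- A family of operators acting on `x • v i` by `∑ (d k * g x) • v (i - k)` has open stabilisers
modulo `p ^ n` as soon as `g` does and the `d k` with `0 < k` vanish modulo `p ^ n` near `0`. -/
theorem exists_congrMod_of_apply_smul [Fact p.Prime] [Algebra A B]
    {v : ℕ → B} {e : (ℕ →₀ A) →+ B} (he : ∀ i x, e (Finsupp.single i x) = x • v i)
    (φ : ℤ_[p] → B →+* B) (g : ℤ_[p] → A →+* A) {d : ℤ_[p] → ℕ → A}
    (hφ : ∀ a i x, φ a (x • v i) = ∑ y ∈ antidiagonal i, (d a y.1 * g a x) • v y.2) (n : ℕ)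
    (hg : ∀ x, ∃ j : ℕ, ∀ a : ℤ_[p], (p : ℤ_[p]) ^ j ∣ a → CongrMod p n (g a x) x)
    (hd₀ : ∀ a, d a 0 = 1)
    (hdn : ∀ a k, (p : ℤ_[p]) ^ n ∣ a → CongrMod p n (d a (k + 1)) 0) (f : ℕ →₀ A) :
    ∃ j : ℕ, ∀ a : ℤ_[p], (p : ℤ_[p]) ^ j ∣ a → CongrMod p n (φ a (e f)) (e f) := by
  induction f using Finsupp.induction_linear with
  | zero => exact ⟨0, fun a _ => CongrMod.of_eq (by rw [map_zero, map_zero])⟩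
  | add f g' hf hg =>
    obtain ⟨j, hj⟩ := hf
    obtain ⟨k, hk⟩ := hg
    refine ⟨j + k, fun a ha => ?_⟩
    rw [map_add, map_add]
    exact (hj a ((pow_dvd_pow _ (Nat.le_add_right j k)).trans ha)).add
      (hk a ((pow_dvd_pow _ (Nat.le_add_left k j)).trans ha))
  | single i x =>
    obtain ⟨j, hj⟩ := hg x
    refine ⟨j + n, fun a ha => ?_⟩
    rw [he, hφ, ← Finset.add_sum_erase _ _
      (show (0, i) ∈ antidiagonal i by simp [mem_antidiagonal]), ← add_zero (x • v i)]
    refine CongrMod.add ?_ (CongrMod.sum_zero _ _ ?_)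
    · rw [hd₀, one_mul, Algebra.smul_def, Algebra.smul_def]
      exact ((hj a ((pow_dvd_pow _ (Nat.le_add_right j n)).trans ha)).map
        (algebraMap A B)).mul (CongrMod.refl _)
    · rintro ⟨k, m⟩ hkm
      rw [Finset.mem_erase, mem_antidiagonal] at hkm
      have hk : k ≠ 0 := by
        rintro rfl
        exact hkm.1 (by simpa using hkm.2)
      obtain ⟨k, rfl⟩ := Nat.exists_eq_succ_of_ne_zero hk
      exact ((hdn a k ((pow_dvd_pow _ (Nat.le_add_left n j)).trans ha)).mul_zero _).smul_zero _

/-- The family of endomorphisms `x ↦ x + t a` of the divided power algebra, acting through `g a` on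
the coefficients, has open stabilisers modulo `p ^ n` as soon as `g` does and the divided powers
`t a ^ k / k!` with `0 < k` vanish modulo `p ^ n` near `a = 0`. -/
theorem exists_congrMod_pdHom [Fact p.Prime] (h : IsTorsionFreeLocal p A)
    (g : ℤ_[p] → A →+* A) (t : ℤ_[p] → A) (ht : ∀ a (m : ℕ), (m.factorial : A) ∣ t a ^ m)
    {d : ℤ_[p] → ℕ → A} (hd : ∀ a j, (j.factorial : A) * d a j = t a ^ j) (n : ℕ)
    (hg : ∀ x, ∃ j : ℕ, ∀ a : ℤ_[p], (p : ℤ_[p]) ^ j ∣ a → CongrMod p n (g a x) x)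
    (hd₀ : ∀ a, d a 0 = 1)
    (hdn : ∀ a k, (p : ℤ_[p]) ^ n ∣ a → CongrMod p n (d a (k + 1)) 0) (f : PDPoly p A) :
    ∃ j : ℕ, ∀ a : ℤ_[p], (p : ℤ_[p]) ^ j ∣ a →
      CongrMod p n (pdHom p (g a) (t a) (ht a) f) f := by
  obtain ⟨f, rfl⟩ := (coeffsEquiv h).surjective f
  exact exists_congrMod_of_apply_smul (B := PDPoly p A) (v := divPow p A h)
    (e := (coeffsEquiv h).toLinearMap.toAddMonoidHom) (coeffsEquiv_single h)
    (fun a => pdHom p (g a) (t a) (ht a))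
    g (fun a i x => pdHom_smul_divPow h _ _ _ (hd a) i x) n hg hd₀ hdn f

end CongruencePowers

/-! ### Continuity of the action of `Γ` -/

section Continuity

open TensorProduct

variable {p : ℕ} [Fact p.Prime] (ε : RootSystem p)

/-- The stabiliser in `Γ` of an element of `K[T^{±1/p^∞}]` is open. -/
theorem exists_torusAct_eq_self (x : SInf₀ p) :
    ∃ j : ℕ, ∀ a : ℤ_[p], (p : ℤ_[p]) ^ j ∣ a → torusAct ε (baseToPoly p) a x = x := by
  induction x using AddMonoidAlgebra.induction_linear with
  | zero => exact ⟨0, fun a _ => map_zero _⟩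
  | add x y hx hy =>
    obtain ⟨j, hj⟩ := hx
    obtain ⟨k, hk⟩ := hy
    refine ⟨j + k, fun a ha => ?_⟩
    rw [map_add, hj a ((pow_dvd_pow _ (Nat.le_add_right j k)).trans ha),
      hk a ((pow_dvd_pow _ (Nat.le_add_left k j)).trans ha)]
  | single r b =>
    obtain ⟨k, i, hi⟩ := r.2
    refine ⟨k, ?_⟩
    rintro _ ⟨a, rfl⟩
    rw [torusAct_single, ε.rpow_eq_one, map_one, mul_one]
    have h : (((p : ℤ_[p]) ^ k * a : ℤ_[p]) : ℚ_[p]) * ((r : ℚ) : ℚ_[p]) =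
        ((a * (i : ℤ_[p]) : ℤ_[p]) : ℚ_[p]) := by
      push_cast
      rw [← Rat.cast_intCast, ← hi]
      push_cast
      ring
    rw [h]
    exact PadicInt.norm_le_one _

theorem exists_congrMod_gammaSInf (n : ℕ) (x : SInf p) :
    ∃ j : ℕ, ∀ a : ℤ_[p], (p : ℤ_[p]) ^ j ∣ a → CongrMod p n (gammaSInf ε a x) x :=
  exists_congrMod_of_dense (q := fun a j => (p : ℤ_[p]) ^ j ∣ a) (A := SInf₀ p) (B := SInf p)
    (PCompl.of p : SInf₀ p →+* PCompl p (SInf₀ p))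
    (fun a => (torusAct ε (baseToPoly p) a : SInf₀ p →+* SInf₀ p)) (gammaSInf ε) n
    (PCompl.exists_congrMod (A := SInf₀ p) n) (fun _ x => PCompl.map_of p _ x)
    (fun x => (exists_torusAct_eq_self ε x).imp fun _ hj a ha => CongrMod.of_eq (hj a ha)) x

theorem congrMod_cDivPow (n : ℕ) (a : ℤ_[p]) (k : ℕ) (ha : (p : ℤ_[p]) ^ n ∣ a) :
    CongrMod p n
      (baseToPoly p (algebraMap ℤ_[p] (ZpZeta p) a) ^ (k + 1) * cDivPow ε (k + 1)) 0 := by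
  obtain ⟨b, hb⟩ := ha
  have h : CongrMod p n a 0 := ⟨b, by rw [hb, zero_add]⟩
  have h' := h.map ((baseToPoly p).comp (algebraMap ℤ_[p] (ZpZeta p)))
  rw [map_zero] at h'
  exact (h'.pow_succ_zero k).mul_zero _

theorem congrMod_acElt (n : ℕ) (a : ℤ_[p]) (k : ℕ) (ha : (p : ℤ_[p]) ^ n ∣ a) :
    CongrMod p n (algebraMap (S p) (SInf p) (cycPolyToS
      (baseToPoly p (algebraMap ℤ_[p] (ZpZeta p) a) ^ (k + 1) * cDivPow ε (k + 1)))) 0 := by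
  have h := (congrMod_cDivPow ε n a k ha).map ((algebraMap (S p) (SInf p)).comp cycPolyToS)
  rwa [map_zero] at h

theorem acElt_divPow_zero (a : ℤ_[p]) :
    algebraMap (S p) (SInf p) (cycPolyToS (baseToPoly p (algebraMap ℤ_[p] (ZpZeta p) a) ^ 0 *
      cDivPow ε 0)) = 1 := by
  have h1 : cDivPow ε 0 = 1 := rfl
  rw [pow_zero, h1, mul_one, map_one, map_one]

theorem exists_congrMod_gammaPD (n : ℕ) (f : PDPoly p (SInf p)) :
    ∃ j : ℕ, ∀ a : ℤ_[p], (p : ℤ_[p]) ^ j ∣ a → CongrMod p n (gammaPD ε a f) f :=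
  exists_congrMod_pdHom (isTorsionFreeLocal_sInf p) (gammaSInf ε) (acElt ε) (acElt_factorial_dvd ε)
    (factorial_mul_eq_acElt_pow ε) n (exists_congrMod_gammaSInf ε n) (acElt_divPow_zero ε)
    (congrMod_acElt ε n) f

variable (p) in
/-- The map from the divided power algebra to its completion `B^+`. -/
def toBPlus : PDPoly p (SInf p) →+* BPlus p :=
  (PCompl.of p : PDPoly p (SInf p) →+* PCompl p (PDPoly p (SInf p)))

variable (p) in
theorem exists_congrMod_toBPlus (n : ℕ) :
    ∀ b : BPlus p, ∃ x : PDPoly p (SInf p), CongrMod p n b (toBPlus p x) :=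
  PCompl.exists_congrMod (A := PDPoly p (SInf p)) n

theorem gammaB_toBPlus (a : ℤ_[p]) (x : PDPoly p (SInf p)) :
    (gammaB ε a : BPlus p →+* BPlus p) (toBPlus p x) = toBPlus p (gammaPD ε a x) := by
  have := PCompl.map_of (A := PDPoly p (SInf p)) (B := PDPoly p (SInf p)) p (gammaPD ε a) x
  exact this

theorem exists_congrMod_gammaB (n : ℕ) (b : BPlus p) :
    ∃ j : ℕ, ∀ a : ℤ_[p], (p : ℤ_[p]) ^ j ∣ a → CongrMod p n (gammaB ε a b) b := by
  obtain ⟨x, hx⟩ := exists_congrMod_toBPlus p n b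
  obtain ⟨j, hj⟩ := exists_congrMod_gammaPD ε n x
  refine ⟨j, fun a ha => ?_⟩
  have h1 := hx.map (gammaB ε a : BPlus p →+* BPlus p)
  have h2 := (hj a ha).map (toBPlus p)
  rw [gammaB_toBPlus] at h1
  have h4 := h1.trans (h2.trans hx.symm)
  exact h4

variable (R : Type u) [CommRing R] [Algebra (S p) R]

theorem exists_baseChange_sub_mem (n : ℕ) (t : R ⊗[S p] BPlus p) :
    ∃ j : ℕ, ∀ a : ℤ_[p], (p : ℤ_[p]) ^ j ∣ a → (gammaB ε a).toLinearMap.baseChange R t - t ∈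
      (Ideal.span {(p : R)} ^ n • ⊤ : Submodule R (R ⊗[S p] BPlus p)) := by
  induction t using TensorProduct.induction_on with
  | zero => exact ⟨0, fun a _ => by rw [map_zero, sub_zero]; exact zero_mem _⟩
  | add f g hf hg =>
    obtain ⟨j, hj⟩ := hf
    obtain ⟨k, hk⟩ := hg
    refine ⟨j + k, fun a ha => ?_⟩
    rw [map_add, add_sub_add_comm]
    exact add_mem (hj a ((pow_dvd_pow _ (Nat.le_add_right j k)).trans ha))
      (hk a ((pow_dvd_pow _ (Nat.le_add_left k j)).trans ha))
  | tmul r b =>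
    obtain ⟨j, hj⟩ := exists_congrMod_gammaB ε n b
    refine ⟨j, fun a ha => ?_⟩
    obtain ⟨z, hz⟩ := hj a ha
    have h : r ⊗ₜ[S p] ((p : BPlus p) ^ n * z) = (p : R) ^ n • (r ⊗ₜ[S p] z) := by
      rw [← Nat.cast_pow, ← Nat.cast_pow, ← nsmul_eq_mul, Nat.cast_smul_eq_nsmul]
      exact map_nsmul (TensorProduct.mk (S p) R (BPlus p) r) _ _
    rw [LinearMap.baseChange_tmul, AlgHom.toLinearMap_apply, hz, TensorProduct.tmul_add,
      add_sub_cancel_left, h]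
    exact Submodule.smul_mem_smul (Ideal.pow_mem_pow (Ideal.mem_span_singleton_self _) n) trivial

theorem gammaHat_of (a : ℤ_[p]) (t : R ⊗[S p] BPlus p) :
    gammaHat ε R a (AdicCompletion.of _ _ t) =
      AdicCompletion.of _ _ ((gammaB ε a).toLinearMap.baseChange R t) :=
  AdicCompletion.map_of (Ideal.span {(p : R)}) ((gammaB ε a).toLinearMap.baseChange R) t

/-- The orbit maps of `Γ` on `B^+ ⊗̂_S R` are continuous. -/
theorem exists_gammaHat_sub_mem (n : ℕ) (m : BHat p R) :
    ∃ j : ℕ, ∀ a : ℤ_[p], (p : ℤ_[p]) ^ j ∣ a →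
      gammaHat ε R a m - m ∈ (Ideal.span {(p : R)} ^ n • ⊤ : Submodule R (BHat p R)) := by
  obtain ⟨t, ht⟩ := Submodule.Quotient.mk_surjective _ (AdicCompletion.eval (Ideal.span {(p : R)})
    (R ⊗[S p] BPlus p) n m)
  have h : m - AdicCompletion.of _ _ t ∈
      (Ideal.span {(p : R)} ^ n • ⊤ : Submodule R (BHat p R)) := by
    rw [AdicCompletion.pow_smul_top_eq_ker_eval ⟨{(p : R)}, by simp⟩, LinearMap.mem_ker, map_sub,
      ← ht, AdicCompletion.eval_of]
    exact sub_self _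
  obtain ⟨j, hj⟩ := exists_baseChange_sub_mem ε R n t
  refine ⟨j, fun a ha => ?_⟩
  have h1 : gammaHat ε R a (m - AdicCompletion.of _ _ t) ∈
      (Ideal.span {(p : R)} ^ n • ⊤ : Submodule R (BHat p R)) :=
    Submodule.smul_top_le_comap_smul_top _ (gammaHat ε R a) h
  have h2 : gammaHat ε R a (AdicCompletion.of _ _ t) - AdicCompletion.of _ _ t ∈
      (Ideal.span {(p : R)} ^ n • ⊤ : Submodule R (BHat p R)) := by
    rw [gammaHat_of, ← map_sub]
    exact Submodule.smul_top_le_comap_smul_top _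
      (AdicCompletion.of (Ideal.span {(p : R)}) (R ⊗[S p] BPlus p)) (hj a ha)
  rw [map_sub] at h1
  have := sub_mem (add_mem h1 h2) h
  convert this using 1
  abel

end Continuity

/-! ### Inverting `γ - 1` on `B^+ ⊗̂_S R` -/

section HomotopyOnBHat

open TensorProduct

variable {p : ℕ} [Fact p.Prime] (ε : RootSystem p) (R : Type u) [CommRing R] [Algebra (S p) R]

theorem AdicCompletion.map_val_of_eq {R M N : Type*} [CommRing R] {I : Ideal R} [AddCommGroup M]
    [Module R M] [AddCommGroup N] [Module R N] (f : M →ₗ[R] N) {n : ℕ} {x : AdicCompletion I M}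
    {t : M} (h : x.val n = Submodule.Quotient.mk t) :
    (AdicCompletion.map I f x).val n = Submodule.Quotient.mk (f t) := by
  rw [AdicCompletion.map_val_apply, h]
  rfl

/-- The homotopy on `B^+ ⊗̂_S R` obtained from the one on `B^+` by base change: `γ - 1` is
invertible up to `c`, apart from the summand `R`. -/
theorem exists_homotopy_bHat [IsAdicComplete (Ideal.span {(p : R)}) R] :
    ∃ (H : BHat p R →ₗ[R] BHat p R) (e : BHat p R →ₗ[R] R),
      e (AdicCompletion.of _ _ (1 ⊗ₜ 1)) = 1 ∧
      (∀ m, gammaHat ε R 1 (H m) - H m = algebraMap (S p) R (cElt ε) • m) ∧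
      ∀ m, H (gammaHat ε R 1 m - m) =
        algebraMap (S p) R (cElt ε) • (m - e m • AdicCompletion.of _ _ (1 ⊗ₜ 1)) := by
  obtain ⟨H, h1, h2⟩ := exists_homotopy_bPlus ε
  set I : Ideal R := Ideal.span {(p : R)} with hI
  set c : R := algebraMap (S p) R (cElt ε) with hc
  set G := (gammaB ε 1).toLinearMap.baseChange R with hG
  -- the identities hold on `R ⊗ B^+` by base change and are then checked modulo each `p ^ n`
  let e₀ : R ⊗[S p] BPlus p →ₗ[R] R :=
    (TensorProduct.AlgebraTensorModule.rid (S p) R R).toLinearMap ∘ₗ bPlusToS.baseChange R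
  have k1 : ∀ t, G (H.baseChange R t) - H.baseChange R t = c • t := by
    intro t
    induction t using TensorProduct.induction_on with
    | zero => simp
    | add s t hs ht =>
      rw [map_add, map_add, smul_add, ← hs, ← ht]
      abel
    | tmul r b =>
      rw [hG, LinearMap.baseChange_tmul, LinearMap.baseChange_tmul, ← TensorProduct.tmul_sub]
      have := LinearMap.congr_fun h1 b
      rw [Module.End.mul_apply, LinearMap.sub_apply] at this
      refine (congrArg (r ⊗ₜ[S p] ·) this).trans ?_
      rw [LinearMap.smul_apply, Module.End.one_apply, TensorProduct.tmul_smul, hc, algebraMap_smul]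
  have k2 : ∀ t, H.baseChange R (G t - t) = c • (t - e₀ t • (1 ⊗ₜ 1)) := by
    intro t
    induction t using TensorProduct.induction_on with
    | zero => simp
    | add s t hs ht =>
      rw [map_add, add_sub_add_comm, map_add, hs, ht, map_add, add_smul, ← smul_add]
      congr 1
      abel
    | tmul r b =>
      rw [hG, LinearMap.baseChange_tmul, ← TensorProduct.tmul_sub, LinearMap.baseChange_tmul]
      have := LinearMap.congr_fun h2 b
      refine (congrArg (r ⊗ₜ[S p] ·) this).trans ?_
      rw [LinearMap.smul_apply, TensorProduct.tmul_smul, hc, algebraMap_smul, LinearMap.sub_apply,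
        TensorProduct.tmul_sub, Module.End.one_apply, LinearMap.comp_apply,
        LinearMap.toSpanSingleton_apply, TensorProduct.tmul_smul]
      congr 2
      simp only [e₀, LinearMap.comp_apply, LinearMap.baseChange_tmul]
      rw [LinearEquiv.coe_coe, TensorProduct.AlgebraTensorModule.rid_tmul,
        TensorProduct.smul_tmul', TensorProduct.smul_tmul', smul_assoc, smul_eq_mul, mul_one]
  refine ⟨(AdicCompletion.map I (H.baseChange R)).restrictScalars R,
    (AdicCompletion.ofLinearEquiv I R).symm.toLinearMap ∘ₗ
      (AdicCompletion.map I e₀).restrictScalars R, ?_, fun m => ?_, fun m => ?_⟩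
  · change (AdicCompletion.ofLinearEquiv I R).symm (AdicCompletion.map I e₀ _) = 1
    rw [AdicCompletion.map_of, AdicCompletion.ofLinearEquiv_symm_of]
    simp [e₀, bPlusToS_one]
  · refine AdicCompletion.ext fun n => ?_
    obtain ⟨t, ht⟩ := Submodule.Quotient.mk_surjective _ (m.val n)
    have e1 := AdicCompletion.map_val_of_eq (H.baseChange R) ht.symm
    have e2 := AdicCompletion.map_val_of_eq G e1
    change (AdicCompletion.map I G (AdicCompletion.map I (H.baseChange R) m)).val n -
      (AdicCompletion.map I (H.baseChange R) m).val n = c • m.val n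
    rw [e1, e2, ← ht, ← Submodule.Quotient.mk_sub, k1, Submodule.Quotient.mk_smul]
  · refine AdicCompletion.ext fun n => ?_
    obtain ⟨t, ht⟩ := Submodule.Quotient.mk_surjective _ (m.val n)
    have e1 := AdicCompletion.map_val_of_eq G ht.symm
    have e2 : (AdicCompletion.map I G m - m).val n = Submodule.Quotient.mk (G t - t) := by
      rw [AdicCompletion.val_sub_apply, e1, ← ht]
      rfl
    have e3 := AdicCompletion.map_val_of_eq (H.baseChange R) e2
    set r := (AdicCompletion.ofLinearEquiv I R).symm (AdicCompletion.map I e₀ m) with hr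
    have e4 : (Submodule.Quotient.mk r : R ⧸ (I ^ n • ⊤ : Submodule R R)) =
        Submodule.Quotient.mk (e₀ t) := by
      rw [← AdicCompletion.map_val_of_eq e₀ ht.symm]
      rw [← AdicCompletion.of_ofLinearEquiv_symm I (AdicCompletion.map I e₀ m)]
      rfl
    have e5 : (Submodule.Quotient.mk (r • (1 ⊗ₜ 1)) :
        (R ⊗[S p] BPlus p) ⧸ (I ^ n • ⊤ : Submodule R (R ⊗[S p] BPlus p))) =
        Submodule.Quotient.mk (e₀ t • (1 ⊗ₜ 1)) := by
      rw [Submodule.Quotient.eq] at e4 ⊢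
      rw [← sub_smul]
      rw [smul_eq_mul, Ideal.mul_top] at e4
      exact Submodule.smul_mem_smul e4 trivial
    change (AdicCompletion.map I (H.baseChange R) (AdicCompletion.map I G m - m)).val n =
      c • (m.val n - Submodule.Quotient.mk (r • (1 ⊗ₜ 1)))
    rw [e3, k2, e5, ← ht]
    rfl

end HomotopyOnBHat

/-! ### Continuous functions on `ℤ_p` with values in an adically complete module -/

section AdicTopology

open Topology Filter

variable {p : ℕ} [Fact p.Prime]

theorem padic_eventually_dvd_sub (j : ℕ) (a : ℤ_[p]) : ∀ᶠ b in 𝓝 a, (p : ℤ_[p]) ^ j ∣ b - a := by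
  have hp : (0 : ℝ) < (p : ℝ) ^ (-(j : ℤ)) :=
    zpow_pos (by exact_mod_cast (Fact.out : p.Prime).pos) _
  filter_upwards [Metric.closedBall_mem_nhds a hp] with b hb
  rw [mem_closedBall_iff_norm, PadicInt.norm_le_pow_iff_mem_span_pow] at hb
  exact Ideal.mem_span_singleton.mp hb

theorem padic_exists_dvd_sub {δ : ℝ} (hδ : 0 < δ) :
    ∃ j : ℕ, ∀ a b : ℤ_[p], (p : ℤ_[p]) ^ j ∣ b - a → b ∈ Metric.ball a δ := by
  obtain ⟨j, hj⟩ := PadicInt.exists_pow_neg_lt p hδ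
  refine ⟨j, fun a b h => mem_ball_iff_norm.mpr (lt_of_le_of_lt ?_ hj)⟩
  rw [PadicInt.norm_le_pow_iff_mem_span_pow]
  exact Ideal.mem_span_singleton.mpr h

/-- Partial sums of a function with period `P` modulo a submodule `N`: over `q` periods they vanish
modulo `N` once `q` kills the quotient. -/
theorem sum_range_sub_mem {M : Type*} [AddCommGroup M] {N : AddSubgroup M} {f : ℕ → M} {P q : ℕ}
    (hf : ∀ k, f (k + P) - f k ∈ N) (hq : ∀ x : M, q • x ∈ N) (m t : ℕ) :
    ∑ k ∈ Finset.range (m + P * (q * t)), f k - ∑ k ∈ Finset.range m, f k ∈ N := by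
  let s : ℕ → M := fun m => ∑ k ∈ Finset.range m, f k
  have h1 : ∀ m, s (m + P) - s m - s P ∈ N := by
    intro m
    induction m with
    | zero => simp [s]
    | succ m ih =>
      have e : s (m + 1 + P) - s (m + 1) - s P = (s (m + P) - s m - s P) + (f (m + P) - f m) := by
        simp only [s]
        rw [add_right_comm, Finset.sum_range_succ, Finset.sum_range_succ]
        abel
      rw [e]
      exact N.add_mem ih (hf m)
  have h2 : ∀ t m, s (m + P * t) - s m - t • s P ∈ N := by
    intro t m
    induction t with
    | zero => simp
    | succ t ih =>
      have e : s (m + P * (t + 1)) - s m - (t + 1) • s P =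
          (s (m + P * t + P) - s (m + P * t) - s P) + (s (m + P * t) - s m - t • s P) := by
        rw [mul_add_one, ← add_assoc, succ_nsmul]
        abel
      rw [e]
      exact N.add_mem (h1 _) ih
  have h3 : s (m + P * (q * t)) - s m - (q * t) • s P + (q * t) • s P ∈ N := by
    refine N.add_mem (h2 _ _) ?_
    rw [mul_nsmul]
    exact hq _ |> fun h => by simpa [mul_nsmul, nsmul_left_comm] using N.nsmul_mem h t
  simpa [s] using h3

variable {R : Type*} [CommRing R] {I : Ideal R} {M : Type*} [AddCommGroup M] [Module R M]
  [TopologicalSpace M] [IsTopologicalAddGroup M]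

theorem adic_isOpen
    (hb : (𝓝 (0 : M)).HasBasis (fun _ => True) fun n : ℕ => ((I ^ n • ⊤ : Submodule R M) : Set M))
    (n : ℕ) : IsOpen ((I ^ n • ⊤ : Submodule R M) : Set M) :=
  (I ^ n • ⊤ : Submodule R M).toAddSubgroup.isOpen_of_mem_nhds
    (hb.mem_of_mem (i := n) trivial)

theorem adic_tendsto_iff
    (hb : (𝓝 (0 : M)).HasBasis (fun _ => True) fun n : ℕ => ((I ^ n • ⊤ : Submodule R M) : Set M))
    {X : Type*} {l : Filter X} {f : X → M} {y : M} :
    Tendsto f l (𝓝 y) ↔ ∀ n : ℕ, ∀ᶠ x in l, f x - y ∈ (I ^ n • ⊤ : Submodule R M) := by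
  rw [← tendsto_sub_nhds_zero_iff, hb.tendsto_right_iff]
  simp

theorem adic_t2Space [IsHausdorff I M]
    (hb : (𝓝 (0 : M)).HasBasis (fun _ => True) fun n : ℕ => ((I ^ n • ⊤ : Submodule R M) : Set M))
    : T2Space M := by
  refine IsTopologicalAddGroup.t2Space_of_zero_sep fun x hx => ?_
  by_contra! h
  refine hx ((‹IsHausdorff I M›).haus x fun n => ?_)
  rw [SModEq.zero]
  exact h _ (hb.mem_of_mem (i := n) trivial)

/-- A continuous function on `ℤ_p` is uniformly continuous modulo `I ^ n`. -/
theorem exists_sub_mem_of_dvd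
    (hb : (𝓝 (0 : M)).HasBasis (fun _ => True) fun n : ℕ => ((I ^ n • ⊤ : Submodule R M) : Set M))
    (f : C(ℤ_[p], M)) (n : ℕ) :
    ∃ j : ℕ, ∀ a b : ℤ_[p], (p : ℤ_[p]) ^ j ∣ b - a → f b - f a ∈ (I ^ n • ⊤ : Submodule R M) := by
  obtain ⟨δ, hδ, h⟩ := lebesgue_number_lemma_of_metric (isCompact_univ (X := ℤ_[p]))
    (c := fun a : ℤ_[p] => {b | f b - f a ∈ (I ^ n • ⊤ : Submodule R M)})
    (fun a => (adic_isOpen hb n).preimage (f.continuous.sub continuous_const))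
    (fun a _ => Set.mem_iUnion.mpr ⟨a, by simp⟩)
  obtain ⟨j, hj⟩ := padic_exists_dvd_sub (p := p) hδ
  refine ⟨j, fun a b hab => ?_⟩
  obtain ⟨i, hi⟩ := h a trivial
  have h1 : f b - f i ∈ (I ^ n • ⊤ : Submodule R M) := hi (hj a b hab)
  have h2 : f a - f i ∈ (I ^ n • ⊤ : Submodule R M) := hi (Metric.mem_ball_self hδ)
  simpa using sub_mem h1 h2

/-- A function on `ℕ` that is uniformly continuous for the `p`-adic topology extends to `ℤ_p`. -/
theorem exists_continuous_extension [IsAdicComplete I M]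
    (hb : (𝓝 (0 : M)).HasBasis (fun _ => True) fun n : ℕ => ((I ^ n • ⊤ : Submodule R M) : Set M))
    (g : ℕ → M)
    (hg : ∀ n : ℕ, ∃ j : ℕ, ∀ m m' : ℕ, (p : ℤ_[p]) ^ j ∣ (m : ℤ_[p]) - m' →
      g m - g m' ∈ (I ^ n • ⊤ : Submodule R M)) :
    ∃ F : C(ℤ_[p], M), ∀ m : ℕ, F m = g m := by
  choose j hj using hg
  -- a monotone modulus of continuity
  let J : ℕ → ℕ := fun n => ∑ i ∈ Finset.range (n + 1), j i
  have hJ : Monotone J := fun m n hmn =>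
    Finset.sum_le_sum_of_subset (Finset.range_mono (Nat.succ_le_succ hmn))
  have hjJ : ∀ n, j n ≤ J n := fun n =>
    Finset.single_le_sum (f := j) (fun _ _ => Nat.zero_le _) (Finset.self_mem_range_succ n)
  have hspec : ∀ (a : ℤ_[p]) {m n : ℕ}, m ≤ n → (p : ℤ_[p]) ^ j m ∣ a - a.appr (J n) :=
    fun a m n hmn => (pow_dvd_pow _ ((hjJ m).trans (hJ hmn))).trans
      (Ideal.mem_span_singleton.mp (PadicInt.appr_spec (J n) a))
  have hlim : ∀ a : ℤ_[p], ∃ L : M, ∀ n, g (a.appr (J n)) - L ∈ (I ^ n • ⊤ : Submodule R M) := by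
    intro a
    obtain ⟨L, hL⟩ := IsPrecomplete.prec' (I := I) (fun n => g (a.appr (J n))) (by
      intro m n hmn
      rw [SModEq.sub_mem]
      refine hj m _ _ ?_
      simpa using (hspec a hmn).sub (hspec a le_rfl))
    exact ⟨L, fun n => SModEq.sub_mem.mp (hL n)⟩
  choose F hF using hlim
  have key : ∀ (a : ℤ_[p]) (m n : ℕ), (p : ℤ_[p]) ^ j n ∣ a - m →
      F a - g m ∈ (I ^ n • ⊤ : Submodule R M) := by
    intro a m n h
    have h1 := hj n (a.appr (J n)) m (by simpa using h.sub (hspec a le_rfl))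
    simpa using sub_mem h1 (hF a n)
  refine ⟨⟨F, continuous_iff_continuousAt.mpr fun a => (adic_tendsto_iff hb).mpr fun n => ?_⟩,
    fun m => ?_⟩
  · filter_upwards [padic_eventually_dvd_sub (j n) a] with b h
    have h1 := key a (a.appr (J n)) n (hspec a le_rfl)
    have h2 := key b (a.appr (J n)) n (by simpa using h.add (hspec a (le_refl n)))
    simpa using sub_mem h2 h1
  · refine sub_eq_zero.mp ((IsHausdorff.haus (I := I) inferInstance) _ fun n => ?_)
    rw [SModEq.zero]
    exact key m m n (by simp)

/-- The indefinite sum `m ↦ ∑_{k < m} f k` of a continuous function extends continuously from `ℕ`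
to `ℤ_p`. -/
theorem exists_indefinite_sum [IsAdicComplete I M]
    (hb : (𝓝 (0 : M)).HasBasis (fun _ => True) fun n : ℕ => ((I ^ n • ⊤ : Submodule R M) : Set M))
    (hp : (p : R) ∈ I) (f : C(ℤ_[p], M)) :
    ∃ F : C(ℤ_[p], M), ∀ m : ℕ, F m = ∑ k ∈ Finset.range m, f k := by
  refine exists_continuous_extension hb _ fun n => ?_
  obtain ⟨j, hj⟩ := exists_sub_mem_of_dvd (p := p) hb f n
  have main : ∀ m m' : ℕ, m ≤ m' → (p : ℤ_[p]) ^ (j + n) ∣ (m' : ℤ_[p]) - m →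
      ∑ k ∈ Finset.range m', f k - ∑ k ∈ Finset.range m, f k ∈ (I ^ n • ⊤ : Submodule R M) := by
    intro m m' hmm h
    obtain ⟨d, rfl⟩ := Nat.exists_eq_add_of_le hmm
    have hd : p ^ (j + n) ∣ d := by
      have h' : ((p ^ (j + n) : ℕ) : ℤ_[p]) ∣ ((d : ℤ) : ℤ_[p]) := by simpa using h
      have h2 := (PadicInt.norm_int_le_pow_iff_dvd (p := p) (k := (d : ℤ)) (n := j + n)).mp
        ((PadicInt.norm_le_pow_iff_mem_span_pow _ _).mpr
          (Ideal.mem_span_singleton.mpr (by simpa using h')))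
      exact_mod_cast h2
    obtain ⟨t, rfl⟩ := hd
    rw [pow_add, mul_assoc]
    refine sum_range_sub_mem (N := (I ^ n • ⊤ : Submodule R M).toAddSubgroup)
      (f := fun k => f (k : ℤ_[p])) (fun k => hj _ _ (by simp)) (fun x => ?_) m t
    change p ^ n • x ∈ (I ^ n • ⊤ : Submodule R M)
    rw [← Nat.cast_smul_eq_nsmul R, Nat.cast_pow]
    exact Submodule.smul_mem_smul (Ideal.pow_mem_pow hp n) trivial
  -- `f` has period `p ^ j` modulo `I ^ n`, and `p ^ n` kills the quotient by `I ^ n`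
  refine ⟨j + n, fun m m' h => ?_⟩
  rcases le_total m m' with hm | hm
  · rw [← neg_sub]
    exact neg_mem (main m m' hm (by rwa [← dvd_neg, neg_sub]))
  · exact main m' m hm h

end AdicTopology

/-! ### Indefinite sums of continuous functions on `ℤ_p` -/

section IndefiniteSum

open Topology Filter

variable (p : ℕ) [Fact p.Prime] (R : Type*) [CommRing R]

/-- Continuous functions `f` on `ℤ_p` with values in `Y` have indefinite sums, i.e. solutions of
`F (a + 1) - F a = f a`, depending linearly and continuously on `f`. -/
def HasIndefiniteSum (Y : Type*) [AddCommGroup Y] [TopologicalSpace Y] [IsTopologicalAddGroup Y]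
    [Module R Y] [ContinuousConstSMul R Y] : Prop :=
  ∃ Sop : C(ℤ_[p], Y) →ₗ[R] C(ℤ_[p], Y), Continuous Sop ∧ ∀ f a, Sop f (a + 1) - Sop f a = f a

variable {p R}

/-- Complete modules with their adic topology have indefinite sums: the sum over `k < m` extends
from `m ∈ ℕ` to `ℤ_p`, and depends continuously on the function as it preserves congruences. -/
theorem hasIndefiniteSum_of_adic {I : Ideal R} {M : Type*} [AddCommGroup M] [Module R M]
    [TopologicalSpace M] [IsTopologicalAddGroup M] [ContinuousConstSMul R M]
    (hb : (𝓝 (0 : M)).HasBasis (fun _ => True) fun n : ℕ => ((I ^ n • ⊤ : Submodule R M) : Set M))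
    [IsAdicComplete I M] (hp : (p : R) ∈ I) : HasIndefiniteSum p R M := by
  have : T2Space M := adic_t2Space hb
  choose F hF using exists_indefinite_sum (p := p) hb hp
  have hdense : ∀ {f g : ℤ_[p] → M}, Continuous f → Continuous g → (∀ m : ℕ, f m = g m) →
      ∀ a, f a = g a := fun hf hg h a =>
    congrFun (PadicInt.denseRange_natCast.equalizer hf hg (funext h)) a
  let Sop : C(ℤ_[p], M) →ₗ[R] C(ℤ_[p], M) :=
    { toFun := F
      map_add' := fun f g => ContinuousMap.ext <| hdense (F _).continuous (F f + F g).continuous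
        fun m => by simp [hF, Finset.sum_add_distrib]
      map_smul' := fun r f => ContinuousMap.ext <| hdense (F _).continuous (r • F f).continuous
        fun m => by simp [hF, Finset.smul_sum] }
  have hmem : ∀ (n : ℕ) (f : C(ℤ_[p], M)), (∀ a, f a ∈ (I ^ n • ⊤ : Submodule R M)) →
      ∀ a, F f a ∈ (I ^ n • ⊤ : Submodule R M) := by
    intro n f hf a
    have hcl : IsClosed (F f ⁻¹' ((I ^ n • ⊤ : Submodule R M) : Set M)) :=
      (AddSubgroup.isClosed_of_isOpen (I ^ n • ⊤ : Submodule R M).toAddSubgroup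
        (adic_isOpen hb n)).preimage (F f).continuous
    refine PadicInt.denseRange_natCast.induction_on (p := fun a => F f a ∈ _) a hcl fun m => ?_
    rw [hF]
    exact sum_mem fun k _ => hf k
  refine ⟨Sop, ContinuousMap.continuous_of_continuous_uncurry _ ?_, fun f a => ?_⟩
  · refine continuous_iff_continuousAt.mpr fun ⟨f₀, a₀⟩ => (adic_tendsto_iff hb).mpr fun n => ?_
    have h1 : ∀ᶠ q : C(ℤ_[p], M) × ℤ_[p] in 𝓝 (f₀, a₀), ∀ a, (q.1 - f₀) a ∈
        (I ^ n • ⊤ : Submodule R M) := by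
      have ho := (ContinuousMap.isOpen_setOfPred_mapsTo (isCompact_univ (X := ℤ_[p]))
        (adic_isOpen hb n)).preimage ((continuous_fst (X := C(ℤ_[p], M)) (Y := ℤ_[p])).sub
          (continuous_const (y := f₀)))
      filter_upwards [ho.mem_nhds (show (f₀, a₀) ∈ _ by
        intro a _
        simp)] with q hq a
      exact hq trivial
    have h2 : ∀ᶠ q : C(ℤ_[p], M) × ℤ_[p] in 𝓝 (f₀, a₀), F f₀ q.2 - F f₀ a₀ ∈
        (I ^ n • ⊤ : Submodule R M) :=
      (adic_tendsto_iff hb).mp (((F f₀).continuous.comp continuous_snd).tendsto (f₀, a₀)) n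
    filter_upwards [h1, h2] with q hq1 hq2
    have h3 := hmem n _ hq1 q.2
    have e : F (q.1 - f₀) = F q.1 - F f₀ := map_sub Sop _ _
    rw [e, ContinuousMap.sub_apply] at h3
    have h4 := add_mem h3 hq2
    rw [sub_add_sub_cancel] at h4
    exact h4
  · refine hdense (f := fun a => F f (a + 1) - F f a) (by fun_prop) f.continuous (fun m => ?_) a
    have := hF f (m + 1)
    rw [Nat.cast_add_one] at this
    simp only [this, hF, Finset.sum_range_succ, add_sub_cancel_left]

/-- Exchanging the two variables of a continuous function. -/
def swapVar {X X' Y : Type*} [TopologicalSpace X] [TopologicalSpace X'] [TopologicalSpace Y]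
    [LocallyCompactSpace X'] (f : C(X, C(X', Y))) : C(X', C(X, Y)) :=
  (f.uncurry.comp ContinuousMap.prodSwap).curry

theorem continuous_swapVar {X X' Y : Type*} [TopologicalSpace X] [TopologicalSpace X']
    [TopologicalSpace Y] [LocallyCompactSpace X] [LocallyCompactSpace X'] :
    Continuous (swapVar : C(X, C(X', Y)) → C(X', C(X, Y))) :=
  ContinuousMap.continuous_curry.comp
    ((ContinuousMap.continuous_precomp _).comp ContinuousMap.continuous_uncurry)

/-- Indefinite sums in a function space are taken pointwise. -/
theorem HasIndefiniteSum.continuousMap {Y : Type*} [AddCommGroup Y] [TopologicalSpace Y]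
    [IsTopologicalAddGroup Y] [Module R Y] [ContinuousConstSMul R Y]
    (h : HasIndefiniteSum p R Y) (K : Type*) [TopologicalSpace K] [LocallyCompactSpace K] :
    HasIndefiniteSum p R C(K, Y) := by
  obtain ⟨Sop, hc, hS⟩ := h
  refine ⟨{ toFun := fun f => swapVar ((⟨Sop, hc⟩ : C(C(ℤ_[p], Y), C(ℤ_[p], Y))).comp (swapVar f))
            map_add' := fun f g => ?_
            map_smul' := fun r f => ?_ }, ?_, fun f a => ?_⟩
  · ext a k
    exact DFunLike.congr_fun (map_add Sop (swapVar f k) (swapVar g k)) a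
  · ext a k
    exact DFunLike.congr_fun (map_smul Sop r (swapVar f k)) a
  · exact continuous_swapVar.comp ((ContinuousMap.continuous_postcomp _).comp continuous_swapVar)
  · ext k
    exact hS (swapVar f k) a

end IndefiniteSum

/-! ### Representations of `Γ` with indefinite sums -/

section Regular

open Topology TopRep

variable {p : ℕ} [Fact p.Prime] {R : Type u} [CommRing R] [TopologicalSpace R]

variable (p) in
/-- The topological generator `γ` of `Γ`. -/
abbrev gen : Multiplicative ℤ_[p] := Multiplicative.ofAdd 1

/-- The operator `γ - 1` on a representation. -/
def genSub (X : TopRep.{u} R (Multiplicative ℤ_[p])) : X →ₗ[R] X :=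
  (X.ρ (gen p) : X →ₗ[R] X) - LinearMap.id

theorem genSub_apply (X : TopRep.{u} R (Multiplicative ℤ_[p])) (x : X) :
    genSub X x = X.ρ (gen p) x - x := rfl

/-- The topological properties of a representation of `Γ = ℤ_p` that are used: it is Hausdorff,
the action is jointly continuous, and continuous functions on `ℤ_p` have indefinite sums. All of
them are inherited by the coinduced representation. -/
structure IsSummable (X : TopRep.{u} R (Multiplicative ℤ_[p])) : Prop where
  t2 : T2Space X
  continuous_action : Continuous fun q : Multiplicative ℤ_[p] × X => X.ρ q.1 q.2
  sum : HasIndefiniteSum p R X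

instance : LocallyCompactSpace (Multiplicative ℤ_[p]) :=
  inferInstanceAs (LocallyCompactSpace ℤ_[p])

variable {X : TopRep.{u} R (Multiplicative ℤ_[p])}

theorem IsSummable.coind₁ (h : IsSummable X) : IsSummable X.coind₁ where
  t2 := by
    have := h.t2
    infer_instance
  continuous_action := by
    refine ContinuousMap.continuous_of_continuous_uncurry _ ?_
    have h1 : Continuous fun q : (Multiplicative ℤ_[p] × C(Multiplicative ℤ_[p], X)) ×
        Multiplicative ℤ_[p] => q.1.2 (q.1.1⁻¹ * q.2) := by fun_prop
    exact h.continuous_action.comp ((continuous_fst.comp continuous_fst).prodMk h1)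
  sum := h.sum.continuousMap (Multiplicative ℤ_[p])

theorem IsSummable.resolutionX (h : IsSummable X) : ∀ n, IsSummable (resolutionX X n)
  | 0 => h
  | n + 1 => (h.resolutionX n).coind₁

/-- As `γ` generates a dense subgroup, its fixed vectors are invariant under `Γ`. -/
theorem IsSummable.mem_invariants (h : IsSummable X) {x : X} (hx : genSub X x = 0) :
    x ∈ X.ρ.invariants := by
  have := h.t2
  have h1 : X.ρ (gen p) x = x := sub_eq_zero.mp hx
  have h2 : ∀ m : ℕ, X.ρ (Multiplicative.ofAdd (m : ℤ_[p])) x = x := by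
    intro m
    induction m with
    | zero => simp
    | succ m ih =>
      rw [Nat.cast_add_one, ofAdd_add, map_mul, mul_apply_eq_comp, h1, ih]
  have h3 : Continuous fun a : ℤ_[p] => X.ρ (Multiplicative.ofAdd a) x :=
    h.continuous_action.comp (continuous_ofAdd.prodMk continuous_const)
  intro g
  exact congrFun (PadicInt.denseRange_natCast.equalizer h3 continuous_const (funext h2)) g.toAdd

/-- On a coinduced representation `γ - 1` has a linear right inverse: with `E` an indefinite sum of
`a ↦ γ^a F(γ^(-a))`, it is `g ↦ g E(g⁻¹)`. -/
theorem IsSummable.exists_rightInverse (h : IsSummable X) :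
    ∃ P : X.coind₁ →ₗ[R] X.coind₁, ∀ F, genSub X.coind₁ (P F) = F := by
  obtain ⟨Sop, -, hS⟩ := h.sum
  have hcont : ∀ F : C(Multiplicative ℤ_[p], X), Continuous fun a : ℤ_[p] =>
      X.ρ (Multiplicative.ofAdd a) (F (Multiplicative.ofAdd (-a))) := fun F =>
    h.continuous_action.comp (continuous_ofAdd.prodMk
      (F.continuous.comp (continuous_ofAdd.comp continuous_neg)))
  let w : C(Multiplicative ℤ_[p], X) →ₗ[R] C(ℤ_[p], X) :=
    { toFun := fun F => ⟨_, hcont F⟩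
      map_add' := fun F F' => by ext a; simp
      map_smul' := fun r F => by ext a; simp }
  have hcont' : ∀ E : C(ℤ_[p], X), Continuous fun g : Multiplicative ℤ_[p] =>
      X.ρ g (E (-g.toAdd)) := fun E =>
    h.continuous_action.comp (continuous_id.prodMk
      (E.continuous.comp (continuous_neg.comp continuous_toAdd)))
  let v : C(ℤ_[p], X) →ₗ[R] C(Multiplicative ℤ_[p], X) :=
    { toFun := fun E => ⟨_, hcont' E⟩
      map_add' := fun F F' => by ext a; simp
      map_smul' := fun r F => by ext a; simp }
  refine ⟨v ∘ₗ Sop ∘ₗ w, fun F => ContinuousMap.ext fun g => ?_⟩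
  have h1 := hS (w F) (-g.toAdd)
  have h2 : w F (-g.toAdd) = X.ρ g⁻¹ (F g) := by
    change X.ρ (Multiplicative.ofAdd (-g.toAdd)) (F (Multiplicative.ofAdd (- -g.toAdd))) = _
    rw [neg_neg]
    rfl
  have h3 : X.ρ (gen p) (X.ρ ((gen p)⁻¹ * g) (Sop (w F) (-((gen p)⁻¹ * g).toAdd))) =
      X.ρ g (Sop (w F) (-g.toAdd + 1)) := by
    rw [← mul_apply_eq_comp, ← map_mul, mul_inv_cancel_left]
    congr 2
    simp [add_comm]
  change X.ρ (gen p) (X.ρ ((gen p)⁻¹ * g) (Sop (w F) (-((gen p)⁻¹ * g).toAdd))) -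
    X.ρ g (Sop (w F) (-g.toAdd)) = F g
  rw [h3, ← map_sub, h1, h2, ← mul_apply_eq_comp, ← map_mul, mul_inv_cancel, map_one]
  rfl

end Regular

/-! ### A contraction of the invariants of the standard resolution -/

section Contraction

open TopRep

variable {p : ℕ} [Fact p.Prime] {R : Type u} [CommRing R] [TopologicalSpace R]
  (X : TopRep.{u} R (Multiplicative ℤ_[p]))

/-- The differential of the resolution `X → C(Γ, X) → C(Γ, C(Γ, X)) → ⋯` as a linear map. -/
def resD (n : ℕ) : resolutionX X n →ₗ[R] resolutionX X (n + 1) :=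
  (TopRep.d X n).hom.toContinuousLinearMap.toLinearMap

/-- Evaluation at `1`, a (non-equivariant) contraction of the resolution. -/
def resEval (n : ℕ) : resolutionX X (n + 1) →ₗ[R] resolutionX X n where
  toFun f := (f : C(Multiplicative ℤ_[p], resolutionX X n)) 1
  map_add' _ _ := rfl
  map_smul' _ _ := rfl

theorem resEval_resD_zero (x : resolutionX X 0) : resEval X 0 (resD X 0 x) = x := rfl

theorem resEval_resD_succ (n : ℕ) (x : resolutionX X (n + 1)) :
    resEval X (n + 1) (resD X (n + 1) x) = x - resD X n (resEval X n x) := rfl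

theorem resD_resD (n : ℕ) (x : resolutionX X n) : resD X (n + 1) (resD X n x) = 0 :=
  congrArg (fun f => f.hom x) (TopRep.d_comp_d X n)

theorem genSub_resD (n : ℕ) (x : resolutionX X n) :
    genSub _ (resD X n x) = resD X n (genSub _ x) := by
  rw [genSub_apply, genSub_apply, map_sub]
  exact congrArg (· - _) ((TopRep.d X n).hom.isIntertwining (gen p) x).symm

variable {X} {P : ∀ n, resolutionX X n →ₗ[R] resolutionX X n}

/-- Given right inverses `P` of `γ - 1` up to `c` on the resolution, this is the contraction of
the complex of invariants in positive degrees, up to `c`. With `s` the evaluation at `1` it is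
`c s - d P s (γ - 1) s + P s (γ - 1) s d`: the first term satisfies the homotopy identity because
`s d + d s = 1`, but does not preserve invariants, and the other two repair this without affecting
the homotopy identity. -/
def invHomotopyAux (c : R) (P : ∀ n, resolutionX X n →ₗ[R] resolutionX X n) (n : ℕ) :
    resolutionX X (n + 2) →ₗ[R] resolutionX X (n + 1) :=
  c • resEval X (n + 1) -
    resD X n ∘ₗ P n ∘ₗ resEval X n ∘ₗ genSub _ ∘ₗ resEval X (n + 1) +
    P (n + 1) ∘ₗ resEval X (n + 1) ∘ₗ genSub _ ∘ₗ resEval X (n + 2) ∘ₗ resD X (n + 2)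

theorem invHomotopyAux_apply (c : R) (n : ℕ) (x : resolutionX X (n + 2)) :
    invHomotopyAux c P n x = c • resEval X (n + 1) x -
      resD X n (P n (resEval X n (genSub _ (resEval X (n + 1) x)))) +
      P (n + 1) (resEval X (n + 1) (genSub _ (resEval X (n + 2) (resD X (n + 2) x)))) := rfl

theorem genSub_eq_zero {Y : TopRep.{u} R (Multiplicative ℤ_[p])} {x : Y}
    (hx : x ∈ Y.ρ.invariants) : genSub Y x = 0 := sub_eq_zero.mpr (hx _)

theorem resEval_genSub_resEval_resD (n : ℕ) {x : resolutionX X (n + 2)}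
    (hx : x ∈ (resolutionX X (n + 2)).ρ.invariants) :
    resEval X (n + 1) (genSub _ (resEval X (n + 2) (resD X (n + 2) x))) =
      -(genSub _ (resEval X (n + 1) x) -
        resD X n (resEval X n (genSub _ (resEval X (n + 1) x)))) := by
  rw [resEval_resD_succ, map_sub, genSub_eq_zero hx, zero_sub, map_neg, genSub_resD,
    resEval_resD_succ]

/-- The contraction maps invariants to vectors fixed by `γ`. -/
theorem genSub_invHomotopyAux {c : R} (hP : ∀ n x, genSub _ (P n x) = c • x) (n : ℕ)
    {x : resolutionX X (n + 2)} (hx : x ∈ (resolutionX X (n + 2)).ρ.invariants) :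
    genSub _ (invHomotopyAux c P n x) = 0 := by
  rw [invHomotopyAux_apply, map_add, map_sub, map_smul, genSub_resD, hP, hP, map_smul,
    resEval_genSub_resEval_resD n hx, smul_neg, smul_sub]
  abel

/-- The homotopy identity in positive degrees. -/
theorem resD_invHomotopyAux {c : R} (n : ℕ) {x : resolutionX X (n + 2)} :
    resD X (n + 1) (invHomotopyAux c P n x) + invHomotopyAux c P (n + 1) (resD X (n + 2) x) =
      c • x := by
  rw [invHomotopyAux_apply, invHomotopyAux_apply, map_add, map_sub, resD_resD, resD_resD,
    map_zero, map_zero, map_zero, map_zero, map_smul, resEval_resD_succ X (n + 1), smul_sub]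
  abel

/-- The homotopy identity in degree zero, where the retraction `e` onto `R • u` appears. -/
theorem invHomotopyAux_zero {c : R} {u : X} {e : X →ₗ[R] R}
    (hH : ∀ m, P 0 (genSub X m) = c • (m - e m • u)) {x : resolutionX X 1}
    (hx : x ∈ (resolutionX X 1).ρ.invariants) :
    invHomotopyAux c P 0 (resD X 1 x) = c • x - c • e (resEval X 0 x) • resD X 0 u := by
  have h1 : resEval X 0 (genSub _ (resEval X 1 (resD X 1 x))) = -genSub X (resEval X 0 x) := by
    rw [resEval_resD_succ, map_sub, genSub_eq_zero hx, zero_sub, map_neg, genSub_resD]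
    rfl
  have h2 : P 0 (-genSub X (resEval X 0 x)) = -(c • (resEval X 0 x - e (resEval X 0 x) • u)) :=
    (map_neg _ _).trans (congrArg _ (hH _))
  rw [invHomotopyAux_apply, resD_resD, map_zero, map_zero, map_zero, map_zero, add_zero, h1, h2,
    resEval_resD_succ, map_neg, map_smul, map_sub, smul_sub, smul_sub]
  have h3 : resD X 0 (e (resEval X 0 x) • u) = e (resEval X 0 x) • resD X 0 u := map_smul _ _ _
  rw [h3]
  abel

end Contraction

/-! ### Localization of maps that are invertible up to a scalar -/

section LocalizedModules

variable {R : Type*} [CommRing R] (s : Submonoid R) {M N : Type*}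
  [AddCommGroup M] [Module R M] [AddCommGroup N] [Module R N]

theorem localizedModule_map_map {f : M →ₗ[R] N} {g : N →ₗ[R] M} {c : R}
    (h : ∀ x, g (f x) = c • x) (x : LocalizedModule s M) :
    LocalizedModule.map s g (LocalizedModule.map s f x) = algebraMap R (Localization s) c • x := by
  induction x using LocalizedModule.induction_on with
  | h m t =>
    have e1 : LocalizedModule.map s f (LocalizedModule.mk m t) = LocalizedModule.mk (f m) t :=
      IsLocalizedModule.map_LocalizedModules s f m t
    have e2 : LocalizedModule.map s g (LocalizedModule.mk (f m) t) =
        LocalizedModule.mk (g (f m)) t :=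
      IsLocalizedModule.map_LocalizedModules s g (f m) t
    rw [e1, e2, h, algebraMap_smul, LocalizedModule.smul'_mk]

/-- Linear maps that are mutually inverse up to a scalar `c` become bijective in a localization in
which `c` is invertible. -/
theorem bijective_localizedModule_map {f : M →ₗ[R] N} {g : N →ₗ[R] M}
    {c : R} (hgf : ∀ x, g (f x) = c • x) (hfg : ∀ x, f (g x) = c • x)
    (hc : IsUnit (algebraMap R (Localization s) c)) :
    Function.Bijective (LocalizedModule.map s f) := by
  obtain ⟨a, ha⟩ := hc.exists_left_inv
  refine ⟨fun x y hxy => ?_, fun y => ⟨a • LocalizedModule.map s g y, ?_⟩⟩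
  · have h := congrArg (fun z => a • LocalizedModule.map s g z) hxy
    simpa only [localizedModule_map_map s hgf, smul_smul, ha, one_smul] using h
  · rw [map_smul, localizedModule_map_map s hfg, smul_smul, ha, one_smul]

end LocalizedModules

/-! ### Mapping cones of maps that are invertible up to a scalar -/

section MappingCone

open Pretriangulated

open Limits in
/-- If the first morphism of a distinguished triangle is invertible up to a scalar `c` then `c ^ 2`
kills the third object. -/
theorem sq_smul_eq_zero_of_distinguished {R : Type*} [CommRing R] {C : Type*} [Category* C]
    [Preadditive C] [HasZeroObject C] [HasShift C ℤ] [∀ n : ℤ, (shiftFunctor C n).Additive]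
    [Pretriangulated C] [Linear R C] [(shiftFunctor C (1 : ℤ)).Linear R] (T : Triangle C)
    (hT : T ∈ distTriang C) (r : T.obj₂ ⟶ T.obj₁) (c : R) (h₁ : T.mor₁ ≫ r = c • 𝟙 _)
    (h₂ : r ≫ T.mor₁ = c • 𝟙 _) : c ^ 2 • 𝟙 T.obj₃ = 0 := by
  have h12 := comp_distTriang_mor_zero₁₂ T hT
  have h31 := comp_distTriang_mor_zero₃₁ T hT
  have k2 : c • T.mor₂ = 0 := by
    have : (r ≫ T.mor₁) ≫ T.mor₂ = 0 := by
      rw [Category.assoc, h12, Limits.comp_zero]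
    rwa [h₂, Linear.smul_comp, Category.id_comp] at this
  have k3 : c • T.mor₃ = 0 := by
    have : T.mor₃ ≫ (T.mor₁ ≫ r)⟦(1 : ℤ)⟧' = 0 := by
      rw [Functor.map_comp, ← Category.assoc, h31, Limits.zero_comp]
    rwa [h₁, Functor.map_smul, CategoryTheory.Functor.map_id, Linear.comp_smul,
      Category.comp_id] at this
  obtain ⟨φ, hφ⟩ := Triangle.yoneda_exact₃ T hT (c • 𝟙 T.obj₃) (by
    rw [Linear.comp_smul, Category.comp_id, k2])
  rw [pow_two, mul_smul, hφ, ← Linear.smul_comp, k3, Limits.zero_comp]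

/-- If a map of complexes has a homotopy inverse up to a scalar `c`, then `c ^ 2` kills its mapping
cone in the derived category. -/
theorem sq_smul_mappingCone_eq_zero {R : Type*} [CommRing R] {C : Type*} [Category* C] [Abelian C]
    [Linear R C] [HasDerivedCategory.{w} C] {K L : CochainComplex C ℤ} (f : K ⟶ L) (r : L ⟶ K)
    (c : R) (hfr : f ≫ r = c • 𝟙 K) (hrf : Homotopy (r ≫ f) (c • 𝟙 L)) :
    c ^ 2 • 𝟙 (DerivedCategory.Q.obj (CochainComplex.mappingCone f)) = 0 := by
  have hfr' : DerivedCategory.Q.map f ≫ DerivedCategory.Q.map r = c • 𝟙 _ := by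
    rw [← Functor.map_comp, hfr, Functor.map_smul, CategoryTheory.Functor.map_id]
  have hrf' : DerivedCategory.Q.map r ≫ DerivedCategory.Q.map f = c • 𝟙 _ := by
    rw [← Functor.map_comp, DerivedCategory.Q_map_eq_of_homotopy C hrf, Functor.map_smul,
      CategoryTheory.Functor.map_id]
  exact sq_smul_eq_zero_of_distinguished _
    (DerivedCategory.mappingCone_triangle_distinguished f) (DerivedCategory.Q.map r) c hfr' hrf'

end MappingCone

/-! ### Homotopy equivalence up to a scalar with a complex in degree zero -/

section SingleZero

variable {R : Type u} [CommRing R]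

/-- A cochain complex with a contraction, up to a scalar `c` and apart from a module `A` in degree
zero, is homotopy equivalent to `A` up to `c`. -/
theorem exists_homotopyInverse {D : CochainComplex (ModuleCat.{u} R) ℕ} {A : ModuleCat.{u} R}
    (ψ : A ⟶ D.X 0) (hψ : ∀ k, (ComplexShape.up ℕ).Rel 0 k → ψ ≫ D.d 0 k = 0) (φ : D.X 0 ⟶ A)
    (h : ∀ n, D.X (n + 1) ⟶ D.X n) (c : R) (h1 : ψ ≫ φ = c • 𝟙 A)
    (h2 : D.d 0 1 ≫ h 0 = c • 𝟙 _ - φ ≫ ψ)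
    (h3 : ∀ n, D.d (n + 1) (n + 2) ≫ h (n + 1) + h n ≫ D.d n (n + 1) = c • 𝟙 _) :
    ∃ r : D ⟶ (CochainComplex.single₀ (ModuleCat.{u} R)).obj A,
      HomologicalComplex.mkHomFromSingle ψ hψ ≫ r = c • 𝟙 _ ∧
      Nonempty (Homotopy (r ≫ HomologicalComplex.mkHomFromSingle ψ hψ) (c • 𝟙 D)) := by
  have hφ : ∀ i, (ComplexShape.up ℕ).Rel i 0 → D.d i 0 ≫ φ = 0 := fun i hi =>
    absurd hi (Nat.succ_ne_zero i)
  refine ⟨HomologicalComplex.mkHomToSingle φ hφ, ?_, ⟨?_⟩⟩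
  · refine HomologicalComplex.from_single_hom_ext ?_
    rw [HomologicalComplex.comp_f, HomologicalComplex.mkHomFromSingle_f,
      HomologicalComplex.mkHomToSingle_f, Category.assoc, reassoc_of% h1, Linear.smul_comp,
      Linear.comp_smul, Category.id_comp, Iso.hom_inv_id]
    rfl
  · let h' : ∀ i j, (ComplexShape.up ℕ).Rel j i → (D.X i ⟶ D.X j) := fun i j hij =>
      eqToHom (congrArg D.X hij.symm) ≫ h j
    have e : c • 𝟙 D - HomologicalComplex.mkHomToSingle φ hφ ≫
        HomologicalComplex.mkHomFromSingle ψ hψ = Homotopy.nullHomotopicMap' h' := by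
      ext1 i
      cases i with
      | zero =>
        rw [Homotopy.nullHomotopicMap'_f_of_not_rel_right (k₁ := 0) (k₀ := 1) rfl
          (fun l => Nat.succ_ne_zero l), HomologicalComplex.sub_f_apply, HomologicalComplex.comp_f,
          HomologicalComplex.mkHomFromSingle_f, HomologicalComplex.mkHomToSingle_f]
        simp only [h', eqToHom_refl, Category.id_comp, h2, Category.assoc,
          Iso.inv_hom_id_assoc]
        rfl
      | succ n =>
        rw [Homotopy.nullHomotopicMap'_f (k₁ := n + 1) (k₀ := n + 2) (k₂ := n) rfl rfl,
          HomologicalComplex.sub_f_apply, HomologicalComplex.comp_f,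
          (HomologicalComplex.isZero_single_obj_X (ComplexShape.up ℕ) 0 A (n + 1)
            (Nat.succ_ne_zero n)).eq_of_src (HomologicalComplex.Hom.f
              (HomologicalComplex.mkHomFromSingle ψ hψ) (n + 1)) 0]
        simp only [h', eqToHom_refl, Category.id_comp, h3, Limits.comp_zero, sub_zero]
        rfl
    exact ((Homotopy.equivSubZero (f := c • 𝟙 D)).symm
      ((Homotopy.ofEq e).trans (Homotopy.nullHomotopy' h'))).symm

end SingleZero

/-! ### Continuous cochains of `Γ` -/

section Cochains

open TopRep

variable {p : ℕ} [Fact p.Prime] {R : Type u} [CommRing R] [TopologicalSpace R]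

/-- The complex of homogeneous continuous cochains of `Γ`, without its topology. -/
abbrev plainCochains (X : TopRep.{u} R (Multiplicative ℤ_[p])) :
    CochainComplex (ModuleCat.{u} R) ℕ :=
  ((forget₂ (TopModuleCat.{u} R) (ModuleCat.{u} R)).mapHomologicalComplex _).obj
    (TopRep.homogeneousCochains X)

theorem plainCochains_d_apply (X : TopRep.{u} R (Multiplicative ℤ_[p])) (n : ℕ)
    (x : (resolutionX X (n + 1)).ρ.invariants) :
    (((plainCochains X).d n (n + 1)).hom x : (resolutionX X (n + 2)).ρ.invariants).1 =
      resD X (n + 1) x.1 :=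
  homogeneousCochains.d_apply X n x

variable {X : TopRep.{u} R (Multiplicative ℤ_[p])}

/-- The contraction of the cochain complex in positive degrees, up to `c`. -/
def invHomotopy (hX : IsSummable X) {c : R} {P : ∀ n, resolutionX X n →ₗ[R] resolutionX X n}
    (hP : ∀ n x, genSub _ (P n x) = c • x) (n : ℕ) :
    (resolutionX X (n + 2)).ρ.invariants →ₗ[R] (resolutionX X (n + 1)).ρ.invariants :=
  (invHomotopyAux c P n).restrict fun _ hx =>
    (hX.resolutionX (n + 1)).mem_invariants (genSub_invHomotopyAux hP n hx)

/-- If `γ - 1` is invertible on `X` up to `c` apart from a summand `R • u`, then the cochain complex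
of `X` is homotopy equivalent to `R` up to `c`. -/
theorem exists_homotopyInverse_cochains (hX : IsSummable X) {u : X} {e : X →ₗ[R] R}
    {H : X →ₗ[R] X} {c : R} (hu : u ∈ X.ρ.invariants) (he : e u = 1)
    (hH : ∀ m, genSub X (H m) = c • m) (hH' : ∀ m, H (genSub X m) = c • (m - e m • u))
    (ψ : ModuleCat.of R R ⟶ (plainCochains X).X 0)
    (hψ : ∀ k, (ComplexShape.up ℕ).Rel 0 k → ψ ≫ (plainCochains X).d 0 k = 0)
    (hψ' : ψ.hom (1 : R) = (⟨ContinuousMap.const _ u,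
      ContinuousCohomology.mem_const_resol₀ X u hu⟩ : (resolutionX X 1).ρ.invariants)) :
    ∃ r : plainCochains X ⟶ (CochainComplex.single₀ (ModuleCat.{u} R)).obj (ModuleCat.of R R),
      HomologicalComplex.mkHomFromSingle ψ hψ ≫ r = c • 𝟙 _ ∧
      Nonempty (Homotopy (r ≫ HomologicalComplex.mkHomFromSingle ψ hψ)
        (c • 𝟙 (plainCochains X))) := by
  choose Q hQ using fun n => (hX.resolutionX n).exists_rightInverse
  -- on `X` itself `γ - 1` is inverted by `H`, on the coinduced terms by indefinite summation
  let P : ∀ n, resolutionX X n →ₗ[R] resolutionX X n := fun n =>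
    match n with
    | 0 => H
    | n + 1 => c • Q n
  have hP : ∀ n x, genSub _ (P n x) = c • x := by
    intro n x
    cases n with
    | zero => exact hH x
    | succ n => exact (map_smul _ _ _).trans (congrArg (c • ·) (hQ n x))
  let φ : (resolutionX X 1).ρ.invariants →ₗ[R] R :=
    c • e ∘ₗ resEval X 0 ∘ₗ (resolutionX X 1).ρ.invariants.subtype
  have hψ1 : ∀ s : R, (ψ.hom s : (resolutionX X 1).ρ.invariants).1 = s • resD X 0 u := by
    intro s
    have h1 : ψ.hom s = s • ψ.hom (1 : R) := by rw [← map_smul, smul_eq_mul, mul_one]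
    rw [h1, hψ']
    rfl
  refine exists_homotopyInverse ψ hψ (ModuleCat.ofHom φ)
    (fun n => ModuleCat.ofHom (invHomotopy hX hP n)) c ?_ ?_ fun n => ?_
  · refine ModuleCat.hom_ext (LinearMap.ext_ring ?_)
    change c • e (resEval X 0 (ψ.hom (1 : R) : (resolutionX X 1).ρ.invariants).1) = c • (1 : R)
    rw [hψ1, one_smul, resEval_resD_zero, he]
  · refine ModuleCat.hom_ext (LinearMap.ext fun x => Subtype.ext ?_)
    change invHomotopyAux c P 0
      (((plainCochains X).d 0 1).hom x : (resolutionX X 2).ρ.invariants).1 =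
      c • x.1 - (ψ.hom (φ x) : (resolutionX X 1).ρ.invariants).1
    have hd := plainCochains_d_apply X 0 x
    refine (congrArg (invHomotopyAux c P 0) hd).trans ((invHomotopyAux_zero hH' x.2).trans ?_)
    exact congrArg (c • x.1 - ·) ((smul_assoc c _ _).symm.trans (hψ1 _).symm)
  · refine ModuleCat.hom_ext (LinearMap.ext fun x => Subtype.ext ?_)
    change invHomotopyAux c P (n + 1)
        (((plainCochains X).d (n + 1) (n + 2)).hom x : (resolutionX X (n + 3)).ρ.invariants).1 +
      (((plainCochains X).d n (n + 1)).hom (invHomotopy hX hP n x) :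
        (resolutionX X (n + 2)).ρ.invariants).1 = c • x.1
    have hd := congrArg (invHomotopyAux c P (n + 1)) (plainCochains_d_apply X (n + 1) x)
    have hd' := plainCochains_d_apply X n (invHomotopy hX hP n x)
    exact (congrArg₂ (· + ·) hd hd').trans ((add_comm _ _).trans (resD_invHomotopyAux n))

end Cochains

/-! ### Representations on adically complete modules -/

section AdicRepresentations

open Topology

variable {p : ℕ} [Fact p.Prime] {R : Type u} [CommRing R] [TopologicalSpace R]

/-- A representation of `Γ` on a complete module with its adic topology is summable once its orbit
maps are continuous. -/
theorem isSummable_of_adic {I : Ideal R} {M : Type u} [AddCommGroup M] [Module R M]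
    [TopologicalSpace M] [IsTopologicalAddGroup M] [ContinuousSMul R M] [IsAdicComplete I M]
    (hb : (𝓝 (0 : M)).HasBasis (fun _ => True) fun n : ℕ => ((I ^ n • ⊤ : Submodule R M) : Set M))
    (hp : (p : R) ∈ I) (ρ : ContRepresentation R (Multiplicative ℤ_[p]) M)
    (hρ : ∀ (n : ℕ) (m : M), ∃ j : ℕ, ∀ a : ℤ_[p], (p : ℤ_[p]) ^ j ∣ a →
      ρ (Multiplicative.ofAdd a) m - m ∈ (I ^ n • ⊤ : Submodule R M)) :
    IsSummable (TopRep.of ρ) := by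
  refine ⟨adic_t2Space hb, ?_, hasIndefiniteSum_of_adic hb hp⟩
  refine continuous_iff_continuousAt.mpr fun ⟨g₀, m₀⟩ => (adic_tendsto_iff hb).mpr fun n => ?_
  obtain ⟨j, hj⟩ := hρ n m₀
  have h1 : ∀ᶠ q : Multiplicative ℤ_[p] × M in 𝓝 (g₀, m₀),
      (p : ℤ_[p]) ^ j ∣ q.1.toAdd - g₀.toAdd := by
    have hc : ContinuousAt (fun q : Multiplicative ℤ_[p] × M => q.1.toAdd) (g₀, m₀) :=
      (continuous_toAdd.comp continuous_fst).continuousAt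
    exact hc.eventually (padic_eventually_dvd_sub j g₀.toAdd)
  have h2 : ∀ᶠ q : Multiplicative ℤ_[p] × M in 𝓝 (g₀, m₀),
      q.2 - m₀ ∈ (I ^ n • ⊤ : Submodule R M) :=
    (adic_tendsto_iff hb).mp (continuous_snd.tendsto (g₀, m₀)) n
  filter_upwards [h1, h2] with q hq1 hq2
  have e1 : ρ q.1 q.2 - ρ g₀ m₀ = ρ q.1 (q.2 - m₀) +
      ρ g₀ (ρ (Multiplicative.ofAdd (q.1.toAdd - g₀.toAdd)) m₀ - m₀) := by
    rw [map_sub, map_sub, ← mul_apply_eq_comp, ← map_mul, ofAdd_sub, ofAdd_toAdd, ofAdd_toAdd,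
      mul_div_cancel]
    abel
  change ρ q.1 q.2 - ρ g₀ m₀ ∈ _
  rw [e1]
  exact add_mem (Submodule.smul_top_le_comap_smul_top _ (ρ q.1 : M →ₗ[R] M) hq2)
    (Submodule.smul_top_le_comap_smul_top _ (ρ g₀ : M →ₗ[R] M) (hj _ hq1))

end AdicRepresentations

/-! ### The unit map into the cohomology of `B^+ ⊗̂_S R` -/

section GaloisCohomology

open TensorProduct Topology

variable {p : ℕ} [Fact p.Prime] (ε : RootSystem p) (R : Type u) [CommRing R] [Algebra (S p) R]

/-- The representation `B^+ ⊗̂_S R` of `Γ` is summable. -/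
theorem isSummable_galoisRep :
    letI : TopologicalSpace R := (Ideal.span {(p : R)}).adicTopology
    IsSummable (galoisRep ε R) := by
  let _ : WithIdeal R := ⟨Ideal.span {(p : R)}⟩
  let _ : TopologicalSpace (BHat p R) := WithIdeal.topologicalSpaceModule R (BHat p R)
  have : IsAdicComplete (Ideal.span {(p : R)}) (BHat p R) :=
    AdicCompletion.isAdicComplete ⟨{(p : R)}, by simp⟩
  exact isSummable_of_adic (M := BHat p R)
    (adic_hasBasis_nhds_zero (Ideal.span {(p : R)}) (BHat p R)) (Ideal.mem_span_singleton_self _) _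
    (exists_gammaHat_sub_mem ε R)

/-- `R → RΓ(Γ, B^+ ⊗̂_S R)` has a homotopy inverse up to `c`. -/
theorem exists_homotopyInverse_unitMap [IsAdicComplete (Ideal.span {(p : R)}) R] :
    ∃ r : cochains ε R ⟶ (CochainComplex.single₀ (ModuleCat.{u} R)).obj (ModuleCat.of R R),
      unitMap ε R ≫ r = algebraMap (S p) R (cElt ε) • 𝟙 _ ∧
      Nonempty (Homotopy (r ≫ unitMap ε R) (algebraMap (S p) R (cElt ε) • 𝟙 (cochains ε R))) := by
  let _ : TopologicalSpace R := (Ideal.span {(p : R)}).adicTopology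
  obtain ⟨H, e, he, h1, h2⟩ := exists_homotopy_bHat ε R
  exact exists_homotopyInverse_cochains (isSummable_galoisRep ε R) (e := e) (H := H)
    (fun g => gammaHat_one ε R g.toAdd) he h1 h2 (unitCochain ε R) _ (one_smul R _)

/-- The homotopy inverse up to `c` for complexes indexed by `ℤ`. -/
theorem exists_homotopyInverse_unitMapInt [IsAdicComplete (Ideal.span {(p : R)}) R] :
    ∃ r, unitMapInt ε R ≫ r = algebraMap (S p) R (cElt ε) • 𝟙 _ ∧
      Nonempty (Homotopy (r ≫ unitMapInt ε R) (algebraMap (S p) R (cElt ε) • 𝟙 _)) := by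
  obtain ⟨r, h1, ⟨h2⟩⟩ := exists_homotopyInverse_unitMap ε R
  have hsmul : ∀ (K : CochainComplex (ModuleCat.{u} R) ℕ) (c : R),
      HomologicalComplex.extendMap (c • 𝟙 K) ComplexShape.embeddingUpNat = c • 𝟙 _ := by
    intro K c
    ext1 i
    by_cases hi : ∃ j, ComplexShape.embeddingUpNat.f j = i
    · obtain ⟨j, hj⟩ := hi
      rw [HomologicalComplex.extendMap_f _ _ hj]
      simp
    · exact (HomologicalComplex.isZero_extend_X _ _ _ (not_exists.mp hi)).eq_of_src _ _
  refine ⟨HomologicalComplex.extendMap r ComplexShape.embeddingUpNat, ?_, ⟨?_⟩⟩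
  · rw [unitMapInt, ← HomologicalComplex.extendMap_comp, h1, hsmul]
  · refine (Homotopy.ofEq ?_).trans ((h2.extend ComplexShape.embeddingUpNat).trans
      (Homotopy.ofEq (hsmul _ _)))
    rw [unitMapInt, ← HomologicalComplex.extendMap_comp]

end GaloisCohomology

/-! ### Scalars on homology -/

section Conclusion

theorem homologyMap_smul_id {R : Type u} [CommRing R] (K : CochainComplex (ModuleCat.{u} R) ℤ)
    (c : R) (i : ℤ) (x : K.homology i) :
    (HomologicalComplex.homologyMap (c • 𝟙 K) i).hom x = c • x := by
  have h : HomologicalComplex.homologyMap (c • 𝟙 K) i = c • 𝟙 _ := by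
    have h1 := ShortComplex.homologyMap_smul
      ((HomologicalComplex.shortComplexFunctor (ModuleCat.{u} R) _ i).map (𝟙 K)) c
    rw [CategoryTheory.Functor.map_id, ShortComplex.homologyMap_id] at h1
    exact h1
  rw [h]
  rfl

end Conclusion

end GaloisB

end

theorem theoremt (p : ℕ) [Fact p.Prime] (ε : GaloisB.RootSystem p) :
    ∃ n : ℕ, ∀ (R : Type u) [CommRing R] [Algebra (GaloisB.S p) R]
      [IsAdicComplete (Ideal.span {(p : R)}) R] [HasDerivedCategory.{w} (ModuleCat.{u} R)],
      (algebraMap (GaloisB.S p) R (GaloisB.cElt ε) * (p : R)) ^ n •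
          𝟙 (GaloisB.cofiber ε R) = 0 ∧
      (IsUnit (algebraMap R (Localization.Away (p : R))
          (algebraMap (GaloisB.S p) R (GaloisB.cElt ε))) →
        ∀ i : ℤ, Function.Bijective (LocalizedModule.map (Submonoid.powers (p : R))
          (HomologicalComplex.homologyMap (GaloisB.unitMapInt ε R) i).hom)) := by
  -- one factor `c` for each of the two arrows next to the cone in the exact triangle
  refine ⟨2, fun R _ _ _ _ => ?_⟩
  obtain ⟨r, h1, ⟨h2⟩⟩ := GaloisB.exists_homotopyInverse_unitMapInt ε R
  constructor
  · have h : algebraMap (GaloisB.S p) R (GaloisB.cElt ε) ^ 2 • 𝟙 (GaloisB.cofiber ε R) = 0 :=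
      GaloisB.sq_smul_mappingCone_eq_zero _ r _ h1 h2
    rw [mul_pow, mul_comm, mul_smul, h, smul_zero]
  · intro hc i
    refine GaloisB.bijective_localizedModule_map _
      (g := (HomologicalComplex.homologyMap r i).hom) (fun x => ?_) (fun x => ?_) hc
    · rw [← GaloisB.homologyMap_smul_id, ← h1, HomologicalComplex.homologyMap_comp]
      rfl
    · rw [← GaloisB.homologyMap_smul_id, ← h2.homologyMap_eq, HomologicalComplex.homologyMap_comp]
      rfl
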